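/- **Setting.** Let $I_1,I_2,I_3,I_4$ be finite index sets (massless vector fields, massive vector fields, physical scalar fields, Dirac fields). The free fields are: vector fields $v_a^\mu$ and ghosts $u_a,\tilde u_a$ for $a\in I_1\cup I_2$, of mass $m_a$, where $m_a=0$ on $I_1$ and $m_a>0$ on $I_2$; scalar fields $\Phi_c$ for $c\in I_2\cup I_3$ of mass $m_c$ ($\Phi_j=\phi_j$ for $j\in I_3$); Dirac fields $\psi_A,\bar\psi_A$, $A\in I_4$, of mass $M_A$. The ghosts and the Dirac fields are odd, the others even; $u$ has ghost number $1$, $\tilde u$ has ghost number $-1$, the others $0$; the Dirac fields have canonical dimension $3/2$, the others $1$, and each derivative adds $1$. Wick polynomials are the polynomials in the fields and their derivatives modulo graded commutativity, the Klein-Gordon equations $(\square+m^2)\xi=0$ for $v,u,\tilde u,\Phi$, and the Dirac equations $i\gamma^\mu\partial_\mu\psi=M\psi$, $i\partial_\mu\bar\psi\gamma^\mu=-M\bar\psi$. The metric is $\mathrm{diag}(1,-1,-1,-1)$; $\gamma_\mu$ are $4\times4$ matrices with $\{\gamma_\mu,\gamma_\nu\}=2\eta_{\mu\nu}$; $\gamma_5=i\gamma_0\gamma_1\gamma_2\gamma_3$,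 $\gamma_\epsilon=\frac12(1+\epsilon\gamma_5)$, $\epsilon=\pm$. Repeated indices are summed. $F_a^{\mu\nu}=\partial^\mu v_a^\nu-\partial^\nu v_a^\mu$. The gauge charge $d_Q$ is the odd derivation commuting with derivatives with $$d_Qv_a^\mu=i\partial^\mu u_a,\quad d_Qu_a=0,\quad d_Q\tilde u_a=-i(\partial_\mu v_a^\mu+m_a\Phi_a),\quad d_Q\Phi_a=im_au_a\ (a\in I_2),\quad d_Q\phi_j=0,\quad d_Q\psi=d_Q\bar\psi=0 .$$ **Interaction.** The coupling constants are complex: $f_{abc}$ ($a,b,c\in I_1\cup I_2$), $f'_{cda}$ ($c,d\in I_2\cup I_3$, $a\in I_1\cup I_2$), $f''_{cde}$ ($c,d,e\in I_2\cup I_3$; $f''_{jkl}=\lambda_{jkl}$ on $I_3$), and matrices $t_a^\epsilon$, $s_c^\epsilon$ acting on the index of the Dirac fields. With $j_a^\mu=\sum_\epsilon\bar\psi\,t_a^\epsilon\otimes\gamma^\mu\gamma_\epsilon\psi$ and $j_c=\sum_\epsilon\bar\psi\,s_c^\epsilon\otimes\gamma_\epsilon\psi$, put $$T=f_{abc}\bigl(\tfrac12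 v_{a\mu}v_{b\nu}F_c^{\nu\mu}+u_av_b^\mu\partial_\mu\tilde u_c\bigr)+f'_{abc}\Phi_a\partial_\mu\Phi_b\,v_c^\mu+\sum_{b\in I_2}m_bf'_{abc}\bigl(-\Phi_av_{b\mu}v_c^\mu+\Phi_a\tilde u_bu_c\bigr)+\tfrac16f''_{abc}\Phi_a\Phi_b\Phi_c+j_a^\mu v_{a\mu}+j_c\Phi_c,$$ $$T^\mu=f_{abc}\bigl(u_av_{b\nu}F_c^{\nu\mu}-\tfrac12u_au_b\partial^\mu\tilde u_c\bigr)+j_a^\mu u_a+f'_{abc}\Phi_a\partial^\mu\Phi_b\,u_c-\sum_{b\in I_2}m_bf'_{abc}\Phi_av_b^\mu u_c,\qquad T^{\mu\nu}=\tfrac12f_{abc}u_au_bF_c^{\mu\nu}.$$ The constants satisfy the relations of a first-order gauge-invariant interaction: $f_{abc}$ is completely antisymmetric, $f'_{cda}=-f'_{dca}$, $f''$ is completely symmetric and, with $f'_{cba}:=0$ for $b\in I_1$: - $m_bf'_{abc}-m_cf'_{acb}=m_af_{abc}$ for $a\in I_2$ and $b,c\in I_1\cup I_2$; - $m_bf'_{jbc}=m_cf'_{jcb}$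 for $j\in I_3$, $b\in I_2$, $c\in I_1\cup I_2$; - $i(M_At_{a,AB}^\epsilon-t_{a,AB}^{-\epsilon}M_B)$ equals $0$ for $a\in I_1$ and $m_as_{a,AB}^\epsilon$ for $a\in I_2$; - $f''_{abc}=0$ for $a,b,c\in I_2$; $f''_{jbc}=\frac{m_j^2}{m_c}f'_{jbc}$ for $j\in I_3$, $b,c\in I_2$; $f''_{jkc}=\frac{m_j^2-m_k^2}{m_c}f'_{jkc}$ for $j,k\in I_3$, $c\in I_2$. **Anomalies.** For a jet variable $\xi$ and a Wick polynomial $A$ let $\xi\cdot A=(-1)^{|\xi||A|}\partial A/\partial\xi$ (left derivative), and define $B_a=\frac12f_{abc}u_bu_c$, $B_a^\mu=\tilde u_{a,\mu}\cdot T$, $D_a=u_a\cdot T$, $D_a^\mu=u_a\cdot T^\mu$, $D_a^{\mu\nu}=u_a\cdot T^{\mu\nu}$, $E_a^{\mu\nu}=v_{a\mu,\nu}\cdot T$, $G_c=\Phi_c\cdot T$, $G_c^\mu=\Phi_c\cdot T^\mu$, $H_c^\mu=\Phi_{c,\mu}\cdot T$, $H_c=-f'_{cda}\Phi_du_a$.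 The gauge variations of the renormalized second-order tree chronological products are $sT^{\rm ren}(T^I(x_1),T^J(x_2))=\delta(x_1-x_2)\,\mathcal A(T^I,T^J)(x_2)$, with $s=d_Q-i\delta$, $\delta$ the divergence operator $T^I\mapsto\partial_\mu T^{I\mu}$ acting with graded signs, and $$\mathcal A(T,T)=-2(B_{a\mu}D_a^\mu+B_aD_a)+E_a^{\mu\nu}D_{a\mu\nu}-2H_cG_c+2H_{c\mu}G_c^\mu+\mathcal A_D(T,T),$$ $$\mathcal A_D(T,T)=-2i\sum_\epsilon u_av_b^\mu\,\bar\psi[t_a^\epsilon,t_b^\epsilon]\otimes\gamma_\mu\gamma_\epsilon\psi-2i\sum_\epsilon u_a\Phi_c\,\bar\psi(t_a^{-\epsilon}s_c^\epsilon-s_c^\epsilon t_a^\epsilon)\otimes\gamma_\epsilon\psi,$$ $$\mathcal A(T^\mu,T)=2(B_aD_a^\mu+B_{a\nu}D_a^{\mu\nu})-2H_cG_c^\mu-i\sum_\epsilon u_au_b\,\bar\psi[t_a^\epsilon,t_b^\epsilon]\otimes\gamma^\mu\gamma_\epsilon\psi,$$ $$\mathcal A(T^\mu,T^\nu)=2B_aD_a^{\mu\nu},\quad\mathcal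 A(T^{\mu\nu},T)=-2B_aD_a^{\mu\nu},\quad\mathcal A(T^J,T^I)=(-1)^{|I||J|}\mathcal A(T^I,T^J),\quad\mathcal A(T^I,T^J)=0\text{ for }|I|+|J|\ge3.$$ A *finite renormalization* (quasi-local cochain) is a family $\delta(x_1-x_2)R(T^I,T^J)(x_2)$, where the $R(T^I,T^J)$ are quadri-linear Wick polynomials of canonical dimension $\le4$ and ghost number $|I|+|J|$, graded symmetric ($R(T^J,T^I)=(-1)^{|I||J|}R(T^I,T^J)$), antisymmetric in the indices of $T^{\mu\nu}$, and zero if $|I|>2$. It *eliminates the anomalies* if $\delta(x_1-x_2)\mathcal A(T^I,T^J)(x_2)+s\bigl(\delta(x_1-x_2)R(T^I,T^J)(x_2)\bigr)=0$ for all $I,J$, i.e. if the anomaly is the coboundary of $-R$. **Theorem.** (a) The anomalies can be eliminated by a finite renormalization if and only if the following hold. (i) Jacobi identity: $f_{eab}f_{ecd}+f_{ebc}f_{ead}+f_{eca}f_{ebd}=0$. (ii) The matrices $(T'_a)_{cd}=-f'_{cda}$, $c,d\in I_2\cup I_3$, satisfy $[T'_a,T'_b]=f_{abc}T'_c$. (iii)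 $[t_a^\epsilon,t_b^\epsilon]=if_{abc}t_c^\epsilon$ for $a,b\in I_1\cup I_2$, and $t_a^{-\epsilon}s_b^\epsilon-s_b^\epsilon t_a^\epsilon=-if'_{cba}s_c^\epsilon$ for $a\in I_1\cup I_2$, $b\in I_2\cup I_3$ (sum over $c$). (iv) For $a\in I_1\cup I_2$ and $b,c,d\in I_2\cup I_3$ let $g_{abcd}=6\,\mathcal S_{bcd}\bigl(f'_{eba}f''_{ecd}\bigr)$, with $\mathcal S_{bcd}$ the normalized symmetrization. Then $g_{abcd}=0$ for $a\in I_1$, and $\frac1{m_a}g_{abcd}=\frac1{m_b}g_{bacd}$ for $a,b\in I_2$, $c,d\in I_2\cup I_3$. (b) If (i)-(iv) hold, there is a completely symmetric tensor $h_{abcd}$, $a,b,c,d\in I_2\cup I_3$, with $h_{abcd}=\frac1{m_a}g_{abcd}$ for $a\in I_2$; and for every such $h$ the finite renormalization $$R(T,T)=\tfrac i{24}\,h_{abcd}\,\Phi_a\Phi_b\Phi_c\Phi_d,\qquad R(T^I,T^J)=0\ \text{ for }|I|+|J|\ge1,$$ eliminates the anomalies. (c) Conversely, every finite renormalization that eliminates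 the anomalies has $R(T,T)=\frac i{24}h_{abcd}\Phi_a\Phi_b\Phi_c\Phi_d$ for some such $h$. -/

import Mathlib

open scoped Matrix

noncomputable section

namespace YM

/-- The Minkowski metric `diag(1,-1,-1,-1)`; `η μ` is the entry `η_{μμ} = η^{μμ}`. -/
def η (μ : Fin 4) : ℂ := if μ = 0 then 1 else -1

/-- The basic fields. Vector (and ghost) indices run over `I₁ ⊕ I₂` (massless and massive vector
fields), scalar indices over `I₂ ⊕ I₃`: `Φ (inl a)` is the scalar ghost `Φ_a` of the massive vector
field `a`, and `Φ (inr j)` is the physical scalar field `φ_j`. `I₄` labels the Dirac fields.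
`v a μ` is the component with upper index, `v_a^μ`; `ut` is the anti-ghost. -/
inductive Fld (I₁ I₂ I₃ I₄ : Type*)
  | v (a : I₁ ⊕ I₂) (μ : Fin 4)
  | u (a : I₁ ⊕ I₂)
  | ut (a : I₁ ⊕ I₂)
  | Φ (c : I₂ ⊕ I₃)
  | ψ (A : I₄) (α : Fin 4)
  | ψbar (A : I₄) (α : Fin 4)

/-- Jet variables: `(ξ, {μ₁,…,μ_r})` stands for `∂_{μ₁}⋯∂_{μ_r} ξ` (derivatives with lower
indices). -/
abbrev Jet (I₁ I₂ I₃ I₄ : Type*) := Fld I₁ I₂ I₃ I₄ × Multiset (Fin 4)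

/-- Expressions in the jet variables, before imposing (anti)commutativity and the equations of
motion; these are imposed in `Params.Wick` below. -/
abbrev Expr (I₁ I₂ I₃ I₄ : Type*) := FreeAlgebra ℂ (Jet I₁ I₂ I₃ I₄)

/-- Masses, Dirac matrices `γ_μ` (lower index) and coupling constants. `f' c d a` is `f'_{cda}` with
`c, d ∈ I₂ ∪ I₃`; `f'' c d e` is the cubic scalar coupling (so that `f''_{jkl} = λ_{jkl}` on `I₃`);
`t a ε` and `s c ε` are the matrices `t_a^ε`, `s_c^ε`, acting on the index of the Dirac fields. -/
structure Params (I₁ I₂ I₃ I₄ : Type*) where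
  m₂ : I₂ → ℝ
  m₃ : I₃ → ℝ
  M : I₄ → ℝ
  γ : Fin 4 → Matrix (Fin 4) (Fin 4) ℂ
  f : I₁ ⊕ I₂ → I₁ ⊕ I₂ → I₁ ⊕ I₂ → ℂ
  f' : I₂ ⊕ I₃ → I₂ ⊕ I₃ → I₁ ⊕ I₂ → ℂ
  f'' : I₂ ⊕ I₃ → I₂ ⊕ I₃ → I₂ ⊕ I₃ → ℂ
  t : I₁ ⊕ I₂ → ℤˣ → Matrix I₄ I₄ ℂ
  s : I₂ ⊕ I₃ → ℤˣ → Matrix I₄ I₄ ℂ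

section General

variable {I₁ I₂ I₃ I₄ : Type*}

/-- Grassmann parity: ghosts, anti-ghosts and Dirac fields are odd. -/
def Fld.odd : Fld I₁ I₂ I₃ I₄ → Bool
  | .v _ _ => false
  | .u _ => true
  | .ut _ => true
  | .Φ _ => false
  | .ψ _ _ => true
  | .ψbar _ _ => true

/-- Ghost number. -/
def Fld.gh : Fld I₁ I₂ I₃ I₄ → ℤ
  | .u _ => 1
  | .ut _ => -1
  | _ => 0

/-- Canonical dimension of a field. -/
def Fld.dim : Fld I₁ I₂ I₃ I₄ → ℚ
  | .ψ _ _ => 3 / 2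
  | .ψbar _ _ => 3 / 2
  | _ => 1

/-- Canonical dimension of a jet variable: each derivative adds one unit. -/
def Jet.dim (x : Jet I₁ I₂ I₃ I₄) : ℚ := x.1.dim + (Multiset.card x.2 : ℚ)

/-- A jet variable as an expression. -/
def jet (ξ : Fld I₁ I₂ I₃ I₄) (s : Multiset (Fin 4)) : Expr I₁ I₂ I₃ I₄ := FreeAlgebra.ι ℂ (ξ, s)

/-- The algebra homomorphism into `2 × 2` matrices whose upper right entry is the graded derivation
with parity `p` and with prescribed values `D` on the jet variables. -/
def derHom (p : Bool) (D : Jet I₁ I₂ I₃ I₄ → Expr I₁ I₂ I₃ I₄) :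
    Expr I₁ I₂ I₃ I₄ →ₐ[ℂ] Matrix (Fin 2) (Fin 2) (Expr I₁ I₂ I₃ I₄) :=
  FreeAlgebra.lift ℂ fun x =>
    !![(if p && x.1.odd then -FreeAlgebra.ι ℂ x else FreeAlgebra.ι ℂ x), D x;
      0, FreeAlgebra.ι ℂ x]

/-- The grading automorphism `A ↦ (-1)^{|A|} A` (for `p = true`; the identity for `p = false`). -/
def grading (p : Bool) : Expr I₁ I₂ I₃ I₄ →ₐ[ℂ] Expr I₁ I₂ I₃ I₄ :=
  FreeAlgebra.lift ℂ fun x => if p && x.1.odd then -FreeAlgebra.ι ℂ x else FreeAlgebra.ι ℂ x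

/-- The graded (left) derivation of parity `p` (`true` = odd) with values `D` on jet variables. -/
def der (p : Bool) (D : Jet I₁ I₂ I₃ I₄ → Expr I₁ I₂ I₃ I₄) :
    Expr I₁ I₂ I₃ I₄ →ₗ[ℂ] Expr I₁ I₂ I₃ I₄ :=
  (Matrix.entryLinearMap ℂ (Expr I₁ I₂ I₃ I₄) (0 : Fin 2) (1 : Fin 2)) ∘ₗ
    (derHom p D).toLinearMap

theorem der_ι (p : Bool) (D : Jet I₁ I₂ I₃ I₄ → Expr I₁ I₂ I₃ I₄) (x : Jet I₁ I₂ I₃ I₄) :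
    der p D (FreeAlgebra.ι ℂ x) = D x := by
  change derHom p D (FreeAlgebra.ι ℂ x) 0 1 = D x
  simp [derHom]

theorem derHom_entries (p : Bool) (D : Jet I₁ I₂ I₃ I₄ → Expr I₁ I₂ I₃ I₄)
    (A : Expr I₁ I₂ I₃ I₄) :
    derHom p D A 0 0 = grading p A ∧ derHom p D A 1 0 = 0 ∧ derHom p D A 1 1 = A := by
  induction A using FreeAlgebra.induction with
  | grade0 r => simp [Matrix.algebraMap_matrix_apply]
  | grade1 x => simp [derHom, grading]
  | mul a b ha hb =>
    simp [Matrix.mul_apply, Fin.sum_univ_two, ha.1, ha.2.1, ha.2.2, hb.1, hb.2.1, hb.2.2]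
  | add a b ha hb => simp [ha.1, ha.2.1, ha.2.2, hb.1, hb.2.1, hb.2.2]

/-- The graded Leibniz rule `δ(AB) = δ(A) B + (-1)^{|δ||A|} A δ(B)`. -/
theorem der_mul (p : Bool) (D : Jet I₁ I₂ I₃ I₄ → Expr I₁ I₂ I₃ I₄) (A B : Expr I₁ I₂ I₃ I₄) :
    der p D (A * B) = der p D A * B + grading p A * der p D B := by
  have hA := derHom_entries p D A
  have hB := derHom_entries p D B
  have h : derHom p D (A * B) 0 1 = derHom p D A 0 1 * B + grading p A * derHom p D B 0 1 := by
    rw [map_mul, Matrix.mul_apply, Fin.sum_univ_two, hA.1, hB.2.2, add_comm]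
  exact h

/-- The total (formal) derivative `d_μ`, lower index. -/
def d (μ : Fin 4) : Expr I₁ I₂ I₃ I₄ →ₗ[ℂ] Expr I₁ I₂ I₃ I₄ :=
  der false fun x => jet x.1 (μ ::ₘ x.2)

open Classical in
/-- The left derivative `∂/∂x` with respect to the jet variable `x`. -/
def pd (x : Jet I₁ I₂ I₃ I₄) : Expr I₁ I₂ I₃ I₄ →ₗ[ℂ] Expr I₁ I₂ I₃ I₄ :=
  der x.1.odd fun y => if y = x then 1 else 0

/-- The Wick submonomial `x · A = (-1)^{|x||A|} ∂A/∂x`. -/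
def sub (ξ : Fld I₁ I₂ I₃ I₄) (s : Multiset (Fin 4)) (A : Expr I₁ I₂ I₃ I₄) :
    Expr I₁ I₂ I₃ I₄ :=
  pd (ξ, s) (grading ξ.odd A)

/-- `v_a^μ` -/
def v (a : I₁ ⊕ I₂) (μ : Fin 4) : Expr I₁ I₂ I₃ I₄ := jet (.v a μ) 0
/-- `v_{aμ}` -/
def vL (a : I₁ ⊕ I₂) (μ : Fin 4) : Expr I₁ I₂ I₃ I₄ := η μ • v a μ
/-- `u_a` -/
def u (a : I₁ ⊕ I₂) : Expr I₁ I₂ I₃ I₄ := jet (.u a) 0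
/-- `ũ_a` -/
def ut (a : I₁ ⊕ I₂) : Expr I₁ I₂ I₃ I₄ := jet (.ut a) 0
/-- `Φ_c` for `c ∈ I₂`, and `φ_c` for `c ∈ I₃` -/
def Φ (c : I₂ ⊕ I₃) : Expr I₁ I₂ I₃ I₄ := jet (.Φ c) 0
/-- `F_a^{μν} = d^μ v_a^ν - d^ν v_a^μ` -/
def F (a : I₁ ⊕ I₂) (μ ν : Fin 4) : Expr I₁ I₂ I₃ I₄ := η μ • d μ (v a ν) - η ν • d ν (v a μ)

end General

namespace Params

variable {I₁ I₂ I₃ I₄ : Type*} (P : Params I₁ I₂ I₃ I₄)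

/-- The masses `m_a` of the vector fields: `m_a = 0` for `a ∈ I₁`. -/
def mV : I₁ ⊕ I₂ → ℝ := Sum.elim (fun _ => 0) P.m₂

/-- The masses of the scalar fields: `Φ_a` has the mass `m_a` of the vector field. -/
def mS : I₂ ⊕ I₃ → ℝ := Sum.elim P.m₂ P.m₃

/-- `f'_{cba}` for a vector index `b`, with the convention that it vanishes for `b ∈ I₁`. -/
def f'V (c : I₂ ⊕ I₃) (b a : I₁ ⊕ I₂) : ℂ :=
  Sum.elim (fun _ => 0) (fun b' => P.f' c (.inl b') a) b

/-- The Clifford relations `{γ_μ, γ_ν} = 2 η_{μν}`. -/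
def Clifford : Prop :=
  ∀ μ ν, P.γ μ * P.γ ν + P.γ ν * P.γ μ =
    if μ = ν then (2 * η μ) • (1 : Matrix (Fin 4) (Fin 4) ℂ) else 0

/-- `γ_5 = i γ_0 γ_1 γ_2 γ_3` -/
def γ5 : Matrix (Fin 4) (Fin 4) ℂ := Complex.I • (P.γ 0 * P.γ 1 * P.γ 2 * P.γ 3)

/-- `γ_ε = (1 + ε γ_5) / 2` -/
def γε (ε : ℤˣ) : Matrix (Fin 4) (Fin 4) ℂ := (1 / 2 : ℂ) • (1 + ((ε : ℤ) : ℂ) • P.γ5)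

/-- The defining relations of the algebra of Wick polynomials in the free fields: graded
commutativity, and the equations of motion (Klein-Gordon for `v, u, ũ, Φ, φ`; Dirac for `ψ, ψ̄`)
together with all their derivatives. -/
inductive Rel : Expr I₁ I₂ I₃ I₄ → Expr I₁ I₂ I₃ I₄ → Prop
  | comm (x y : Jet I₁ I₂ I₃ I₄) :
      Rel (FreeAlgebra.ι ℂ x * FreeAlgebra.ι ℂ y)
        ((if x.1.odd && y.1.odd then -1 else 1 : ℂ) • (FreeAlgebra.ι ℂ y * FreeAlgebra.ι ℂ x))
  | kg_v (a : I₁ ⊕ I₂) (μ : Fin 4) (s : Multiset (Fin 4)) :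
      Rel (∑ ρ, η ρ • jet (.v a μ) (ρ ::ₘ ρ ::ₘ s) + (P.mV a : ℂ) ^ 2 • jet (.v a μ) s) 0
  | kg_u (a : I₁ ⊕ I₂) (s : Multiset (Fin 4)) :
      Rel (∑ ρ, η ρ • jet (.u a) (ρ ::ₘ ρ ::ₘ s) + (P.mV a : ℂ) ^ 2 • jet (.u a) s) 0
  | kg_ut (a : I₁ ⊕ I₂) (s : Multiset (Fin 4)) :
      Rel (∑ ρ, η ρ • jet (.ut a) (ρ ::ₘ ρ ::ₘ s) + (P.mV a : ℂ) ^ 2 • jet (.ut a) s) 0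
  | kg_Φ (c : I₂ ⊕ I₃) (s : Multiset (Fin 4)) :
      Rel (∑ ρ, η ρ • jet (.Φ c) (ρ ::ₘ ρ ::ₘ s) + (P.mS c : ℂ) ^ 2 • jet (.Φ c) s) 0
  | dirac (A : I₄) (α : Fin 4) (s : Multiset (Fin 4)) :
      Rel (∑ ρ, ∑ β, (Complex.I * (η ρ * P.γ ρ α β)) • jet (.ψ A β) (ρ ::ₘ s))
        ((P.M A : ℂ) • jet (.ψ A α) s)
  | dirac_bar (A : I₄) (α : Fin 4) (s : Multiset (Fin 4)) :
      Rel (∑ ρ, ∑ β, (Complex.I * (η ρ * P.γ ρ β α)) • jet (.ψbar A β) (ρ ::ₘ s))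
        (-(P.M A : ℂ) • jet (.ψbar A α) s)

/-- The algebra of (on-shell) Wick polynomials. -/
abbrev Wick := RingQuot P.Rel

/-- The Wick polynomial of an expression; `P.toWick A = P.toWick B` means that `A` and `B` coincide
modulo graded commutativity and the equations of motion. -/
def toWick : Expr I₁ I₂ I₃ I₄ →ₐ[ℂ] P.Wick := RingQuot.mkAlgHom ℂ P.Rel

/-- The values of the gauge charge on the jet variables:
`d_Q v_a^μ = i d^μ u_a`, `d_Q u_a = 0`, `d_Q ũ_a = -i (d_μ v_a^μ + m_a Φ_a)`, `d_Q Φ_a = i m_a u_a`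
for `a ∈ I₂` and `d_Q φ_j = 0`, `d_Q ψ = d_Q ψ̄ = 0` (with `m_a Φ_a = 0` for `a ∈ I₁`). -/
def dQval : Jet I₁ I₂ I₃ I₄ → Expr I₁ I₂ I₃ I₄
  | (.v a μ, s) => (Complex.I * η μ) • jet (.u a) (μ ::ₘ s)
  | (.u _, _) => 0
  | (.ut (.inl a), s) => (-Complex.I) • ∑ μ, jet (.v (.inl a) μ) (μ ::ₘ s)
  | (.ut (.inr a), s) =>
      (-Complex.I) •
        (∑ μ, jet (.v (.inr a) μ) (μ ::ₘ s) + (P.m₂ a : ℂ) • jet (.Φ (.inl a)) s)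
  | (.Φ (.inl a), s) => (Complex.I * (P.m₂ a : ℂ)) • jet (.u (.inr a)) s
  | (.Φ (.inr _), _) => 0
  | (.ψ _ _, _) => 0
  | (.ψbar _ _, _) => 0

/-- The gauge charge operator, an odd derivation. -/
def dQ : Expr I₁ I₂ I₃ I₄ →ₗ[ℂ] Expr I₁ I₂ I₃ I₄ := der true P.dQval

variable [Fintype I₁] [Fintype I₂] [Fintype I₃] [Fintype I₄]

/-- `ψ̄ (m ⊗ g) ψ`, where `m` acts on the index of the Dirac fields and `g` on the spinor index. -/
def bil (m : Matrix I₄ I₄ ℂ) (g : Matrix (Fin 4) (Fin 4) ℂ) : Expr I₁ I₂ I₃ I₄ :=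
  ∑ A, ∑ B, ∑ α, ∑ β, (m A B * g α β) • (jet (.ψbar A α) 0 * jet (.ψ B β) 0)

/-- The current `j_a^μ = ψ̄ t_a^ε ⊗ γ^μ γ_ε ψ` (sum over `ε = ±`). -/
def jV (a : I₁ ⊕ I₂) (μ : Fin 4) : Expr I₁ I₂ I₃ I₄ :=
  ∑ ε : ℤˣ, bil (P.t a ε) ((η μ • P.γ μ) * P.γε ε)

/-- The scalar currents `ψ̄ s_c^ε ⊗ γ_ε ψ`: `j_c` for `c ∈ I₂` and `d_c` for `c ∈ I₃`. -/
def jS (c : I₂ ⊕ I₃) : Expr I₁ I₂ I₃ I₄ := ∑ ε : ℤˣ, bil (P.s c ε) (P.γε ε)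

/-- The interaction Lagrangian `T`. -/
def T : Expr I₁ I₂ I₃ I₄ :=
  (∑ a, ∑ b, ∑ c, P.f a b c •
    ((1 / 2 : ℂ) • (∑ μ, ∑ ν, vL a μ * vL b ν * F c ν μ) + ∑ μ, u a * v b μ * d μ (ut c)))
  + (∑ a, ∑ b, ∑ c, P.f' a b c • ∑ μ, Φ a * d μ (Φ b) * v c μ)
  + (∑ a, ∑ b : I₂, ∑ c, (P.f' a (.inl b) c * (P.m₂ b : ℂ)) •
      (-(∑ μ, Φ a * vL (.inr b) μ * v c μ) + Φ a * ut (.inr b) * u c))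
  + (1 / 6 : ℂ) • (∑ a, ∑ b, ∑ c, P.f'' a b c • (Φ a * Φ b * Φ c))
  + (∑ a, ∑ μ, P.jV a μ * vL a μ) + ∑ c, P.jS c * Φ c

/-- `T^μ` -/
def T1 (μ : Fin 4) : Expr I₁ I₂ I₃ I₄ :=
  (∑ a, ∑ b, ∑ c, P.f a b c •
    ((∑ ν, u a * vL b ν * F c ν μ) - (1 / 2 : ℂ) • (u a * u b * (η μ • d μ (ut c)))))
  + (∑ a, P.jV a μ * u a)
  + (∑ a, ∑ b, ∑ c, P.f' a b c • (Φ a * (η μ • d μ (Φ b)) * u c))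
  - ∑ a, ∑ b : I₂, ∑ c, (P.f' a (.inl b) c * (P.m₂ b : ℂ)) • (Φ a * v (.inr b) μ * u c)

/-- `T^{μν}` -/
def T2 (μ ν : Fin 4) : Expr I₁ I₂ I₃ I₄ :=
  (1 / 2 : ℂ) • ∑ a, ∑ b, ∑ c, P.f a b c • (u a * u b * F c μ ν)

/-! Wick submonomials; all Lorentz indices are upper. -/

/-- `B_a = (1/2) f_{abc} u_b u_c` -/
def B (a : I₁ ⊕ I₂) : Expr I₁ I₂ I₃ I₄ := (1 / 2 : ℂ) • ∑ b, ∑ c, P.f a b c • (u b * u c)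
/-- `B_a^μ = ũ_{a,μ} · T` -/
def B1 (a : I₁ ⊕ I₂) (μ : Fin 4) : Expr I₁ I₂ I₃ I₄ := sub (.ut a) {μ} P.T
/-- `D_a = u_a · T` -/
def D (a : I₁ ⊕ I₂) : Expr I₁ I₂ I₃ I₄ := sub (.u a) 0 P.T
/-- `D_a^μ = u_a · T^μ` -/
def D1 (a : I₁ ⊕ I₂) (μ : Fin 4) : Expr I₁ I₂ I₃ I₄ := sub (.u a) 0 (P.T1 μ)
/-- `D_a^{μν} = u_a · T^{μν}` -/
def D2 (a : I₁ ⊕ I₂) (μ ν : Fin 4) : Expr I₁ I₂ I₃ I₄ := sub (.u a) 0 (P.T2 μ ν)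
/-- `E_a^{μν} = v_{aμ,ν} · T` -/
def E (a : I₁ ⊕ I₂) (μ ν : Fin 4) : Expr I₁ I₂ I₃ I₄ := η μ • sub (.v a μ) {ν} P.T
/-- `G_c = Φ_c · T` -/
def G (c : I₂ ⊕ I₃) : Expr I₁ I₂ I₃ I₄ := sub (.Φ c) 0 P.T
/-- `G_c^μ = Φ_c · T^μ` -/
def G1 (c : I₂ ⊕ I₃) (μ : Fin 4) : Expr I₁ I₂ I₃ I₄ := sub (.Φ c) 0 (P.T1 μ)
/-- `H_c^μ = Φ_{c,μ} · T` -/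
def H1 (c : I₂ ⊕ I₃) (μ : Fin 4) : Expr I₁ I₂ I₃ I₄ := sub (.Φ c) {μ} P.T
/-- `H_c = - f'_{cda} Φ_d u_a`, so that `Φ_{c,ν} · T_μ = η_{μν} H_c` -/
def H (c : I₂ ⊕ I₃) : Expr I₁ I₂ I₃ I₄ := -∑ e, ∑ a, P.f' c e a • (Φ e * u a)

/-- The Dirac part of the anomaly of `(T, T)`. -/
def ADirac : Expr I₁ I₂ I₃ I₄ :=
  (-2 * Complex.I) • (∑ a, ∑ b, ∑ ε : ℤˣ, ∑ μ,
    u a * v b μ * bil (P.t a ε * P.t b ε - P.t b ε * P.t a ε) (P.γ μ * P.γε ε))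
  + (-2 * Complex.I) • (∑ a, ∑ c, ∑ ε : ℤˣ,
    u a * Φ c * bil (P.t a (-ε) * P.s c ε - P.s c ε * P.t a ε) (P.γε ε))

/-- The Dirac part of the anomaly of `(T^μ, T)`. -/
def ADirac1 (μ : Fin 4) : Expr I₁ I₂ I₃ I₄ :=
  (-Complex.I) • ∑ a, ∑ b, ∑ ε : ℤˣ,
    u a * u b * bil (P.t a ε * P.t b ε - P.t b ε * P.t a ε) ((η μ • P.γ μ) * P.γε ε)

/-- The anomaly `𝒜(T,T)` -/
def A00 : Expr I₁ I₂ I₃ I₄ :=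
  (-2 : ℂ) • (∑ a, ((∑ μ, η μ • (P.B1 a μ * P.D1 a μ)) + P.B a * P.D a))
  + (∑ a, ∑ μ, ∑ ν, (η μ * η ν) • (P.E a μ ν * P.D2 a μ ν))
  - (2 : ℂ) • (∑ c, P.H c * P.G c)
  + (2 : ℂ) • (∑ c, ∑ μ, η μ • (P.H1 c μ * P.G1 c μ))
  + P.ADirac

/-- The anomaly `𝒜(T^μ,T)` -/
def A10 (μ : Fin 4) : Expr I₁ I₂ I₃ I₄ :=
  (2 : ℂ) • (∑ a, (P.B a * P.D1 a μ + ∑ ν, η ν • (P.B1 a ν * P.D2 a μ ν)))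
  - (2 : ℂ) • (∑ c, P.H c * P.G1 c μ)
  + P.ADirac1 μ

/-- The anomaly `𝒜(T^μ,T^ν)` -/
def A11 (μ ν : Fin 4) : Expr I₁ I₂ I₃ I₄ := (2 : ℂ) • ∑ a, P.B a * P.D2 a μ ν

/-- The anomalies `𝒜(T^I,T^J)` of the renormalized second order tree chronological products:
`s T^ren(T^I(x₁), T^J(x₂)) = δ(x₁ - x₂) 𝒜(T^I,T^J)(x₂)`, where
`𝒜(T^{μν},T) = -2 B_a D_a^{μν}`, `𝒜(T^J,T^I) = (-1)^{|I||J|} 𝒜(T^I,T^J)` and `𝒜(T^I,T^J) = 0` for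
`|I| + |J| ≥ 3`. -/
def anomaly : List (Fin 4) → List (Fin 4) → Expr I₁ I₂ I₃ I₄
  | [], [] => P.A00
  | [μ], [] => P.A10 μ
  | [], [μ] => P.A10 μ
  | [μ], [ν] => P.A11 μ ν
  | [μ, ν], [] => -P.A11 μ ν
  | [], [μ, ν] => -P.A11 μ ν
  | _, _ => 0

/-- Quadri-linear expressions of ghost number `n` and canonical dimension at most `4`. -/
def quartic (I₁ I₂ I₃ I₄ : Type*) (n : ℤ) : Submodule ℂ (Expr I₁ I₂ I₃ I₄) :=
  Submodule.span ℂ {w | ∃ x₁ x₂ x₃ x₄ : Jet I₁ I₂ I₃ I₄,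
    w = FreeAlgebra.ι ℂ x₁ * FreeAlgebra.ι ℂ x₂ * FreeAlgebra.ι ℂ x₃ * FreeAlgebra.ι ℂ x₄ ∧
    x₁.1.gh + x₂.1.gh + x₃.1.gh + x₄.1.gh = n ∧
    Jet.dim x₁ + Jet.dim x₂ + Jet.dim x₃ + Jet.dim x₄ ≤ 4}

/-- `R` gives a finite renormalization (quasi-local cochain)
`R(T^I(x₁), T^J(x₂)) = δ(x₁ - x₂) R(T^I,T^J)(x₂)`: the expressions `R I J = R(T^I,T^J)` are
quadri-linear, of canonical dimension at most `4` and ghost number `|I| + |J|`, graded symmetric in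
the two entries, antisymmetric in the indices of `T^{μν}`, and `T^I = 0` for `|I| > 2`. -/
structure IsRenormalization (R : List (Fin 4) → List (Fin 4) → Expr I₁ I₂ I₃ I₄) : Prop where
  mem : ∀ I J, R I J ∈ quartic I₁ I₂ I₃ I₄ ((I.length : ℤ) + (J.length : ℤ))
  symm : ∀ I J, P.toWick (R I J) = P.toWick ((-1 : ℂ) ^ (I.length * J.length) • R J I)
  antisymm : ∀ μ ν J, P.toWick (R [ν, μ] J) = P.toWick (-R [μ, ν] J)
  trunc : ∀ I J, 2 < I.length → P.toWick (R I J) = 0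

/-- The coefficient of `δ(x₁ - x₂)` in the gauge variation `s R(T^I(x₁), T^J(x₂))`, where
`s = d_Q - i δ` and
`δ R(T^I, T^J) = ∂¹_μ R(T^{Iμ}(x₁), T^J(x₂)) + (-1)^{|I|} ∂²_μ R(T^I(x₁), T^{Jμ}(x₂))`. -/
def sR (R : List (Fin 4) → List (Fin 4) → Expr I₁ I₂ I₃ I₄) (I J : List (Fin 4)) :
    Expr I₁ I₂ I₃ I₄ :=
  P.dQ (R I J) - (Complex.I * (-1) ^ I.length) • ∑ μ, d μ (R I (J ++ [μ]))

/-- The coefficient of `∂_ρ δ(x₁ - x₂)` in `s R(T^I(x₁), T^J(x₂))`. -/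
def sR' (R : List (Fin 4) → List (Fin 4) → Expr I₁ I₂ I₃ I₄) (ρ : Fin 4) (I J : List (Fin 4)) :
    Expr I₁ I₂ I₃ I₄ :=
  (-Complex.I) • (R (I ++ [ρ]) J - ((-1 : ℂ) ^ I.length) • R I (J ++ [ρ]))

/-- Adding `R` to the chronological products eliminates the anomalies:
`δ(x₁ - x₂) 𝒜(T^I,T^J)(x₂) + s R(T^I(x₁), T^J(x₂)) = 0` for all `I, J`; in other words, the anomaly
is the coboundary `s(-R)`. -/
def Eliminates (R : List (Fin 4) → List (Fin 4) → Expr I₁ I₂ I₃ I₄) : Prop :=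
  ∀ I J, P.toWick (P.anomaly I J + P.sR R I J) = 0 ∧ ∀ ρ, P.toWick (sR' R ρ I J) = 0

/-- The relations satisfied by the constants of the interaction Lagrangian `T`. -/
structure Consistent : Prop where
  f_antisymm₁ : ∀ a b c, P.f a b c = -P.f b a c
  f_antisymm₂ : ∀ a b c, P.f a b c = -P.f a c b
  f'_antisymm : ∀ c e a, P.f' c e a = -P.f' e c a
  f''_symm₁ : ∀ c e g, P.f'' c e g = P.f'' e c g
  f''_symm₂ : ∀ c e g, P.f'' c e g = P.f'' c g e
  mass_vector : ∀ (a : I₂) (b c : I₁ ⊕ I₂),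
    (P.mV b : ℂ) * P.f'V (.inl a) b c - (P.mV c : ℂ) * P.f'V (.inl a) c b =
      (P.m₂ a : ℂ) * P.f (.inr a) b c
  mass_scalar : ∀ (j : I₃) (b : I₂) (c : I₁ ⊕ I₂),
    (P.m₂ b : ℂ) * P.f'V (.inr j) (.inr b) c - (P.mV c : ℂ) * P.f'V (.inr j) c (.inr b) = 0
  dirac_massless : ∀ (a : I₁) (ε : ℤˣ) (A B : I₄),
    Complex.I * ((P.M A : ℂ) * P.t (.inl a) ε A B - P.t (.inl a) (-ε) A B * (P.M B : ℂ)) = 0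
  dirac_massive : ∀ (a : I₂) (ε : ℤˣ) (A B : I₄),
    Complex.I * ((P.M A : ℂ) * P.t (.inr a) ε A B - P.t (.inr a) (-ε) A B * (P.M B : ℂ)) =
      (P.m₂ a : ℂ) * P.s (.inl a) ε A B
  cubic_ghost : ∀ a b c : I₂, P.f'' (.inl a) (.inl b) (.inl c) = 0
  cubic_one : ∀ (j : I₃) (b c : I₂),
    P.f'' (.inr j) (.inl b) (.inl c) =
      (P.m₃ j : ℂ) ^ 2 / (P.m₂ c : ℂ) * P.f' (.inr j) (.inl b) (.inr c)
  cubic_two : ∀ (j k : I₃) (c : I₂),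
    P.f'' (.inr j) (.inr k) (.inl c) =
      1 / (P.m₂ c : ℂ) * ((P.m₃ j : ℂ) ^ 2 - (P.m₃ k : ℂ) ^ 2) * P.f' (.inr j) (.inr k) (.inr c)

/-- The Jacobi identity for `f_{abc}`. -/
def Jacobi : Prop :=
  ∀ a b c g, ∑ e, (P.f e a b * P.f e c g + P.f e b c * P.f e a g + P.f e c a * P.f e b g) = 0

/-- The matrices `(T'_a)_{cd} = -f'_{cda}`. -/
def T' (a : I₁ ⊕ I₂) : Matrix (I₂ ⊕ I₃) (I₂ ⊕ I₃) ℂ := Matrix.of fun c e => -P.f' c e a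

/-- `[T'_a, T'_b] = f_{abc} T'_c` -/
def Representation : Prop :=
  ∀ a b, P.T' a * P.T' b - P.T' b * P.T' a = ∑ c, P.f a b c • P.T' c

/-- The relations in the Dirac sector. -/
def DiracRelations : Prop :=
  (∀ a b (ε : ℤˣ), P.t a ε * P.t b ε - P.t b ε * P.t a ε =
    Complex.I • ∑ c, P.f a b c • P.t c ε) ∧
  (∀ a c (ε : ℤˣ), P.t a (-ε) * P.s c ε - P.s c ε * P.t a ε =
    (-Complex.I) • ∑ e, P.f' e c a • P.s e ε)

/-- The tensor `g_{abcd}`, `a ∈ I₁ ∪ I₂` and `b, c, d ∈ I₂ ∪ I₃`: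
`g_{abcd} = 6 𝒮_{bcd} (f'_{eba} f''_{ecd})`, with `𝒮` the (normalized) symmetrization. -/
def g (a : I₁ ⊕ I₂) (b c e : I₂ ⊕ I₃) : ℂ :=
  2 * ∑ k, (P.f' k b a * P.f'' k c e + P.f' k c a * P.f'' k b e + P.f' k e a * P.f'' k b c)

/-- The conditions on the tensor `g_{abcd}`. -/
def ScalarRelations : Prop :=
  (∀ (a : I₁) (b c e : I₂ ⊕ I₃), P.g (.inl a) b c e = 0) ∧
  (∀ (a b : I₂) (c e : I₂ ⊕ I₃),
    1 / (P.m₂ a : ℂ) * P.g (.inr a) (.inl b) c e = 1 / (P.m₂ b : ℂ) * P.g (.inr b) (.inl a) c e)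

/-- `h` is a completely symmetric tensor on `I₂ ∪ I₃` with `h_{abcd} = g_{abcd} / m_a` for
`a ∈ I₂`. -/
structure IsQuarticCoupling (h : I₂ ⊕ I₃ → I₂ ⊕ I₃ → I₂ ⊕ I₃ → I₂ ⊕ I₃ → ℂ) : Prop where
  symm₁ : ∀ a b c e, h a b c e = h b a c e
  symm₂ : ∀ a b c e, h a b c e = h a c b e
  symm₃ : ∀ a b c e, h a b c e = h a b e c
  eq : ∀ (a : I₂) (b c e : I₂ ⊕ I₃), h (.inl a) b c e = 1 / (P.m₂ a : ℂ) * P.g (.inr a) b c e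

/-- `(i/24) h_{abcd} Φ_a Φ_b Φ_c Φ_d` -/
def quarticTerm (h : I₂ ⊕ I₃ → I₂ ⊕ I₃ → I₂ ⊕ I₃ → I₂ ⊕ I₃ → ℂ) : Expr I₁ I₂ I₃ I₄ :=
  (Complex.I / 24) • ∑ a, ∑ b, ∑ c, ∑ e, h a b c e • (Φ a * Φ b * Φ c * Φ e)

/-- The finite renormalization `R_s`: `R_s(T,T) = (i/24) h_{abcd} Φ_a Φ_b Φ_c Φ_d`, all the other
components being zero. -/
def Rs (h : I₂ ⊕ I₃ → I₂ ⊕ I₃ → I₂ ⊕ I₃ → I₂ ⊕ I₃ → ℂ) :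
    List (Fin 4) → List (Fin 4) → Expr I₁ I₂ I₃ I₄
  | [], [] => quarticTerm h
  | _, _ => 0

end Params

end YM

end

/-! Sufficiency is a computation in graded commutative algebra; the equations of motion play no part
in it. After inserting the submonomials of T, T^μ and T^{μν}, each anomaly is a sum of contractions
of two coupling tensors with quartic monomials, sorted here by field content. Contractions ff vanish
by the Jacobi identity. Contractions ff' cancel against f'f' by the representation property, also
when weighted by a mass. The Dirac bilinears carry the obstructions `XD` and `YD` to (iii). What is
left of 𝒜(T,T) is (1/6) g_{abcd} u_a Φ_b Φ_c Φ_d (`IsSuperComm.map_A00`). Because d_Q Φ_a = i m_a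
u_a, the charge of (i/24) hΦΦΦΦ with symmetric h is -(1/6) m_a h_{abcd} u_a Φ_b Φ_c Φ_d
(`IsSuperComm.map_dQ_quarticTerm`), which cancels this remainder when m_a h = g, with 0 = g for
massless a.

Necessity is a descent in the number of Lorentz indices. It takes place in the free graded
commutative algebra `SC`, where left derivatives are well defined and read off coefficients. The
on-shell algebra is mapped there by normal forms (`Params.nfHom_rel`). This map is far from
injective, but it fixes undifferentiated fields and first derivatives of bosons and ghosts, and
nothing else occurs. Power counting (`quartic_le_words`) shows that R contains neither derivatives
nor Dirac fields, so many monomials cannot occur in d_Q R or in ∂R, and their coefficients in the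
anomaly must vanish. With two indices, u u u ∂_0 v^1 yields the Jacobi identity; with one index, Φ
∂_0 Φ u u yields the representation property and ψ̄ψ u u the first Dirac relation; with none, ψ̄ψ u
Φ yields the second.

To descend from one level to the next, R^{μν} and then R^μ must be shown to vanish. A contracting
homotopy for d_Q counts the letters v and ũ, so a d_Q-closed polynomial in undifferentiated fields
depends on u and Φ only (`Params.exists_ghostScalar`). The divergence of such a polynomial contains
∂Φ, and counting the letters Φ recovers the polynomial up to the factor 4 - n, with n its ghost
number (`Params.toSC_eq_zero_of_divergence`); this factor is nonzero for n = 2 and n = 1. At the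
bottom, R(T,T) itself is a quartic in Φ by the same homotopy, and comparing coefficients gives g = m
h, hence (iv) and (c). This direction uses only the equations whose first entry is T, and only the
coefficient of δ, not that of ∂δ. -/

set_option linter.unusedSimpArgs false
set_option linter.unusedSectionVars false

noncomputable section

namespace YM

variable {I₁ I₂ I₃ I₄ : Type*}

/-! ### Homomorphisms under which the jet variables supercommute. -/

section Supercommutative

variable {S : Type*} [Ring S] [Algebra ℂ S]

/-- The commutation sign `(-1)^{pq}` of two parities. -/
def sgn (p q : Bool) : ℂ := if p && q then -1 else 1

/-- A homomorphism out of the free algebra in which the jet variables commute up to the sign given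
by their parities. -/
def IsSuperComm (φ : Expr I₁ I₂ I₃ I₄ →ₐ[ℂ] S) : Prop :=
  ∀ x y : Jet I₁ I₂ I₃ I₄, φ (FreeAlgebra.ι ℂ x) * φ (FreeAlgebra.ι ℂ y) =
    sgn x.1.odd y.1.odd • (φ (FreeAlgebra.ι ℂ y) * φ (FreeAlgebra.ι ℂ x))

/-- `A` has parity `p` as far as commutation with the jet variables is concerned. -/
def SuperCommutes (φ : Expr I₁ I₂ I₃ I₄ →ₐ[ℂ] S) (p : Bool) (A : Expr I₁ I₂ I₃ I₄) : Prop :=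
  ∀ y : Jet I₁ I₂ I₃ I₄,
    φ A * φ (FreeAlgebra.ι ℂ y) = sgn p y.1.odd • (φ (FreeAlgebra.ι ℂ y) * φ A)

variable {φ : Expr I₁ I₂ I₃ I₄ →ₐ[ℂ] S}

theorem SuperCommutes.zero (p : Bool) : SuperCommutes φ p 0 := fun y => by simp

theorem SuperCommutes.one : SuperCommutes φ false 1 := fun y => by simp [sgn]

theorem SuperCommutes.add {p : Bool} {A B : Expr I₁ I₂ I₃ I₄} (hA : SuperCommutes φ p A)
    (hB : SuperCommutes φ p B) : SuperCommutes φ p (A + B) := fun y => by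
  rw [map_add, add_mul, mul_add, hA y, hB y, smul_add]

theorem SuperCommutes.smul {p : Bool} {A : Expr I₁ I₂ I₃ I₄} (c : ℂ)
    (hA : SuperCommutes φ p A) : SuperCommutes φ p (c • A) := fun y => by
  rw [map_smul, smul_mul_assoc, mul_smul_comm, hA y, smul_comm]

theorem SuperCommutes.sum {ι : Type*} {p : Bool} (s : Finset ι) {A : ι → Expr I₁ I₂ I₃ I₄}
    (hA : ∀ i ∈ s, SuperCommutes φ p (A i)) : SuperCommutes φ p (∑ i ∈ s, A i) := fun y => by
  simp only [map_sum, Finset.sum_mul, Finset.mul_sum, Finset.smul_sum]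
  exact Finset.sum_congr rfl fun i hi => hA i hi y

theorem ite_neg_eq_sgn_smul {M : Type*} [AddCommGroup M] [Module ℂ M] (p q : Bool) (A : M) :
    (if p && q then -A else A) = sgn p q • A := by
  cases p <;> cases q <;> simp [sgn]

theorem sgn_mul_sgn (p q : Bool) : sgn p q * sgn p q = 1 := by
  cases p <;> cases q <;> simp [sgn]

theorem sgn_xor (p q r : Bool) : sgn (p ^^ q) r = sgn p r * sgn q r := by
  cases p <;> cases q <;> cases r <;> simp [sgn]

theorem sgn_comm (p q : Bool) : sgn p q = sgn q p := by
  cases p <;> cases q <;> simp [sgn]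

/-- Even elements commute with everything. -/
theorem SuperCommutes.central {A : Expr I₁ I₂ I₃ I₄} (hA : SuperCommutes φ false A) (B : Expr I₁ I₂ I₃ I₄) :
    φ B * φ A = φ A * φ B := by
  induction B using FreeAlgebra.induction with
  | grade0 r => rw [AlgHom.commutes]; exact Algebra.commutes _ _
  | grade1 x => have := hA x; simp [sgn] at this; exact this.symm
  | mul a b ha hb => rw [map_mul, mul_assoc, hb, ← mul_assoc, ha, mul_assoc]
  | add a b ha hb => rw [map_add, add_mul, mul_add, ha, hb]

namespace IsSuperComm

variable (hφ : IsSuperComm φ)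
include hφ

theorem jet (ξ : Fld I₁ I₂ I₃ I₄) (s : Multiset (Fin 4)) :
    SuperCommutes φ ξ.odd (jet ξ s) := fun y => hφ (ξ, s) y

end IsSuperComm

end Supercommutative

/-! The free graded commutative algebra on the jet variables. -/

/-- Graded commutativity of the jet variables. -/
inductive CommRel : Expr I₁ I₂ I₃ I₄ → Expr I₁ I₂ I₃ I₄ → Prop
  | comm (x y : Jet I₁ I₂ I₃ I₄) :
      CommRel (FreeAlgebra.ι ℂ x * FreeAlgebra.ι ℂ y)
        (sgn x.1.odd y.1.odd • (FreeAlgebra.ι ℂ y * FreeAlgebra.ι ℂ x))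

/-- The free graded commutative algebra on the jet variables. -/
abbrev SC (I₁ I₂ I₃ I₄ : Type*) := RingQuot (CommRel (I₁ := I₁) (I₂ := I₂) (I₃ := I₃) (I₄ := I₄))

/-- The quotient map onto the free graded commutative algebra. -/
def toSC : Expr I₁ I₂ I₃ I₄ →ₐ[ℂ] SC I₁ I₂ I₃ I₄ := RingQuot.mkAlgHom ℂ CommRel

theorem toSC_isSuperComm : IsSuperComm (toSC (I₁ := I₁) (I₂ := I₂) (I₃ := I₃) (I₄ := I₄)) :=
  fun x y => by
    have := RingQuot.mkAlgHom_rel ℂ (CommRel.comm x y)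
    rw [map_mul, map_smul, map_mul] at this
    exact this

/-- The universal property of `SC`: an identity in it transfers to any target where the jet
variables supercommute, such as the Wick algebra or matrices encoding a derivation. -/
theorem IsSuperComm.eq_of_toSC_eq {S : Type*} [Ring S] [Algebra ℂ S]
    {φ : Expr I₁ I₂ I₃ I₄ →ₐ[ℂ] S} (hφ : IsSuperComm φ) {A B : Expr I₁ I₂ I₃ I₄}
    (h : toSC A = toSC B) : φ A = φ B := by
  have hr : ∀ ⦃a b : Expr I₁ I₂ I₃ I₄⦄, CommRel a b → φ a = φ b := by
    rintro _ _ ⟨x, y⟩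
    rw [map_mul, map_smul, map_mul]
    exact hφ x y
  have key : ∀ A, RingQuot.liftAlgHom ℂ ⟨φ, hr⟩ (toSC A) = φ A := fun A =>
    RingQuot.liftAlgHom_mkAlgHom_apply ℂ φ hr A
  rw [← key, h, key]

/-- Sending every jet variable to 0 is compatible with the commutation signs and separates the
scalars. Every extraction of a coefficient ends here. -/
theorem toSC_algebraMap_eq_zero {c : ℂ}
    (h : toSC (I₁ := I₁) (I₂ := I₂) (I₃ := I₃) (I₄ := I₄) (algebraMap ℂ _ c) = 0) : c = 0 := by
  have hφ : IsSuperComm (FreeAlgebra.lift ℂ fun _ : Jet I₁ I₂ I₃ I₄ => (0 : ℂ)) :=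
    fun x y => by simp
  have := hφ.eq_of_toSC_eq (h.trans (map_zero toSC).symm)
  simpa using this

/-- A graded derivation with homogeneous values descends to the free graded commutative
algebra. -/
theorem toSC_der_congr {p : Bool} {D : Jet I₁ I₂ I₃ I₄ → Expr I₁ I₂ I₃ I₄}
    (hD : ∀ x, SuperCommutes toSC (p ^^ x.1.odd) (D x)) {A B : Expr I₁ I₂ I₃ I₄}
    (h : toSC A = toSC B) : toSC (der p D A) = toSC (der p D B) := by
  -- The derivation is the upper right entry of an algebra homomorphism into triangular matrices. It
  -- descends as soon as these matrices supercommute, and in the off-diagonal entry this is the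
  -- parity condition `hD`.
  let φ : Expr I₁ I₂ I₃ I₄ →ₐ[ℂ] Matrix (Fin 2) (Fin 2) (SC I₁ I₂ I₃ I₄) :=
    (AlgHom.mapMatrix toSC).comp (derHom p D)
  have hc : ∀ x y : Jet I₁ I₂ I₃ I₄, toSC (FreeAlgebra.ι ℂ x) * toSC (FreeAlgebra.ι ℂ y) =
      sgn x.1.odd y.1.odd • (toSC (FreeAlgebra.ι ℂ y) * toSC (FreeAlgebra.ι ℂ x)) :=
    toSC_isSuperComm
  have hφ : IsSuperComm φ := by
    intro x y
    have h1 := hD x y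
    have h2 := hD y x
    have h3 := hc x y
    rcases x with ⟨x, s⟩
    rcases y with ⟨y, t⟩
    simp only at h1 h2 h3
    ext i j
    fin_cases i <;> fin_cases j <;>
      simp only [φ, derHom, Matrix.mul_apply, Fin.sum_univ_two, Matrix.smul_apply,
        AlgHom.comp_apply, FreeAlgebra.lift_ι_apply, AlgHom.mapMatrix_apply, Matrix.map_apply] <;>
      simp only [Fin.zero_eta, Fin.mk_one, Matrix.of_apply, Matrix.cons_val', Matrix.cons_val_zero,
        Matrix.cons_val_one, Matrix.cons_val_fin_one, map_zero, mul_zero, zero_mul, add_zero,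
        zero_add, smul_zero]
    · simp only [ite_neg_eq_sgn_smul, map_smul, smul_mul_smul_comm, h3, smul_smul]
      congr 1
      ring
    · simp only [ite_neg_eq_sgn_smul, map_smul, smul_mul_assoc, h1, h2, smul_add, smul_smul,
        sgn_xor]
      rw [sgn_comm y.odd x.odd, mul_left_comm, sgn_mul_sgn, mul_one, add_comm,
        mul_comm (sgn p y.odd)]
    · exact h3
  have := congrFun (congrFun (hφ.eq_of_toSC_eq h) 0) 1
  exact this

theorem toSC_der_eq_zero {p : Bool} {D : Jet I₁ I₂ I₃ I₄ → Expr I₁ I₂ I₃ I₄}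
    (hD : ∀ x, SuperCommutes toSC (p ^^ x.1.odd) (D x)) {A : Expr I₁ I₂ I₃ I₄}
    (h : toSC A = 0) : toSC (der p D A) = 0 := by
  have := toSC_der_congr hD (h.trans (map_zero toSC).symm)
  simpa using this

/-- The value 1 of ∂/∂x on x is even, as the parities of the derivation and of x cancel. Hence
coefficients in `SC` can be isolated by differentiating with respect to the letters of a monomial in
turn. -/
theorem toSC_pd_eq_zero (x : Jet I₁ I₂ I₃ I₄) {A : Expr I₁ I₂ I₃ I₄} (h : toSC A = 0) :
    toSC (pd x A) = 0 := by
  refine toSC_der_eq_zero (fun y => ?_) h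
  by_cases hxy : y = x
  · subst hxy
    simpa using SuperCommutes.one
  · simpa [hxy] using SuperCommutes.zero _

theorem toSC_d_eq_zero (μ : Fin 4) {A : Expr I₁ I₂ I₃ I₄} (h : toSC A = 0) :
    toSC (d μ A) = 0 :=
  toSC_der_eq_zero (fun y => by simpa using toSC_isSuperComm.jet y.1 _) h

theorem Params.dQval_superCommutes (P : Params I₁ I₂ I₃ I₄) (x : Jet I₁ I₂ I₃ I₄) :
    SuperCommutes toSC (true ^^ x.1.odd) (P.dQval x) := by
  have hj := fun (ξ : Fld I₁ I₂ I₃ I₄) s => toSC_isSuperComm.jet ξ s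
  rcases x with ⟨(⟨a, μ⟩ | a | (a | a) | (a | a) | _ | _), s⟩
  · exact (hj (.u a) _).smul _
  · exact .zero _
  · exact (SuperCommutes.sum _ fun μ _ => hj (.v _ μ) _).smul _
  · exact ((SuperCommutes.sum _ fun μ _ => hj (.v _ μ) _).add ((hj (.Φ _) _).smul _)).smul _
  · exact (hj (.u _) _).smul _
  · exact .zero _
  · exact .zero _
  · exact .zero _

theorem Params.toSC_dQ_eq_zero (P : Params I₁ I₂ I₃ I₄) {A : Expr I₁ I₂ I₃ I₄} (h : toSC A = 0) :
    toSC (P.dQ A) = 0 :=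
  toSC_der_eq_zero P.dQval_superCommutes h

theorem Params.toWick_isSuperComm (P : Params I₁ I₂ I₃ I₄) : IsSuperComm P.toWick := fun x y => by
  have := RingQuot.mkAlgHom_rel ℂ (Params.Rel.comm (P := P) x y)
  rw [map_mul, map_smul, map_mul] at this
  exact this

/-! Derivations on jet variables. -/

theorem grading_ι (p : Bool) (x : Jet I₁ I₂ I₃ I₄) :
    grading p (FreeAlgebra.ι ℂ x) =
      if p && x.1.odd then -FreeAlgebra.ι ℂ x else FreeAlgebra.ι ℂ x := by
  simp [grading]

theorem grading_jet (p : Bool) (ξ : Fld I₁ I₂ I₃ I₄) (s : Multiset (Fin 4)) :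
    grading p (jet ξ s) = if p && ξ.odd then -jet ξ s else jet ξ s := grading_ι p (ξ, s)

theorem grading_false (A : Expr I₁ I₂ I₃ I₄) : grading false A = A := by
  induction A using FreeAlgebra.induction with
  | grade0 r => simp
  | grade1 x => simp [grading_ι]
  | mul a b ha hb => rw [map_mul, ha, hb]
  | add a b ha hb => rw [map_add, ha, hb]

theorem grading_grading (p : Bool) (A : Expr I₁ I₂ I₃ I₄) : grading p (grading p A) = A := by
  induction A using FreeAlgebra.induction with
  | grade0 r => simp
  | grade1 x => rw [grading_ι]; split_ifs with h <;> simp [grading_ι, h]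
  | mul a b ha hb => simp [map_mul, ha, hb]
  | add a b ha hb => simp [map_add, ha, hb]

theorem d_jet (μ : Fin 4) (ξ : Fld I₁ I₂ I₃ I₄) (s : Multiset (Fin 4)) :
    d μ (jet ξ s) = jet ξ (μ ::ₘ s) := der_ι _ _ _

open Classical in
theorem pd_jet (x : Jet I₁ I₂ I₃ I₄) (ξ : Fld I₁ I₂ I₃ I₄) (s : Multiset (Fin 4)) :
    pd x (jet ξ s) = if (ξ, s) = x then 1 else 0 := der_ι _ _ _

theorem pd_mul (x : Jet I₁ I₂ I₃ I₄) (A B : Expr I₁ I₂ I₃ I₄) :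
    pd x (A * B) = pd x A * B + grading x.1.odd A * pd x B := der_mul _ _ _ _

theorem der_one (p : Bool) (D : Jet I₁ I₂ I₃ I₄ → Expr I₁ I₂ I₃ I₄) : der p D 1 = 0 := by
  have := der_mul p D 1 1
  simpa using this

end YM

namespace YM

theorem sum₂_smul_smul {M ι κ : Type*} [AddCommGroup M] [Module ℂ M] [Fintype ι] [Fintype κ]
    (C : ι → κ → ℂ) (c : ℂ) (X : ι → κ → M) :
    ∑ i, ∑ j, C i j • c • X i j = c • ∑ i, ∑ j, C i j • X i j := by
  simp only [Finset.smul_sum, smul_comm c]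

theorem η_mul_self (μ : Fin 4) : η μ * η μ = 1 := by
  unfold η; split_ifs <;> norm_num

/-! ### Gradings and left derivatives of single letters. -/

section Letters
variable {I₁ I₂ I₃ I₄ : Type*}

theorem grading_v (p : Bool) (a : I₁ ⊕ I₂) (μ : Fin 4) :
    grading p (v a μ : Expr I₁ I₂ I₃ I₄) = v a μ := by simp [v, grading_jet, Fld.odd]
theorem grading_vL (p : Bool) (a : I₁ ⊕ I₂) (μ : Fin 4) :
    grading p (vL a μ : Expr I₁ I₂ I₃ I₄) = vL a μ := by simp [vL, grading_v]
theorem grading_F (p : Bool) (a : I₁ ⊕ I₂) (μ ν : Fin 4) :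
    grading p (F a μ ν : Expr I₁ I₂ I₃ I₄) = F a μ ν := by
  simp [F, v, d_jet, grading_jet, Fld.odd]
theorem grading_u (a : I₁ ⊕ I₂) :
    grading true (u a : Expr I₁ I₂ I₃ I₄) = -u a := by simp [u, grading_jet, Fld.odd]
theorem grading_ut (a : I₁ ⊕ I₂) :
    grading true (ut a : Expr I₁ I₂ I₃ I₄) = -ut a := by simp [ut, grading_jet, Fld.odd]
theorem grading_d_ut (μ : Fin 4) (a : I₁ ⊕ I₂) :
    grading true (d μ (ut a) : Expr I₁ I₂ I₃ I₄) = -d μ (ut a) := by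
  simp [ut, d_jet, grading_jet, Fld.odd]
theorem grading_Φ (p : Bool) (c : I₂ ⊕ I₃) :
    grading p (Φ c : Expr I₁ I₂ I₃ I₄) = Φ c := by simp [Φ, grading_jet, Fld.odd]
theorem grading_d_Φ (p : Bool) (μ : Fin 4) (c : I₂ ⊕ I₃) :
    grading p (d μ (Φ c) : Expr I₁ I₂ I₃ I₄) = d μ (Φ c) := by
  simp [Φ, d_jet, grading_jet, Fld.odd]

theorem grading_d_v (p : Bool) (ν : Fin 4) (a : I₁ ⊕ I₂) (μ : Fin 4) :
    grading p (d ν (v a μ) : Expr I₁ I₂ I₃ I₄) = d ν (v a μ) := by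
  simp [v, d_jet, grading_jet, Fld.odd]

variable (x : Jet I₁ I₂ I₃ I₄)

open Classical in
theorem pd_v (a : I₁ ⊕ I₂) (μ : Fin 4) : pd x (v a μ) = if (.v a μ, 0) = x then 1 else 0 :=
  pd_jet x _ _
open Classical in
theorem pd_vL (a : I₁ ⊕ I₂) (μ : Fin 4) :
    pd x (vL a μ) = if (.v a μ, 0) = x then η μ • 1 else 0 := by
  rw [vL, map_smul, pd_v, smul_ite, smul_zero]
open Classical in
theorem pd_d_v (ν : Fin 4) (a : I₁ ⊕ I₂) (μ : Fin 4) :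
    pd x (d ν (v a μ)) = if (.v a μ, {ν}) = x then 1 else 0 := by
  rw [v, d_jet]; exact pd_jet x _ _
open Classical in
theorem pd_u (a : I₁ ⊕ I₂) : pd x (u a) = if (.u a, 0) = x then 1 else 0 := pd_jet x _ _
open Classical in
theorem pd_ut (a : I₁ ⊕ I₂) : pd x (ut a) = if (.ut a, 0) = x then 1 else 0 := pd_jet x _ _
open Classical in
theorem pd_d_ut (ν : Fin 4) (a : I₁ ⊕ I₂) :
    pd x (d ν (ut a)) = if (.ut a, {ν}) = x then 1 else 0 := by
  rw [ut, d_jet]; exact pd_jet x _ _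
open Classical in
theorem pd_Φ (c : I₂ ⊕ I₃) : pd x (Φ c) = if (.Φ c, 0) = x then 1 else 0 := pd_jet x _ _
open Classical in
theorem pd_d_Φ (ν : Fin 4) (c : I₂ ⊕ I₃) :
    pd x (d ν (Φ c)) = if (.Φ c, {ν}) = x then 1 else 0 := by
  rw [Φ, d_jet]; exact pd_jet x _ _

end Letters

/-! ### Explicit form of the Wick submonomials. -/

namespace Params

variable {I₁ I₂ I₃ I₄ : Type*} (P : Params I₁ I₂ I₃ I₄)

section
variable [Fintype I₄]
theorem pd_bil (x : Jet I₁ I₂ I₃ I₄) (h₁ : ∀ A α s, (.ψ A α, s) ≠ x)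
    (h₂ : ∀ A α s, (.ψbar A α, s) ≠ x)
    (m : Matrix I₄ I₄ ℂ) (g : Matrix (Fin 4) (Fin 4) ℂ) : pd x (bil m g) = 0 := by
  simp [bil, pd_mul, pd_jet, h₁, h₂]

theorem grading_bil (p : Bool) (m : Matrix I₄ I₄ ℂ) (g : Matrix (Fin 4) (Fin 4) ℂ) :
    grading p (bil m g : Expr I₁ I₂ I₃ I₄) = bil m g := by
  cases p <;> simp [bil, grading_jet, Fld.odd]

theorem pd_jV (x : Jet I₁ I₂ I₃ I₄) (h₁ : ∀ A α s, (.ψ A α, s) ≠ x)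
    (h₂ : ∀ A α s, (.ψbar A α, s) ≠ x) (a : I₁ ⊕ I₂) (μ : Fin 4) : pd x (P.jV a μ) = 0 := by
  rw [jV, map_sum]
  exact Finset.sum_eq_zero fun _ _ => pd_bil x h₁ h₂ _ _
theorem pd_jS (x : Jet I₁ I₂ I₃ I₄) (h₁ : ∀ A α s, (.ψ A α, s) ≠ x)
    (h₂ : ∀ A α s, (.ψbar A α, s) ≠ x) (c : I₂ ⊕ I₃) : pd x (P.jS c) = 0 := by
  rw [jS, map_sum]
  exact Finset.sum_eq_zero fun _ _ => pd_bil x h₁ h₂ _ _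
theorem grading_jV (p : Bool) (a : I₁ ⊕ I₂) (μ : Fin 4) : grading p (P.jV a μ) = P.jV a μ := by
  simp only [jV, map_sum, grading_bil]
theorem grading_jS (p : Bool) (c : I₂ ⊕ I₃) : grading p (P.jS c) = P.jS c := by
  simp only [jS, map_sum, grading_bil]
end

variable [Fintype I₁] [Fintype I₂] [Fintype I₃] [Fintype I₄]

theorem grading_T (p : Bool) : grading p P.T = P.T := by
  cases p
  · exact grading_false _
  · simp only [T, map_add, map_sum, map_smul, map_mul, map_neg, grading_v, grading_vL, grading_F, grading_u,
      grading_ut, grading_d_ut, grading_Φ, grading_d_Φ, grading_jV, grading_jS, neg_mul, mul_neg,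
      neg_neg]
theorem grading_T1 (μ : Fin 4) : grading true (P.T1 μ) = -P.T1 μ := by
  simp only [T1, map_add, map_sub, map_sum, map_smul, map_mul, map_neg, grading_v, grading_vL,
    grading_F, grading_u, grading_ut, grading_d_ut, grading_Φ, grading_d_Φ, grading_jV, neg_mul,
    mul_neg, neg_neg, smul_neg, Finset.sum_neg_distrib, smul_sub, Finset.sum_sub_distrib]
  abel

/-- `m_b f'_{abc}` as a tensor with a vector index `b`. -/
def mf' (a : I₂ ⊕ I₃) (b c : I₁ ⊕ I₂) : ℂ := P.f'V a b c * P.mV b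

/-- The mass vanishes on I₁, so a sum over massive indices weighted by the mass may run over all
vector indices. All contractions then use the same index types. -/
theorem sum_mf'_comm {M ι : Type*} [AddCommGroup M] [Module ℂ M] [Fintype ι] (a : I₂ ⊕ I₃)
    (c : ι → I₁ ⊕ I₂) (X : I₁ ⊕ I₂ → ι → M) :
    ∑ b : I₂, ∑ i, (P.f' a (.inl b) (c i) * (P.m₂ b : ℂ)) • X (.inr b) i =
      ∑ b, ∑ i, P.mf' a b (c i) • X b i := by
  simp [Fintype.sum_sum_type, mf', f'V, mV]

theorem T_eq : P.T =
    (∑ a, ∑ b, ∑ c, P.f a b c •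
      ((1 / 2 : ℂ) • (∑ μ, ∑ ν, vL a μ * vL b ν * F c ν μ) + ∑ μ, u a * v b μ * d μ (ut c)))
    + (∑ a, ∑ b, ∑ c, P.f' a b c • ∑ μ, Φ a * d μ (Φ b) * v c μ)
    + (∑ a, ∑ b, ∑ c, P.mf' a b c •
      (-(∑ μ, Φ a * vL b μ * v c μ) + Φ a * ut b * u c))
    + (1 / 6 : ℂ) • (∑ a, ∑ b, ∑ c, P.f'' a b c • (Φ a * Φ b * Φ c))
    + (∑ a, ∑ μ, P.jV a μ * vL a μ) + ∑ c, P.jS c * Φ c := by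
  simp only [T, ← P.sum_mf'_comm _ (fun i => i) fun b c => (-(∑ μ, Φ _ * vL b μ * v c μ) + Φ _ * ut b * u c)]

theorem T1_eq (μ : Fin 4) : P.T1 μ =
    (∑ a, ∑ b, ∑ c, P.f a b c •
      ((∑ ν, u a * vL b ν * F c ν μ) - (1 / 2 : ℂ) • (u a * u b * (η μ • d μ (ut c)))))
    + (∑ a, P.jV a μ * u a)
    + (∑ a, ∑ b, ∑ c, P.f' a b c • (Φ a * (η μ • d μ (Φ b)) * u c))
    - ∑ a, ∑ b, ∑ c, P.mf' a b c • (Φ a * v b μ * u c) := by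
  simp only [T1, ← P.sum_mf'_comm _ (fun i => i) fun b c => Φ _ * v b μ * u c]

theorem f_cyclic (hP : P.Consistent) (a b c : I₁ ⊕ I₂) : P.f b c a = P.f a b c := by
  rw [hP.f_antisymm₂, hP.f_antisymm₁, neg_neg]

theorem B1_eq (hP : P.Consistent) (a : I₁ ⊕ I₂) (μ : Fin 4) :
    P.B1 a μ = ∑ b, ∑ c, P.f a b c • (-(u b * v c μ)) := by
  classical
  rw [B1, sub, grading_T, T_eq]
  simp [-Fintype.sum_sum_type, pd_mul, pd_v, pd_vL, pd_d_v, pd_u, pd_ut, pd_d_ut, pd_Φ, pd_d_Φ,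
    pd_jV, pd_jS, F, Fld.odd, grading_u, grading_v, grading_vL, grading_Φ, grading_ut, grading_d_Φ,
    grading_d_v, grading_jV, grading_jS, ite_and, mul_sub, add_mul, smul_sub, Finset.sum_add_distrib,
    Finset.sum_sub_distrib, Finset.sum_ite_irrel, smul_ite]
  simp only [P.f_cyclic hP]

theorem D_eq (a : I₁ ⊕ I₂) :
    P.D a = ∑ b, ∑ c, P.f a b c • ∑ μ, v b μ * d μ (ut c) +
      ∑ b, ∑ c, P.mf' b c a • (-(Φ b * ut c)) := by
  classical
  rw [D, sub, grading_T, T_eq]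
  simp [-Fintype.sum_sum_type, pd_mul, pd_v, pd_vL, pd_d_v, pd_u, pd_ut, pd_d_ut, pd_Φ, pd_d_Φ,
    pd_jV, pd_jS, F, Fld.odd, grading_u, grading_v, grading_vL, grading_Φ, grading_ut, grading_d_Φ,
    grading_d_v, grading_jV, grading_jS, ite_and, mul_sub, add_mul, smul_sub, Finset.sum_add_distrib,
    Finset.sum_sub_distrib, Finset.sum_ite_irrel, smul_ite]

theorem D1_eq (hP : P.Consistent) (a : I₁ ⊕ I₂) (μ : Fin 4) :
    P.D1 a μ = (∑ b, ∑ c, P.f a b c • (-∑ ν, vL b ν * F c ν μ)) +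
      (∑ b, ∑ c, P.f a b c • (η μ • (u b * d μ (ut c)))) - P.jV a μ +
      (∑ b, ∑ c, P.f' b c a • (-(η μ • (Φ b * d μ (Φ c))))) +
      ∑ b, ∑ c, P.mf' b c a • (Φ b * v c μ) := by
  classical
  rw [D1, sub, Fld.odd, grading_T1, T1_eq]
  simp [-Fintype.sum_sum_type, pd_mul, pd_v, pd_vL, pd_d_v, pd_u, pd_ut, pd_d_ut, pd_Φ, pd_d_Φ,
    pd_jV, pd_jS, F, Fld.odd, grading_u, grading_v, grading_vL, grading_Φ, grading_ut, grading_d_Φ,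
    grading_d_v, grading_jV, grading_jS, ite_and, mul_sub, add_mul, smul_sub, Finset.sum_add_distrib,
    Finset.sum_sub_distrib, Finset.sum_ite_irrel, smul_ite]
  simp only [fun x y => hP.f_antisymm₁ x a y]
  simp [-Fintype.sum_sum_type]
  simp only [sum₂_smul_smul]
  module

theorem D2_eq (hP : P.Consistent) (a : I₁ ⊕ I₂) (μ ν : Fin 4) :
    P.D2 a μ ν = ∑ b, ∑ c, P.f a b c • (u b * F c μ ν) := by
  classical
  rw [D2, sub, T2]
  simp [-Fintype.sum_sum_type, pd_mul, pd_v, pd_vL, pd_d_v, pd_u, pd_ut, pd_d_ut, pd_Φ, pd_d_Φ,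
    pd_jV, pd_jS, F, Fld.odd, grading_u, grading_v, grading_vL, grading_Φ, grading_ut, grading_d_Φ,
    grading_d_v, grading_jV, grading_jS, ite_and, mul_sub, add_mul, smul_sub, Finset.sum_add_distrib,
    Finset.sum_sub_distrib, Finset.sum_ite_irrel, smul_ite]
  simp only [fun x y => hP.f_antisymm₁ x a y]
  simp [-Fintype.sum_sum_type]
  module

/-- The two terms of F give v v in both orders. They stay apart because the free algebra is not
commutative; they are merged only after applying a supercommuting homomorphism. -/
theorem E_eq (hP : P.Consistent) (a : I₁ ⊕ I₂) (μ ν : Fin 4) :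
    P.E a μ ν = ∑ b, ∑ c, P.f a b c •
      ((1 / 2 : ℂ) • (v b μ * v c ν) + (1 / 2 : ℂ) • (v c ν * v b μ)) := by
  classical
  rw [E, sub, grading_T, T_eq]
  simp [-Fintype.sum_sum_type, pd_mul, pd_v, pd_vL, pd_d_v, pd_u, pd_ut, pd_d_ut, pd_Φ, pd_d_Φ,
    pd_jV, pd_jS, F, Fld.odd, grading_u, grading_v, grading_vL, grading_Φ, grading_ut, grading_d_Φ,
    grading_d_v, grading_jV, grading_jS, ite_and, mul_sub, add_mul, smul_sub, Finset.sum_add_distrib,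
    Finset.sum_sub_distrib, Finset.sum_ite_irrel, smul_ite]
  -- Antisymmetry of f turns the minus sign of the second term of F into an exchange of the two
  -- summation indices.
  have e : ∑ x, ∑ y, P.f a x y • (v x ν * v y μ : Expr I₁ I₂ I₃ I₄) =
      -∑ x, ∑ y, P.f a x y • (v y ν * v x μ) := by
    rw [Finset.sum_comm]
    simp only [← Finset.sum_neg_distrib, ← neg_smul]
    exact Finset.sum_congr rfl fun x _ => Finset.sum_congr rfl fun y _ => by
      rw [hP.f_antisymm₂]
  simp only [vL, smul_mul_smul_comm, P.f_cyclic hP, sum₂_smul_smul, smul_add,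
    Finset.sum_add_distrib, e]
  match_scalars <;> linear_combination (1 / 2 : ℂ) * η ν * η ν * η_mul_self μ +
    (1 / 2 : ℂ) * η_mul_self ν

theorem G_eq (hP : P.Consistent) (c : I₂ ⊕ I₃) :
    P.G c = (∑ b, ∑ a, P.f' c b a • ∑ μ, d μ (Φ b) * v a μ) +
      (∑ b, ∑ a, P.mf' c b a • (-∑ μ, vL b μ * v a μ)) +
      (∑ b, ∑ a, P.mf' c b a • (ut b * u a)) +
      (∑ a, ∑ b, P.f'' c a b • ((1 / 2 : ℂ) • (Φ a * Φ b))) + P.jS c := by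
  classical
  rw [G, sub, grading_T, T_eq]
  simp [-Fintype.sum_sum_type, pd_mul, pd_v, pd_vL, pd_d_v, pd_u, pd_ut, pd_d_ut, pd_Φ, pd_d_Φ,
    pd_jV, pd_jS, F, Fld.odd, grading_u, grading_v, grading_vL, grading_Φ, grading_ut, grading_d_Φ,
    grading_d_v, grading_jV, grading_jS, ite_and, mul_sub, add_mul, smul_sub, Finset.sum_add_distrib,
    Finset.sum_sub_distrib, Finset.sum_ite_irrel, smul_ite]
  simp only [fun x y => hP.f''_symm₁ x c y, fun x y => (hP.f''_symm₂ x y c).trans (hP.f''_symm₁ x c y), ← Finset.smul_sum,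
    sum₂_smul_smul]
  module

theorem G1_eq (a : I₂ ⊕ I₃) (μ : Fin 4) :
    P.G1 a μ = ∑ b, ∑ c, P.f' a b c • (η μ • (d μ (Φ b) * u c)) +
      ∑ b, ∑ c, P.mf' a b c • (-(v b μ * u c)) := by
  classical
  rw [G1, sub, Fld.odd, grading_false, T1_eq]
  simp [-Fintype.sum_sum_type, pd_mul, pd_v, pd_vL, pd_d_v, pd_u, pd_ut, pd_d_ut, pd_Φ, pd_d_Φ,
    pd_jV, pd_jS, F, Fld.odd, grading_u, grading_v, grading_vL, grading_Φ, grading_ut, grading_d_Φ,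
    grading_d_v, grading_jV, grading_jS, ite_and, mul_sub, add_mul, smul_sub, Finset.sum_add_distrib,
    Finset.sum_sub_distrib, Finset.sum_ite_irrel, smul_ite]
  rw [sub_eq_add_neg]

theorem H1_eq (hP : P.Consistent) (a : I₂ ⊕ I₃) (μ : Fin 4) :
    P.H1 a μ = ∑ b, ∑ c, P.f' a b c • (-(Φ b * v c μ)) := by
  classical
  rw [H1, sub, Fld.odd, grading_false, T_eq]
  simp [-Fintype.sum_sum_type, pd_mul, pd_v, pd_vL, pd_d_v, pd_u, pd_ut, pd_d_ut, pd_Φ, pd_d_Φ,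
    pd_jV, pd_jS, F, Fld.odd, grading_u, grading_v, grading_vL, grading_Φ, grading_ut, grading_d_Φ,
    grading_d_v, grading_jV, grading_jS, ite_and, mul_sub, add_mul, smul_sub, Finset.sum_add_distrib,
    Finset.sum_sub_distrib, Finset.sum_ite_irrel, smul_ite]
  simp only [fun x => hP.f'_antisymm x a]
  simp [-Fintype.sum_sum_type]
end Params
end YM

namespace YM

/-! ### Resummation under the Jacobi identity and the representation property. -/

section Sums

variable {M α β γ δ : Type*} [AddCommGroup M] [Module ℂ M]
  [Fintype α] [Fintype β] [Fintype γ] [Fintype δ]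

theorem sum_contract {ι A : Type*} [Fintype ι] [Ring A] [Algebra ℂ A] (C : ι → α → β → ℂ)
    (C' : ι → γ → δ → ℂ) (X : α → β → A) (Y : γ → δ → A) :
    ∑ i, (∑ b, ∑ c, C i b c • X b c) * (∑ e, ∑ g, C' i e g • Y e g) =
      ∑ b, ∑ c, ∑ e, ∑ g, (∑ i, C i b c * C' i e g) • (X b c * Y e g) := by
  simp only [Finset.sum_mul]
  simp only [Finset.mul_sum, smul_mul_smul_comm, Finset.sum_smul]
  exact Finset.sum_comm.trans <| Finset.sum_congr rfl fun b _ =>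
    Finset.sum_comm.trans <| Finset.sum_congr rfl fun c _ =>
    Finset.sum_comm.trans <| Finset.sum_congr rfl fun e _ => Finset.sum_comm

theorem sum_smul_sum₄ {N : Type*} [Fintype N] (k : N → ℂ) (C : α → β → γ → δ → ℂ)
    (X : N → α → β → γ → δ → M) :
    ∑ n, k n • ∑ a, ∑ b, ∑ c, ∑ e, C a b c e • X n a b c e =
      ∑ a, ∑ b, ∑ c, ∑ e, C a b c e • ∑ n, k n • X n a b c e := by
  simp only [Finset.smul_sum, smul_smul, fun n a b c e => mul_comm (C a b c e) (k n)]
  exact Finset.sum_comm.trans <| Finset.sum_congr rfl fun b _ =>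
    Finset.sum_comm.trans <| Finset.sum_congr rfl fun c _ =>
    Finset.sum_comm.trans <| Finset.sum_congr rfl fun e _ => Finset.sum_comm

theorem sum_reorder (G : α → β → γ → δ → M) :
    ∑ a, ∑ b, ∑ c, ∑ e, G a b c e = ∑ b, ∑ e, ∑ a, ∑ c, G a b c e :=
  Finset.sum_comm.trans <| Finset.sum_congr rfl fun _ _ =>
    (Finset.sum_congr rfl fun _ _ => Finset.sum_comm).trans Finset.sum_comm

theorem sum_reorder' (G : α → β → γ → δ → M) :
    ∑ a, ∑ b, ∑ c, ∑ e, G a b c e = ∑ e, ∑ b, ∑ a, ∑ c, G a b c e :=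
  (sum_reorder G).trans Finset.sum_comm

theorem sum₄_congr {F G : α → β → γ → δ → M} (h : ∀ a b c e, F a b c e = G a b c e) :
    ∑ a, ∑ b, ∑ c, ∑ e, F a b c e = ∑ a, ∑ b, ∑ c, ∑ e, G a b c e :=
  Finset.sum_congr rfl fun a _ => Finset.sum_congr rfl fun b _ =>
    Finset.sum_congr rfl fun c _ => Finset.sum_congr rfl fun e _ => h a b c e

theorem sum_cyclic (G : α → β → γ → M) :
    ∑ b, ∑ c, ∑ a, G a b c = ∑ a, ∑ b, ∑ c, G a b c :=
  (Finset.sum_congr rfl fun _ _ => Finset.sum_comm).trans Finset.sum_comm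

/-- Contractions of two antisymmetric tensors `f_{abc} f_{ade}` obeying the Jacobi identity. -/
theorem jacobi_combine {K : α → α → α → β → ℂ} {X : α → α → α → β → M}
    (hJ : ∀ b c e g, K b c e g + K c e b g + K e b c g = 0)
    (hK : ∀ b c e g, K c b e g = -K b c e g) (hX : ∀ b c e g, X b e c g = -X b c e g) :
    ∑ b, ∑ c, ∑ e, ∑ g, K b c e g • X e c b g =
      (2 : ℂ) • ∑ b, ∑ c, ∑ e, ∑ g, K b c e g • X b c e g := by
  -- Relabelling moves the permutation from X to K. The Jacobi identity then reads K_{ecb} = K_{bce}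
  -- + K_{ebc}, and the antisymmetries of K and X make the two contributions equal, whence the
  -- factor 2.
  have h1 : ∑ b, ∑ c, ∑ e, ∑ g, K b c e g • X e c b g =
      ∑ b, ∑ c, ∑ e, ∑ g, K e c b g • X b c e g :=
    (Finset.sum_congr rfl fun _ _ => Finset.sum_comm).trans <| Finset.sum_comm.trans <|
      Finset.sum_congr rfl fun _ _ => Finset.sum_comm
  have h2 : ∑ b, ∑ c, ∑ e, ∑ g, K e b c g • X b c e g =
      ∑ b, ∑ c, ∑ e, ∑ g, K b c e g • X b c e g :=
    (Finset.sum_congr rfl fun b _ => Finset.sum_comm).trans <| sum₄_congr fun b c e g => by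
      rw [hX, hK, smul_neg, neg_smul, neg_neg]
  have h3 : ∑ b, ∑ c, ∑ e, ∑ g, K e c b g • X b c e g =
      ∑ b, ∑ c, ∑ e, ∑ g, (K b c e g • X b c e g + K e b c g • X b c e g) :=
    sum₄_congr fun b c e g => by
      rw [← add_smul, hK c e]
      congr 1
      linear_combination -hJ b c e g
  rw [h1, h3]
  simp only [Finset.sum_add_distrib, h2]
  module

/-- Both sides of `jacobi_combine` change sign: the left by the antisymmetry of X in its second and
third arguments, the right by that of K in its first two. -/
theorem jacobi_combine' {K : α → α → α → β → ℂ} {X : α → α → α → β → M}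
    (hJ : ∀ b c e g, K b c e g + K c e b g + K e b c g = 0)
    (hK : ∀ b c e g, K c b e g = -K b c e g) (hX : ∀ b c e g, X b e c g = -X b c e g) :
    ∑ b, ∑ c, ∑ e, ∑ g, K b c e g • X e b c g =
      (2 : ℂ) • ∑ b, ∑ c, ∑ e, ∑ g, K b c e g • X c b e g := by
  have h1 : ∑ b, ∑ c, ∑ e, ∑ g, K b c e g • X c b e g =
      -∑ b, ∑ c, ∑ e, ∑ g, K b c e g • X b c e g := by
    simp only [← Finset.sum_neg_distrib]
    exact Finset.sum_comm.trans <| sum₄_congr fun b c e g => by rw [hK, neg_smul]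
  have h2 : ∑ b, ∑ c, ∑ e, ∑ g, K b c e g • X e b c g =
      -∑ b, ∑ c, ∑ e, ∑ g, K b c e g • X e c b g := by
    simp only [← Finset.sum_neg_distrib]
    exact sum₄_congr fun b c e g => by rw [hX e c b, smul_neg]
  rw [h1, h2, jacobi_combine hJ hK hX, smul_neg]

/-- A cyclically invariant X sees only the cyclic sum of K, so three times the contraction is zero.
-/
theorem jacobi_cyclic {K : α → α → α → β → ℂ} {X : α → α → α → β → M}
    (hJ : ∀ b c e g, K b c e g + K c e b g + K e b c g = 0)
    (hX : ∀ b c e g, X c e b g = X b c e g) :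
    ∑ b, ∑ c, ∑ e, ∑ g, K b c e g • X b c e g = 0 := by
  have h1 : ∑ b, ∑ c, ∑ e, ∑ g, K c e b g • X b c e g =
      ∑ b, ∑ c, ∑ e, ∑ g, K b c e g • X b c e g := by
    rw [← sum_cyclic fun b c e => ∑ g, K c e b g • X b c e g]
    exact sum₄_congr fun b c e g => by rw [hX e b c]
  have h2 : ∑ b, ∑ c, ∑ e, ∑ g, K e b c g • X b c e g =
      ∑ b, ∑ c, ∑ e, ∑ g, K b c e g • X b c e g := by
    rw [← sum_cyclic fun b c e => ∑ g, K b c e g • X b c e g]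
    exact sum₄_congr fun b c e g => by rw [hX]
  have h3 : (3 : ℂ) • ∑ b, ∑ c, ∑ e, ∑ g, K b c e g • X b c e g = 0 := by
    calc _ = ∑ b, ∑ c, ∑ e, ∑ g, (K b c e g + K c e b g + K e b c g) • X b c e g := by
          simp only [add_smul, Finset.sum_add_distrib, h1, h2]; module
      _ = 0 := by simp [hJ]
  simpa using h3

/-- Contractions `f_{abc} f'_{dea}` and `f'_{kdb} f'_{kec}` related by the representation
property. -/
theorem representation_combine {L : α → α → β → γ → ℂ} {R : β → α → γ → α → ℂ}
    {X : α → α → β → γ → M} (h : ∀ b c e g, L b c e g = R e b g c - R e c g b) :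
    ∑ b, ∑ c, ∑ e, ∑ g, L b c e g • X b c e g =
      ∑ e, ∑ b, ∑ g, ∑ c, R e b g c • X b c e g -
      ∑ e, ∑ b, ∑ g, ∑ c, R e b g c • X c b e g := by
  rw [sum_reorder fun e b g c => R e b g c • X b c e g,
    sum_reorder' fun e b g c => R e b g c • X c b e g]
  simp only [← Finset.sum_sub_distrib, ← sub_smul]
  exact sum₄_congr fun b c e g => by rw [h]

/-- On a monomial antisymmetric in b and c, such as one containing u_b u_c, the two terms of the
commutator contribute equally. -/
theorem representation_combine_anti {L : α → α → β → γ → ℂ} {R : β → α → γ → α → ℂ}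
    {X : α → α → β → γ → M} (h : ∀ b c e g, L b c e g = R e b g c - R e c g b)
    (hX : ∀ b c e g, X c b e g = -X b c e g) :
    ∑ b, ∑ c, ∑ e, ∑ g, L b c e g • X b c e g =
      (2 : ℂ) • ∑ e, ∑ b, ∑ g, ∑ c, R e b g c • X b c e g := by
  have h1 : ∑ e, ∑ b, ∑ g, ∑ c, R e b g c • X c b e g =
      -∑ e, ∑ b, ∑ g, ∑ c, R e b g c • X b c e g := by
    simp only [← Finset.sum_neg_distrib]
    exact sum₄_congr fun e b g c => by rw [hX b c, smul_neg]
  rw [representation_combine h, h1]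
  module

end Sums
-- Sorting the factors of a monomial.
section Rules

variable {I₁ I₂ I₃ I₄ : Type*} {S : Type*} [Ring S] [Algebra ℂ S]
  {φ : Expr I₁ I₂ I₃ I₄ →ₐ[ℂ] S}

theorem mul_left_comm_of {x y : S} (h : x * y = y * x) (z : S) : x * (y * z) = y * (x * z) := by
  rw [← mul_assoc, h, mul_assoc]

theorem mul_left_anticomm_of {x y : S} (h : x * y = -(y * x)) (z : S) :
    x * (y * z) = -(y * (x * z)) := by
  rw [← mul_assoc, h, neg_mul, mul_assoc]

theorem SuperCommutes.sub {p : Bool} {A B : Expr I₁ I₂ I₃ I₄} (hA : SuperCommutes φ p A)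
    (hB : SuperCommutes φ p B) : SuperCommutes φ p (A - B) := by
  rw [sub_eq_add_neg, ← neg_one_smul ℂ B]
  exact hA.add (hB.smul _)

theorem SuperCommutes.anticomm {A : Expr I₁ I₂ I₃ I₄} (hA : SuperCommutes φ true A)
    (ξ : Fld I₁ I₂ I₃ I₄) (s : Multiset (Fin 4)) (hξ : ξ.odd = true) :
    φ A * φ (jet ξ s) = -(φ (jet ξ s) * φ A) := by
  have := hA (ξ, s)
  simp only [sgn, hξ, Bool.and_self, if_true, neg_smul, one_smul] at this
  exact this

namespace IsSuperComm

variable (hφ : IsSuperComm φ)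
include hφ

theorem v (a : I₁ ⊕ I₂) (μ : Fin 4) : SuperCommutes φ false (v a μ) := hφ.jet _ _
theorem Φ (c : I₂ ⊕ I₃) : SuperCommutes φ false (Φ c) := hφ.jet _ _
theorem d_v (ν : Fin 4) (a : I₁ ⊕ I₂) (μ : Fin 4) : SuperCommutes φ false (d ν (YM.v a μ)) := by
  rw [YM.v, d_jet]; exact hφ.jet _ _
theorem d_Φ (ν : Fin 4) (c : I₂ ⊕ I₃) : SuperCommutes φ false (d ν (YM.Φ c)) := by
  rw [YM.Φ, d_jet]; exact hφ.jet _ _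
theorem F (a : I₁ ⊕ I₂) (μ ν : Fin 4) : SuperCommutes φ false (F a μ ν) :=
  ((hφ.d_v _ _ _).smul _).sub ((hφ.d_v _ _ _).smul _)
theorem u (a : I₁ ⊕ I₂) : SuperCommutes φ true (u a) := hφ.jet _ _
theorem ut (a : I₁ ⊕ I₂) : SuperCommutes φ true (ut a) := hφ.jet _ _

theorem u_mul_u (a b : I₁ ⊕ I₂) : φ (YM.u a) * φ (YM.u b) = -(φ (YM.u b) * φ (YM.u a)) :=
  (hφ.u a).anticomm _ _ rfl
theorem ut_mul_u (a b : I₁ ⊕ I₂) : φ (YM.ut a) * φ (YM.u b) = -(φ (YM.u b) * φ (YM.ut a)) :=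
  (hφ.ut a).anticomm _ _ rfl

/-- Rules sorting the factors of a monomial: `ψ̄ψ`, `Φ`, `∂Φ`, `v`, `F`, `u`, `ũ`, `∂ũ`. -/
theorem sorting :
    (∀ B c, φ (YM.u B) * φ (YM.Φ c) = φ (YM.Φ c) * φ (YM.u B)) ∧
    (∀ B c z, φ (YM.u B) * (φ (YM.Φ c) * z) = φ (YM.Φ c) * (φ (YM.u B) * z)) ∧
    (∀ B c, φ (YM.ut B) * φ (YM.Φ c) = φ (YM.Φ c) * φ (YM.ut B)) ∧
    (∀ B c z, φ (YM.ut B) * (φ (YM.Φ c) * z) = φ (YM.Φ c) * (φ (YM.ut B) * z)) ∧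
    (∀ B μ c, φ (YM.v B μ) * φ (YM.Φ c) = φ (YM.Φ c) * φ (YM.v B μ)) ∧
    (∀ B μ c z, φ (YM.v B μ) * (φ (YM.Φ c) * z) = φ (YM.Φ c) * (φ (YM.v B μ) * z)) ∧
    (∀ B μ ν c, φ (YM.v B μ) * φ (d ν (YM.Φ c)) = φ (d ν (YM.Φ c)) * φ (YM.v B μ)) ∧
    (∀ B μ ν c z, φ (YM.v B μ) * (φ (d ν (YM.Φ c)) * z) =
      φ (d ν (YM.Φ c)) * (φ (YM.v B μ) * z)) ∧
    (∀ B ν c, φ (YM.u B) * φ (d ν (YM.Φ c)) = φ (d ν (YM.Φ c)) * φ (YM.u B)) ∧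
    (∀ B ν c z, φ (YM.u B) * (φ (d ν (YM.Φ c)) * z) = φ (d ν (YM.Φ c)) * (φ (YM.u B) * z)) ∧
    (∀ B a μ, φ (YM.u B) * φ (YM.v a μ) = φ (YM.v a μ) * φ (YM.u B)) ∧
    (∀ B a μ z, φ (YM.u B) * (φ (YM.v a μ) * z) = φ (YM.v a μ) * (φ (YM.u B) * z)) ∧
    (∀ B a μ ν, φ (YM.u B) * φ (YM.F a μ ν) = φ (YM.F a μ ν) * φ (YM.u B)) ∧
    (∀ B a μ ν z, φ (YM.u B) * (φ (YM.F a μ ν) * z) = φ (YM.F a μ ν) * (φ (YM.u B) * z)) ∧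
    (∀ B a, φ (YM.ut B) * φ (YM.u a) = -(φ (YM.u a) * φ (YM.ut B))) :=
  have hΦ := fun B c => (hφ.Φ c).central B
  have hv := fun B a μ => (hφ.v a μ).central B
  have hdΦ := fun B μ c => (hφ.d_Φ μ c).central B
  have hF := fun B a μ ν => (hφ.F a μ ν).central B
  ⟨fun _ => hΦ _, fun _ _ => mul_left_comm_of (hΦ _ _), fun _ => hΦ _,
    fun _ _ => mul_left_comm_of (hΦ _ _), fun _ _ => hΦ _,
    fun _ _ _ => mul_left_comm_of (hΦ _ _), fun _ _ => hdΦ _,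
    fun _ _ _ _ => mul_left_comm_of (hdΦ _ _ _), fun _ => hdΦ _,
    fun _ _ _ => mul_left_comm_of (hdΦ _ _ _), fun _ => hv _,
    fun _ _ _ => mul_left_comm_of (hv _ _ _), fun _ => hF _,
    fun _ _ _ _ => mul_left_comm_of (hF _ _ _ _), hφ.ut_mul_u⟩

end IsSuperComm

end Rules

end YM

namespace YM
namespace Params

variable {I₁ I₂ I₃ I₄ : Type*} (P : Params I₁ I₂ I₃ I₄)
  [Fintype I₁] [Fintype I₂] [Fintype I₃] [Fintype I₄]

/-! Contractions of the coupling constants. -/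

/-- `f_{abc} f_{aeg}` -/
def ff (b c e g : I₁ ⊕ I₂) : ℂ := ∑ a, P.f a b c * P.f a e g
/-- `f_{abc} f'_{ega}` -/
def ff' (b c : I₁ ⊕ I₂) (e g : I₂ ⊕ I₃) : ℂ := ∑ a, P.f a b c * P.f' e g a
/-- `m_g f_{abc} f'_{ega}` -/
def fmf' (b c : I₁ ⊕ I₂) (e : I₂ ⊕ I₃) (g : I₁ ⊕ I₂) : ℂ := ∑ a, P.f a b c * P.mf' e g a
/-- `f'_{keb} f'_{kgc}` -/
def f'f' (e : I₂ ⊕ I₃) (b : I₁ ⊕ I₂) (g : I₂ ⊕ I₃) (c : I₁ ⊕ I₂) : ℂ :=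
  ∑ k, P.f' k e b * P.f' k g c
/-- `m_g f'_{keb} f'_{kgc}` -/
def f'mf' (e : I₂ ⊕ I₃) (b : I₁ ⊕ I₂) (g : I₁ ⊕ I₂) (c : I₁ ⊕ I₂) : ℂ :=
  ∑ k, P.f' k e b * P.mf' k g c
/-- `f'_{keb} f''_{kgc}` -/
def f'f'' (e : I₂ ⊕ I₃) (b : I₁ ⊕ I₂) (g c : I₂ ⊕ I₃) : ℂ := ∑ k, P.f' k e b * P.f'' k g c

variable {P}

theorem Jacobi.ff (hJ : P.Jacobi) (b c e g : I₁ ⊕ I₂) :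
    P.ff b c e g + P.ff c e b g + P.ff e b c g = 0 := by
  simpa only [Params.ff, Finset.sum_add_distrib] using hJ b c e g

theorem Consistent.ff_swap (hP : P.Consistent) (b c e g : I₁ ⊕ I₂) :
    P.ff c b e g = -P.ff b c e g := by
  simp only [Params.ff, ← Finset.sum_neg_distrib]
  exact Finset.sum_congr rfl fun a _ => by rw [hP.f_antisymm₂ a c b, neg_mul]

/-- The commutation relation entry by entry. Antisymmetry of f' and cyclicity of f bring every
contracted index to the front, which is the form in which the contractions arise in the anomalies.
-/
theorem Consistent.representation_iff (hP : P.Consistent) :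
    P.Representation ↔ ∀ b c e g, P.ff' b c e g = P.f'f' e b g c - P.f'f' e c g b := by
  have h : ∀ b c e g, ((P.T' b * P.T' c - P.T' c * P.T' b) e g = (∑ a, P.f b c a • P.T' a) e g) ↔
      P.ff' b c e g = P.f'f' e b g c - P.f'f' e c g b := by
    intro b c e g
    have h1 : ∀ b c, ∑ k, -P.f' e k b * -P.f' k g c = -P.f'f' e b g c := fun b c => by
      rw [f'f', ← Finset.sum_neg_distrib]
      exact Finset.sum_congr rfl fun k _ => by rw [hP.f'_antisymm e k]; ring
    have h2 : ∑ a, P.f b c a * -P.f' e g a = -P.ff' b c e g := by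
      rw [Params.ff', ← Finset.sum_neg_distrib]
      exact Finset.sum_congr rfl fun a _ => by rw [P.f_cyclic hP]; ring
    simp only [T', Matrix.sub_apply, Matrix.mul_apply, Matrix.of_apply, Matrix.sum_apply,
      Matrix.smul_apply, smul_eq_mul, h1, h2]
    constructor <;> intro h <;> linear_combination h
  constructor
  · intro hR b c e g
    exact (h b c e g).1 (by rw [hR b c])
  · intro hR b c
    ext e g
    exact (h b c e g).2 (hR b c e g)

/-- The massive version of the representation property: multiply by m_g when g is massive; both
sides are zero when it is massless. -/
theorem fmf'_eq (h : ∀ b c e g, P.ff' b c e g = P.f'f' e b g c - P.f'f' e c g b)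
    (b c : I₁ ⊕ I₂) (e : I₂ ⊕ I₃) (g : I₁ ⊕ I₂) :
    P.fmf' b c e g = P.f'mf' e b g c - P.f'mf' e c g b := by
  rcases g with g | g
  · simp [fmf', f'mf', mf', f'V]
  · have := congrArg (· * (P.m₂ g : ℂ)) (h b c e (.inl g))
    simpa [-Fintype.sum_sum_type, fmf', f'mf', mf', f'V, mV, ff', f'f', Finset.sum_mul, sub_mul, mul_assoc] using this

variable (P)

/-! Products of Wick submonomials. -/

theorem B_eq (a : I₁ ⊕ I₂) :
    P.B a = ∑ b, ∑ c, P.f a b c • ((1 / 2 : ℂ) • (u b * u c)) := by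
  rw [sum₂_smul_smul, B]

theorem H_eq (k : I₂ ⊕ I₃) : P.H k = ∑ e, ∑ b, P.f' k e b • (-(Φ e * u b)) := by
  simp only [H, smul_neg, Finset.sum_neg_distrib]

theorem sum_B_D2 (hP : P.Consistent) (μ ν : Fin 4) :
    ∑ a, P.B a * P.D2 a μ ν = ∑ b, ∑ c, ∑ e, ∑ g,
      P.ff b c e g • (((1 / 2 : ℂ) • (u b * u c)) * (u e * F g μ ν)) := by
  simp only [P.B_eq, P.D2_eq hP, sum_contract, ff]

theorem sum_B1_D2 (hP : P.Consistent) (ρ μ ν : Fin 4) :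
    ∑ a, P.B1 a ρ * P.D2 a μ ν = ∑ b, ∑ c, ∑ e, ∑ g,
      P.ff b c e g • ((-(u b * v c ρ)) * (u e * F g μ ν)) := by
  simp only [P.B1_eq hP, P.D2_eq hP, sum_contract, ff]

theorem sum_E_D2 (hP : P.Consistent) (μ ν : Fin 4) :
    ∑ a, P.E a μ ν * P.D2 a μ ν = ∑ b, ∑ c, ∑ e, ∑ g,
      P.ff b c e g • (((1 / 2 : ℂ) • (v b μ * v c ν) + (1 / 2 : ℂ) • (v c ν * v b μ)) *
        (u e * F g μ ν)) := by
  simp only [P.E_eq hP, P.D2_eq hP, sum_contract, ff]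

theorem sum_B_D :
    ∑ a, P.B a * P.D a =
      (∑ b, ∑ c, ∑ e, ∑ g,
        P.ff b c e g • (((1 / 2 : ℂ) • (u b * u c)) * ∑ μ, v e μ * d μ (ut g))) +
      ∑ b, ∑ c, ∑ e, ∑ g,
        P.fmf' b c e g • (((1 / 2 : ℂ) • (u b * u c)) * -(Φ e * ut g)) := by
  simp only [P.B_eq, P.D_eq, mul_add, Finset.sum_add_distrib, sum_contract, ff, fmf']

theorem sum_mul_D1 (hP : P.Consistent) (X : I₁ ⊕ I₂ → I₁ ⊕ I₂ → Expr I₁ I₂ I₃ I₄) (μ : Fin 4) :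
    ∑ a, (∑ b, ∑ c, P.f a b c • X b c) * P.D1 a μ =
      (∑ b, ∑ c, ∑ e, ∑ g, P.ff b c e g • (X b c * -∑ ν, vL e ν * F g ν μ)) +
      (∑ b, ∑ c, ∑ e, ∑ g, P.ff b c e g • (X b c * (η μ • (u e * d μ (ut g))))) -
      (∑ a, (∑ b, ∑ c, P.f a b c • X b c) * P.jV a μ) +
      (∑ b, ∑ c, ∑ e, ∑ g, P.ff' b c e g • (X b c * -(η μ • (Φ e * d μ (Φ g))))) +
      ∑ b, ∑ c, ∑ e, ∑ g, P.fmf' b c e g • (X b c * (Φ e * v g μ)) := by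
  simp only [P.D1_eq hP, mul_add, mul_sub, Finset.sum_add_distrib, Finset.sum_sub_distrib,
    sum_contract, ff, ff', fmf']

theorem sum_mul_G1 (X : I₂ ⊕ I₃ → I₁ ⊕ I₂ → Expr I₁ I₂ I₃ I₄) (μ : Fin 4) :
    ∑ k, (∑ e, ∑ b, P.f' k e b • X e b) * P.G1 k μ =
      (∑ e, ∑ b, ∑ g, ∑ c, P.f'f' e b g c • (X e b * (η μ • (d μ (Φ g) * u c)))) +
      ∑ e, ∑ b, ∑ g, ∑ c, P.f'mf' e b g c • (X e b * -(v g μ * u c)) := by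
  simp only [P.G1_eq, mul_add, Finset.sum_add_distrib, sum_contract, f'f', f'mf']

theorem sum_mul_G (hP : P.Consistent) (X : I₂ ⊕ I₃ → I₁ ⊕ I₂ → Expr I₁ I₂ I₃ I₄) :
    ∑ k, (∑ e, ∑ b, P.f' k e b • X e b) * P.G k =
      (∑ e, ∑ b, ∑ g, ∑ c, P.f'f' e b g c • (X e b * ∑ μ, d μ (Φ g) * v c μ)) +
      (∑ e, ∑ b, ∑ g, ∑ c, P.f'mf' e b g c • (X e b * -∑ μ, vL g μ * v c μ)) +
      (∑ e, ∑ b, ∑ g, ∑ c, P.f'mf' e b g c • (X e b * (ut g * u c))) +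
      (∑ e, ∑ b, ∑ g, ∑ c, P.f'f'' e b g c • (X e b * ((1 / 2 : ℂ) • (Φ g * Φ c)))) +
      ∑ k, (∑ e, ∑ b, P.f' k e b • X e b) * P.jS k := by
  simp only [P.G_eq hP, mul_add, Finset.sum_add_distrib, sum_contract, f'f', f'mf', f'f'']

end Params
end YM

/-! ### The anomalies of (T^μ,T) and (T^μ,T^ν). -/

namespace YM
namespace Params

variable {I₁ I₂ I₃ I₄ : Type*} (P : Params I₁ I₂ I₃ I₄)
  [Fintype I₁] [Fintype I₂] [Fintype I₃] [Fintype I₄]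

theorem bil_sub_smul {ι : Type*} [Fintype ι] (c : ι → ℂ) (t : ι → Matrix I₄ I₄ ℂ) (k : ℂ)
    (m : Matrix I₄ I₄ ℂ) (g : Matrix (Fin 4) (Fin 4) ℂ) :
    (bil (k • m - ∑ i, c i • t i) g : Expr I₁ I₂ I₃ I₄) = k • bil m g - ∑ i, c i • bil (t i) g := by
  have h : (∑ i, c i • bil (t i) g : Expr I₁ I₂ I₃ I₄) = bil (∑ i, c i • t i) g := by
    simp only [bil, Finset.smul_sum, Matrix.sum_apply, Matrix.smul_apply, Finset.sum_mul,
      Finset.sum_smul, smul_eq_mul]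
    rw [Finset.sum_comm]
    refine Finset.sum_congr rfl fun A _ => ?_
    rw [Finset.sum_comm]
    refine Finset.sum_congr rfl fun B _ => ?_
    rw [Finset.sum_comm]
    refine Finset.sum_congr rfl fun α _ => ?_
    rw [Finset.sum_comm]
    refine Finset.sum_congr rfl fun β _ => ?_
    exact Finset.sum_congr rfl fun i _ => by rw [smul_smul, mul_assoc]
  rw [h]
  simp only [bil, ← Finset.sum_sub_distrib, Finset.smul_sum, smul_smul, ← sub_smul,
    Matrix.sub_apply, Matrix.smul_apply, smul_eq_mul]
  refine Finset.sum_congr rfl fun A _ => Finset.sum_congr rfl fun B _ =>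
    Finset.sum_congr rfl fun α _ => Finset.sum_congr rfl fun β _ => ?_
  congr 1; ring

theorem bil_zero (g : Matrix (Fin 4) (Fin 4) ℂ) : (bil 0 g : Expr I₁ I₂ I₃ I₄) = 0 := by
  simp [bil]

/-- The obstruction to the commutation relations of the `t_a^ε`. -/
def XD (b c : I₁ ⊕ I₂) (ε : ℤˣ) : Matrix I₄ I₄ ℂ :=
  (-Complex.I) • (P.t b ε * P.t c ε - P.t c ε * P.t b ε) - ∑ a, P.f a b c • P.t a ε

/-- The obstruction to the intertwining relations of the `s_c^ε`. -/
def YD (a : I₁ ⊕ I₂) (c : I₂ ⊕ I₃) (ε : ℤˣ) : Matrix I₄ I₄ ℂ :=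
  (-2 * Complex.I) • (P.t a (-ε) * P.s c ε - P.s c ε * P.t a ε) -
    ∑ k, (-2 * P.f' k c a) • P.s k ε

/-- The Dirac part of the descent anomaly, including the terms with currents. -/
def dirac1 (μ : Fin 4) : Expr I₁ I₂ I₃ I₄ :=
  ∑ b, ∑ c, ∑ ε : ℤˣ, u b * u c * bil (P.XD b c ε) ((η μ • P.γ μ) * P.γε ε)

/-- D_a^μ contains -j_a^μ, so 2 B_a D_a^μ contributes exactly the f t term that completes the
commutator to `XD`. -/
theorem dirac1_eq (μ : Fin 4) :
    P.ADirac1 μ - (2 : ℂ) • ∑ a, P.B a * P.jV a μ = P.dirac1 μ := by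
  have h : (2 : ℂ) • ∑ a, P.B a * P.jV a μ = ∑ b, ∑ c, ∑ ε : ℤˣ, ∑ a,
      u b * u c * (P.f a b c • bil (P.t a ε) ((η μ • P.γ μ) * P.γε ε)) := by
    have h1 : ∀ a, (2 : ℂ) • (P.B a * P.jV a μ) = ∑ b, ∑ c, ∑ ε : ℤˣ,
        u b * u c * (P.f a b c • bil (P.t a ε) ((η μ • P.γ μ) * P.γε ε)) := fun a => by
      rw [B, jV, smul_mul_assoc, smul_smul]
      norm_num only [one_smul]
      simp only [Finset.sum_mul]
      simp only [Finset.mul_sum, smul_mul_assoc, mul_smul_comm]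
    rw [Finset.smul_sum]
    simp only [h1]
    exact Finset.sum_comm.trans <| Finset.sum_congr rfl fun b _ =>
      Finset.sum_comm.trans <| Finset.sum_congr rfl fun c _ => Finset.sum_comm
  rw [h]
  simp only [dirac1, XD, bil_sub_smul, ADirac1, mul_sub, Finset.sum_sub_distrib, Finset.mul_sum,
    Finset.smul_sum, mul_smul_comm]

/-- The part of the anomaly `𝒜(T^μ,T)` with two scalar fields. -/
def scalar1 (μ : Fin 4) : Expr I₁ I₂ I₃ I₄ :=
  (∑ b, ∑ c, ∑ e, ∑ g, P.ff' b c e g • (u b * u c * -(η μ • (Φ e * d μ (Φ g))))) +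
    (∑ b, ∑ c, ∑ e, ∑ g, P.fmf' b c e g • (u b * u c * (Φ e * v g μ))) -
    (2 : ℂ) • ((∑ e, ∑ b, ∑ g, ∑ c, P.f'f' e b g c •
        ((-(Φ e * u b)) * (η μ • (d μ (Φ g) * u c)))) +
      ∑ e, ∑ b, ∑ g, ∑ c, P.f'mf' e b g c • ((-(Φ e * u b)) * -(v g μ * u c)))

theorem A10_expand (hP : P.Consistent) (μ : Fin 4) : P.A10 μ =
    (∑ b, ∑ c, ∑ e, ∑ g, P.ff b c e g • (u b * u c * -∑ ν, vL e ν * F g ν μ)) +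
    (2 : ℂ) • (∑ b, ∑ c, ∑ e, ∑ g, P.ff b c e g •
      ∑ ν, η ν • (-(u b * v c ν) * (u e * F g μ ν))) +
    (∑ b, ∑ c, ∑ e, ∑ g, P.ff b c e g • (u b * u c * (η μ • (u e * d μ (ut g))))) +
    P.scalar1 μ + P.dirac1 μ := by
  have h1 : ∑ a, ∑ ν, η ν • (P.B1 a ν * P.D2 a μ ν) = ∑ b, ∑ c, ∑ e, ∑ g, P.ff b c e g •
      ∑ ν, η ν • (-(u b * v c ν) * (u e * F g μ ν)) := by
    rw [Finset.sum_comm]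
    simp only [← Finset.smul_sum, P.sum_B1_D2 hP]
    exact sum_smul_sum₄ η _ fun ν b c e g => -(u b * v c ν) * (u e * F g μ ν)
  have h2 := P.sum_mul_D1 hP (fun b c => (1 / 2 : ℂ) • (u b * u c)) μ
  simp only [← P.B_eq, smul_mul_assoc, sum₂_smul_smul, ← Finset.smul_sum] at h2
  have h3 := P.sum_mul_G1 (fun e b => -(Φ e * u b)) μ
  simp only [← P.H_eq] at h3
  rw [A10, Finset.sum_add_distrib, h1, h2, h3, ← dirac1_eq, scalar1]
  module

end Params
end YM

namespace YM
namespace Params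

variable {I₁ I₂ I₃ I₄ : Type*} (P : Params I₁ I₂ I₃ I₄)
  [Fintype I₁] [Fintype I₂] [Fintype I₃] [Fintype I₄]

theorem A11_expand (hP : P.Consistent) (μ ν : Fin 4) : P.A11 μ ν =
    ∑ b, ∑ c, ∑ e, ∑ g, P.ff b c e g • (u b * u c * (u e * F g μ ν)) := by
  rw [A11, P.sum_B_D2 hP]
  simp only [smul_mul_assoc, sum₂_smul_smul, ← Finset.smul_sum]
  rw [smul_smul]
  norm_num only [one_smul]

end Params

section

variable {I₁ I₂ I₃ I₄ : Type*} {P : Params I₁ I₂ I₃ I₄}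
  [Fintype I₁] [Fintype I₂] [Fintype I₃] [Fintype I₄]
  {S : Type*} [Ring S] [Algebra ℂ S] {φ : Expr I₁ I₂ I₃ I₄ →ₐ[ℂ] S}

theorem F_swap (a : I₁ ⊕ I₂) (μ ν : Fin 4) : (F a ν μ : Expr I₁ I₂ I₃ I₄) = -F a μ ν := by
  simp [F]

namespace IsSuperComm

variable (hφ : IsSuperComm φ)
include hφ

theorem uuu_cyclic (b c e : I₁ ⊕ I₂) :
    φ (YM.u c) * (φ (YM.u e) * φ (YM.u b)) = φ (YM.u b) * (φ (YM.u c) * φ (YM.u e)) := by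
  rw [hφ.u_mul_u e b, mul_neg, mul_left_anticomm_of (hφ.u_mul_u c b), neg_neg]

/-- Three ghosts are invariant under cyclic permutations, as these are even, so only the cyclic sum
of ff enters. -/
theorem map_A11 (hP : P.Consistent) (hJ : P.Jacobi) (μ ν : Fin 4) : φ (P.A11 μ ν) = 0 := by
  simp only [P.A11_expand hP, map_sum, map_smul]
  refine jacobi_cyclic hJ.ff fun b c e g => ?_
  simp only [map_mul, ← mul_assoc]
  rw [mul_assoc (φ _) (φ _) (φ (YM.u b)), hφ.uuu_cyclic, ← mul_assoc]

/-- The ff terms drop out: u u u ∂ũ by cyclicity, and the v F u u terms of B_a D_a^μ and of B_{aν}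
D_a^{μν} cancel because `jacobi_combine'` relates them by the factor 2. -/
theorem map_A10 (hP : P.Consistent) (hJ : P.Jacobi) (μ : Fin 4) :
    φ (P.A10 μ) = φ (P.scalar1 μ) + φ (P.dirac1 μ) := by
  have hs := hφ.sorting
  have h1 := jacobi_cyclic (X := fun b c e g =>
    φ (YM.u b * YM.u c * (η μ • (YM.u e * d μ (YM.ut g))))) hJ.ff fun b c e g => by
      simp only [map_mul, map_smul, mul_smul_comm, ← mul_assoc]
      rw [mul_assoc (φ _) (φ _) (φ (YM.u b)), hφ.uuu_cyclic, ← mul_assoc]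
  have h2 := jacobi_combine' (X := fun b c e g => ∑ ν,
    η ν • (φ (YM.v b ν) * (φ (YM.F g ν μ) * (φ (YM.u c) * φ (YM.u e))))) hJ.ff hP.ff_swap
    fun b c e g => by
      simp only [hφ.u_mul_u e c, mul_neg, smul_neg, Finset.sum_neg_distrib]
  have h3 : φ (∑ b, ∑ c, ∑ e, ∑ g, P.ff b c e g • (YM.u b * YM.u c * -∑ ν, vL e ν * YM.F g ν μ)) =
      -∑ b, ∑ c, ∑ e, ∑ g, P.ff b c e g • ∑ ν,
        η ν • (φ (YM.v e ν) * (φ (YM.F g ν μ) * (φ (YM.u b) * φ (YM.u c)))) := by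
    simp only [map_sum, map_smul, map_mul, map_neg, ← Finset.sum_neg_distrib]
    refine sum₄_congr fun b c e g => ?_
    simp only [vL, Finset.mul_sum, map_smul, smul_mul_assoc, mul_smul_comm, mul_neg, mul_assoc, hs,
      smul_neg, Finset.sum_neg_distrib]
  have h4 : φ (∑ b, ∑ c, ∑ e, ∑ g, P.ff b c e g •
        ∑ ν, η ν • (-(YM.u b * YM.v c ν) * (YM.u e * YM.F g μ ν))) =
      ∑ b, ∑ c, ∑ e, ∑ g, P.ff b c e g • ∑ ν,
        η ν • (φ (YM.v c ν) * (φ (YM.F g ν μ) * (φ (YM.u b) * φ (YM.u e)))) := by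
    simp only [map_sum, map_smul, map_mul, map_neg]
    refine sum₄_congr fun b c e g => ?_
    simp only [fun g ν => F_swap (I₃ := I₃) (I₄ := I₄) g ν μ, map_neg, neg_mul, mul_neg, neg_neg, mul_assoc, hs]
  rw [P.A10_expand hP, map_add, map_add, map_add, map_add, map_smul, h3, h4]
  simp only [map_sum, map_smul]
  rw [h1, h2]
  abel

/-- Both field contents, u u Φ ∂Φ and u u Φ v, are antisymmetric in the ghost indices. The
representation property and its mass-weighted form turn ff' into twice f'f', which is what H_c G_c^μ
subtracts. -/
theorem map_scalar1 (hR : ∀ b c e g, P.ff' b c e g = P.f'f' e b g c - P.f'f' e c g b)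
    (μ : Fin 4) : φ (P.scalar1 μ) = 0 := by
  have hs := hφ.sorting
  have h1 := representation_combine_anti (X := fun b c e g =>
    φ (YM.u b * YM.u c * -(η μ • (YM.Φ e * d μ (YM.Φ g))))) hR fun b c e g => by
      rw [map_mul, map_mul, map_mul, map_mul, hφ.u_mul_u c b, neg_mul]
  have h2 := representation_combine_anti (X := fun b c e g =>
    φ (YM.u b * YM.u c * (YM.Φ e * YM.v g μ))) (P.fmf'_eq hR) fun b c e g => by
      simp only [map_mul]
      rw [hφ.u_mul_u c b, neg_mul]
  rw [Params.scalar1, map_sub, map_add, map_smul, map_add]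
  simp only [map_sum, map_smul]
  rw [h1, h2, ← smul_add]
  simp only [map_mul, map_neg, map_smul, mul_smul_comm, smul_mul_assoc, neg_mul, mul_neg, mul_assoc,
    hs, smul_neg, neg_neg, sub_self]

end IsSuperComm
end
end YM

/-! ### The anomaly of (T,T), split by field content: the parts without Dirac fields. -/

namespace YM
namespace Params

variable {I₁ I₂ I₃ I₄ : Type*} (P : Params I₁ I₂ I₃ I₄)
  [Fintype I₁] [Fintype I₂] [Fintype I₃] [Fintype I₄]

/-- The part of the anomaly `𝒜(T,T)` quadratic in the structure constants `f`. -/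
def gauge0 : Expr I₁ I₂ I₃ I₄ :=
  (-2 : ℂ) • (∑ b, ∑ c, ∑ e, ∑ g, P.ff b c e g • ∑ μ, η μ •
      (-(u b * v c μ) * -∑ ν, vL e ν * F g ν μ)) +
  (-2 : ℂ) • (∑ b, ∑ c, ∑ e, ∑ g, P.ff b c e g • ∑ μ, η μ •
      (-(u b * v c μ) * (η μ • (u e * d μ (ut g))))) -
  (∑ b, ∑ c, ∑ e, ∑ g, P.ff b c e g • (u b * u c * ∑ μ, v e μ * d μ (ut g))) +
  ∑ b, ∑ c, ∑ e, ∑ g, P.ff b c e g • ∑ μ, ∑ ν, (η μ * η ν) •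
    (((1 / 2 : ℂ) • (v b μ * v c ν) + (1 / 2 : ℂ) • (v c ν * v b μ)) * (u e * F g μ ν))

/-- The part of the anomaly `𝒜(T,T)` with fields `u`, `v`, `Φ`, `∂Φ`. -/
def scalar0 : Expr I₁ I₂ I₃ I₄ :=
  (-2 : ℂ) • (∑ b, ∑ c, ∑ e, ∑ g, P.ff' b c e g • ∑ μ, η μ •
      (-(u b * v c μ) * -(η μ • (Φ e * d μ (Φ g))))) -
  (2 : ℂ) • (∑ e, ∑ b, ∑ g, ∑ c, P.f'f' e b g c • (-(Φ e * u b) * ∑ μ, d μ (Φ g) * v c μ)) +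
  (2 : ℂ) • (∑ e, ∑ b, ∑ g, ∑ c, P.f'f' e b g c • ∑ μ, η μ •
      (-(Φ e * v b μ) * (η μ • (d μ (Φ g) * u c))))

/-- The part of the anomaly `𝒜(T,T)` with fields `u`, `Φ`, `v`, `v`. -/
def vector0 : Expr I₁ I₂ I₃ I₄ :=
  (-2 : ℂ) • (∑ b, ∑ c, ∑ e, ∑ g, P.fmf' b c e g • ∑ μ, η μ •
      (-(u b * v c μ) * (Φ e * v g μ))) -
  (2 : ℂ) • (∑ e, ∑ b, ∑ g, ∑ c, P.f'mf' e b g c • (-(Φ e * u b) * -∑ μ, vL g μ * v c μ)) +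
  (2 : ℂ) • (∑ e, ∑ b, ∑ g, ∑ c, P.f'mf' e b g c • ∑ μ, η μ •
      (-(Φ e * v b μ) * -(v g μ * u c)))

/-- The part of the anomaly `𝒜(T,T)` with fields `u`, `u`, `ũ`, `Φ`. -/
def ghost0 : Expr I₁ I₂ I₃ I₄ :=
  -(∑ b, ∑ c, ∑ e, ∑ g, P.fmf' b c e g • (u b * u c * -(Φ e * ut g))) -
  (2 : ℂ) • (∑ e, ∑ b, ∑ g, ∑ c, P.f'mf' e b g c • (-(Φ e * u b) * (ut g * u c)))

/-- The part of the anomaly `𝒜(T,T)` cubic in the scalar fields. -/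
def quartic0 : Expr I₁ I₂ I₃ I₄ :=
  -∑ e, ∑ b, ∑ g, ∑ c, P.f'f'' e b g c • (-(Φ e * u b) * (Φ g * Φ c))

theorem A00_expand (hP : P.Consistent) : P.A00 =
    P.gauge0 + P.scalar0 + P.vector0 + P.ghost0 + P.quartic0 +
    ((2 : ℂ) • (∑ μ, η μ • ∑ a, P.B1 a μ * P.jV a μ) - (2 : ℂ) • (∑ k, P.H k * P.jS k) +
      P.ADirac) := by
  have h1 : ∑ a, ∑ μ, η μ • (P.B1 a μ * P.D1 a μ) =
      (∑ b, ∑ c, ∑ e, ∑ g, P.ff b c e g • ∑ μ, η μ •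
        (-(u b * v c μ) * -∑ ν, vL e ν * F g ν μ)) +
      (∑ b, ∑ c, ∑ e, ∑ g, P.ff b c e g • ∑ μ, η μ •
        (-(u b * v c μ) * (η μ • (u e * d μ (ut g))))) -
      (∑ μ, η μ • ∑ a, P.B1 a μ * P.jV a μ) +
      (∑ b, ∑ c, ∑ e, ∑ g, P.ff' b c e g • ∑ μ, η μ •
        (-(u b * v c μ) * -(η μ • (Φ e * d μ (Φ g))))) +
      ∑ b, ∑ c, ∑ e, ∑ g, P.fmf' b c e g • ∑ μ, η μ • (-(u b * v c μ) * (Φ e * v g μ)) := by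
    rw [Finset.sum_comm]
    simp only [← Finset.smul_sum, P.B1_eq hP, P.sum_mul_D1 hP, smul_add, smul_sub,
      Finset.sum_add_distrib, Finset.sum_sub_distrib]
    rw [sum_smul_sum₄ η, sum_smul_sum₄ η, sum_smul_sum₄ η, sum_smul_sum₄ η]
  have h2 : ∑ a, ∑ μ, ∑ ν, (η μ * η ν) • (P.E a μ ν * P.D2 a μ ν) =
      ∑ b, ∑ c, ∑ e, ∑ g, P.ff b c e g • ∑ μ, ∑ ν, (η μ * η ν) •
        (((1 / 2 : ℂ) • (v b μ * v c ν) + (1 / 2 : ℂ) • (v c ν * v b μ)) * (u e * F g μ ν)) := by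
    -- The pair of Lorentz indices serves as one summation index, so that the interchange lemma
    -- applies once.
    have h := sum_smul_sum₄ (fun p : Fin 4 × Fin 4 => η p.1 * η p.2) P.ff fun p b c e g =>
      (((1 / 2 : ℂ) • (v b p.1 * v c p.2) + (1 / 2 : ℂ) • (v c p.2 * v b p.1)) *
        (u e * F g p.1 p.2) : Expr I₁ I₂ I₃ I₄)
    simp only [Fintype.sum_prod_type] at h
    rw [← h]
    simp only [← P.sum_E_D2 hP, Finset.smul_sum]
    exact Finset.sum_comm.trans <| Finset.sum_congr rfl fun μ _ => Finset.sum_comm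
  have h3 : ∑ k, ∑ μ, η μ • (P.H1 k μ * P.G1 k μ) =
      (∑ e, ∑ b, ∑ g, ∑ c, P.f'f' e b g c • ∑ μ, η μ •
        (-(Φ e * v b μ) * (η μ • (d μ (Φ g) * u c)))) +
      ∑ e, ∑ b, ∑ g, ∑ c, P.f'mf' e b g c • ∑ μ, η μ • (-(Φ e * v b μ) * -(v g μ * u c)) := by
    rw [Finset.sum_comm]
    simp only [← Finset.smul_sum, P.H1_eq hP, P.sum_mul_G1, smul_add, Finset.sum_add_distrib]
    rw [sum_smul_sum₄ η, sum_smul_sum₄ η]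
  have h4 := P.sum_mul_G hP (fun e b => -(Φ e * u b))
  simp only [← P.H_eq, mul_smul_comm, sum₂_smul_smul, ← Finset.smul_sum] at h4
  have h5 := P.sum_B_D
  simp only [smul_mul_assoc, sum₂_smul_smul, ← Finset.smul_sum] at h5
  rw [A00, Finset.sum_add_distrib, h1, h2, h3, h4, h5, gauge0, scalar0, vector0, ghost0, quartic0]
  module

end Params
end YM

namespace YM

variable {I₁ I₂ I₃ I₄ : Type*} {P : Params I₁ I₂ I₃ I₄}
  [Fintype I₁] [Fintype I₂] [Fintype I₃] [Fintype I₄]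
  {S : Type*} [Ring S] [Algebra ℂ S] {φ : Expr I₁ I₂ I₃ I₄ →ₐ[ℂ] S}

namespace IsSuperComm

variable (hφ : IsSuperComm φ)
include hφ

/-- Two independent cancellations. For v v F u, the antisymmetry of F makes the monomial
antisymmetric in the two vector indices, and the B_{aμ} D_a^μ term cancels the E D term. For v u u
∂ũ, anticommuting ghosts play this role, and the B_{aμ} D_a^μ term cancels the B_a D_a term. -/
theorem map_gauge0 (hP : P.Consistent) (hJ : P.Jacobi) : φ P.gauge0 = 0 := by
  have hs := hφ.sorting
  have h1 := jacobi_combine (X := fun b c e g => ∑ μ, ∑ ν, (η μ * η ν) •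
    (φ (YM.v c μ) * (φ (YM.v e ν) * (φ (YM.F g ν μ) * φ (YM.u b))))) hJ.ff hP.ff_swap
    fun b c e g => by
      rw [Finset.sum_comm]
      simp only [← Finset.sum_neg_distrib]
      refine Finset.sum_congr rfl fun μ _ => Finset.sum_congr rfl fun ν _ => ?_
      rw [F_swap g μ ν, map_neg, mul_left_comm_of ((hφ.v c μ).central (YM.v e ν)), mul_comm (η ν)]
      simp only [neg_mul, mul_neg, smul_neg, neg_neg]
  have h2 := jacobi_combine' (X := fun b c e g => ∑ μ,
    (φ (YM.v b μ) * (φ (YM.u c) * (φ (YM.u e) * φ (d μ (YM.ut g)))))) hJ.ff hP.ff_swap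
    fun b c e g => by
      simp only [mul_left_anticomm_of (hφ.u_mul_u e c), mul_neg, Finset.sum_neg_distrib]
  have e1 : ∀ b c e g, φ (∑ μ, η μ • (-(YM.u b * YM.v c μ) * -∑ ν, vL e ν * YM.F g ν μ)) =
      ∑ μ, ∑ ν, (η μ * η ν) •
        (φ (YM.v c μ) * (φ (YM.v e ν) * (φ (YM.F g ν μ) * φ (YM.u b)))) := fun b c e g => by
    simp only [vL, map_sum, map_smul, map_mul, map_neg, neg_mul, mul_neg, neg_neg, mul_assoc, hs,
      smul_mul_assoc, mul_smul_comm, Finset.mul_sum, Finset.smul_sum, smul_smul, smul_neg,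
      Finset.sum_neg_distrib]
  have e2 : ∀ b c e g, φ (∑ μ, η μ • (-(YM.u b * YM.v c μ) * (η μ • (YM.u e * d μ (YM.ut g))))) =
      -∑ μ, φ (YM.v c μ) * (φ (YM.u b) * (φ (YM.u e) * φ (d μ (YM.ut g)))) := fun b c e g => by
    simp only [map_sum, map_smul, map_mul, map_neg, neg_mul, mul_neg, mul_assoc, hs,
      smul_mul_assoc, mul_smul_comm, smul_smul, η_mul_self, one_smul, smul_neg,
      Finset.sum_neg_distrib]
  have e3 : ∀ b c e g, φ (YM.u b * YM.u c * ∑ μ, YM.v e μ * d μ (YM.ut g)) =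
      ∑ μ, φ (YM.v e μ) * (φ (YM.u b) * (φ (YM.u c) * φ (d μ (YM.ut g)))) := fun b c e g => by
    simp only [map_sum, map_mul, mul_assoc, hs, Finset.mul_sum]
  have e4 : ∀ b c e g, φ (∑ μ, ∑ ν, (η μ * η ν) •
      (((1 / 2 : ℂ) • (YM.v b μ * YM.v c ν) + (1 / 2 : ℂ) • (YM.v c ν * YM.v b μ)) *
        (YM.u e * YM.F g μ ν))) =
      ∑ μ, ∑ ν, (η μ * η ν) •
        (φ (YM.v c μ) * (φ (YM.v b ν) * (φ (YM.F g ν μ) * φ (YM.u e)))) := fun b c e g => by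
    rw [Finset.sum_comm]
    simp only [map_sum, map_smul, map_mul, map_add, fun μ ν => (hφ.v c ν).central (YM.v b μ),
      ← add_smul]
    refine Finset.sum_congr rfl fun μ _ => Finset.sum_congr rfl fun ν _ => ?_
    norm_num only [one_smul]
    rw [mul_comm (η ν)]
    simp only [mul_assoc, hs]
  rw [Params.gauge0]
  simp only [map_add, map_sub, map_smul φ (-2 : ℂ)]
  simp only [map_sum φ (s := (Finset.univ : Finset (I₁ ⊕ I₂))), map_smul φ (P.ff _ _ _ _), e1, e2, e3, e4]
  rw [h1]
  rw [h2]
  simp only [smul_neg, Finset.sum_neg_distrib]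
  module

/-- Here the monomial Φ ∂Φ v_c u_b has no symmetry in b and c, so the two terms of the commutator
remain distinct: one is cancelled by H_c G_c, the other by H_{cμ} G_c^μ. -/
theorem map_scalar0 (hR : ∀ b c e g, P.ff' b c e g = P.f'f' e b g c - P.f'f' e c g b) :
    φ P.scalar0 = 0 := by
  have hs := hφ.sorting
  have h1 := representation_combine (X := fun b c e g => ∑ μ,
    φ (YM.Φ e) * (φ (d μ (YM.Φ g)) * (φ (YM.v c μ) * φ (YM.u b)))) hR
  have e1 : ∀ b c e g, φ (∑ μ, η μ • (-(YM.u b * YM.v c μ) * -(η μ • (YM.Φ e * d μ (YM.Φ g))))) =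
      ∑ μ, φ (YM.Φ e) * (φ (d μ (YM.Φ g)) * (φ (YM.v c μ) * φ (YM.u b))) := fun b c e g => by
    simp only [map_sum, map_smul, map_mul, map_neg, neg_mul, mul_neg, neg_neg, mul_assoc, hs,
      smul_mul_assoc, mul_smul_comm, smul_smul, η_mul_self, one_smul, smul_neg]
  have e2 : ∀ b c e g, φ (-(YM.Φ e * YM.u b) * ∑ μ, d μ (YM.Φ g) * YM.v c μ) =
      -∑ μ, φ (YM.Φ e) * (φ (d μ (YM.Φ g)) * (φ (YM.v c μ) * φ (YM.u b))) := fun b c e g => by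
    simp only [map_sum, map_mul, map_neg, neg_mul, mul_assoc, hs, Finset.mul_sum,
      Finset.sum_neg_distrib]
  have e3 : ∀ b c e g, φ (∑ μ, η μ • (-(YM.Φ e * YM.v b μ) * (η μ • (d μ (YM.Φ g) * YM.u c)))) =
      -∑ μ, φ (YM.Φ e) * (φ (d μ (YM.Φ g)) * (φ (YM.v b μ) * φ (YM.u c))) := fun b c e g => by
    simp only [map_sum, map_smul, map_mul, map_neg, neg_mul, mul_neg, mul_assoc, hs,
      smul_mul_assoc, mul_smul_comm, smul_smul, η_mul_self, one_smul, smul_neg,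
      Finset.sum_neg_distrib]
  rw [Params.scalar0]
  simp only [map_add, map_sub, map_smul φ (-2 : ℂ), map_smul φ (2 : ℂ)]
  simp only [map_sum φ (s := (Finset.univ : Finset (I₁ ⊕ I₂))), map_sum φ (s := (Finset.univ : Finset (I₂ ⊕ I₃))),
    map_smul φ (P.ff' _ _ _ _), map_smul φ (P.f'f' _ _ _ _), e1, e2, e3]
  rw [h1]
  simp only [smul_neg, Finset.sum_neg_distrib]
  module

/-- The same cancellation as in `map_scalar0`, with v_g in place of ∂Φ_g and the mass-weighted
contractions. -/
theorem map_vector0 (hR : ∀ b c e g, P.ff' b c e g = P.f'f' e b g c - P.f'f' e c g b) :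
    φ P.vector0 = 0 := by
  have hs := hφ.sorting
  have h1 := representation_combine (X := fun b c e g => ∑ μ, η μ •
    (φ (YM.Φ e) * (φ (YM.v g μ) * (φ (YM.v c μ) * φ (YM.u b))))) (P.fmf'_eq hR)
  have e1 : ∀ b c e g, φ (∑ μ, η μ • (-(YM.u b * YM.v c μ) * (YM.Φ e * YM.v g μ))) =
      -∑ μ, η μ • (φ (YM.Φ e) * (φ (YM.v g μ) * (φ (YM.v c μ) * φ (YM.u b)))) :=
    fun b c e g => by
    simp only [map_sum, map_smul, map_mul, map_neg, neg_mul, mul_assoc, hs, smul_neg,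
      Finset.sum_neg_distrib, mul_left_comm_of ((hφ.v g _).central (YM.v c _))]
  have e2 : ∀ b c e g, φ (-(YM.Φ e * YM.u b) * -∑ μ, vL g μ * YM.v c μ) =
      ∑ μ, η μ • (φ (YM.Φ e) * (φ (YM.v g μ) * (φ (YM.v c μ) * φ (YM.u b)))) :=
    fun b c e g => by
    simp only [vL, map_sum, map_mul, map_neg, map_smul, neg_mul, mul_neg, neg_neg, mul_assoc, hs,
      Finset.mul_sum, smul_mul_assoc, mul_smul_comm, smul_neg, Finset.sum_neg_distrib]
  have e3 : ∀ b c e g, φ (∑ μ, η μ • (-(YM.Φ e * YM.v b μ) * -(YM.v g μ * YM.u c))) =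
      ∑ μ, η μ • (φ (YM.Φ e) * (φ (YM.v g μ) * (φ (YM.v b μ) * φ (YM.u c)))) :=
    fun b c e g => by
    simp only [map_sum, map_smul, map_mul, map_neg, neg_mul, mul_neg, neg_neg, mul_assoc, hs,
      mul_left_comm_of ((hφ.v g _).central (YM.v b _))]
  rw [Params.vector0]
  simp only [map_add, map_sub, map_smul φ (-2 : ℂ), map_smul φ (2 : ℂ)]
  simp only [map_sum φ (s := (Finset.univ : Finset (I₁ ⊕ I₂))), map_sum φ (s := (Finset.univ : Finset (I₂ ⊕ I₃))),
    map_smul φ (P.fmf' _ _ _ _), map_smul φ (P.f'mf' _ _ _ _), e1, e2, e3]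
  simp only [smul_neg, Finset.sum_neg_distrib]
  rw [h1]
  module

theorem map_ghost0 (hR : ∀ b c e g, P.ff' b c e g = P.f'f' e b g c - P.f'f' e c g b) :
    φ P.ghost0 = 0 := by
  have hs := hφ.sorting
  have h1 := representation_combine_anti (X := fun b c e g =>
    φ (YM.Φ e) * (φ (YM.u b) * (φ (YM.u c) * φ (YM.ut g)))) (P.fmf'_eq hR) fun b c e g => by
      rw [mul_left_anticomm_of (hφ.u_mul_u c b), mul_neg]
  rw [Params.ghost0]
  simp only [map_neg, map_sub, map_smul, map_sum, map_mul, neg_mul, mul_neg, neg_neg, mul_assoc, hs,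
    smul_neg, Finset.sum_neg_distrib, h1, sub_self]

end IsSuperComm
end YM

/-! ### The Dirac and quartic scalar parts of the anomaly of (T,T). -/

namespace YM
namespace Params

variable {I₁ I₂ I₃ I₄ : Type*} (P : Params I₁ I₂ I₃ I₄)
  [Fintype I₁] [Fintype I₂] [Fintype I₃] [Fintype I₄]

theorem bil_smul (m : Matrix I₄ I₄ ℂ) (k : ℂ) (g : Matrix (Fin 4) (Fin 4) ℂ) :
    (bil m (k • g) : Expr I₁ I₂ I₃ I₄) = k • bil m g := by
  simp only [bil, Finset.smul_sum, smul_smul, Matrix.smul_apply, smul_eq_mul, mul_left_comm k]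

/-- The part of `𝒜(T,T)` with fields `u`, `v` and Dirac fields. -/
def dirac0 : Expr I₁ I₂ I₃ I₄ :=
  ∑ b, ∑ c, ∑ ε : ℤˣ, ∑ μ, u b * v c μ * ((2 : ℂ) • bil (P.XD b c ε) (P.γ μ * P.γε ε))

/-- The part of `𝒜(T,T)` with fields `u`, `Φ` and Dirac fields. -/
def yukawa0 : Expr I₁ I₂ I₃ I₄ :=
  ∑ a, ∑ c, ∑ ε : ℤˣ, u a * Φ c * bil (P.YD a c ε) (P.γε ε)

/-- The part of `𝒜(T,T)` with fields `u`, `Φ`, `Φ`, `Φ`. -/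
def gTerm : Expr I₁ I₂ I₃ I₄ :=
  (1 / 6 : ℂ) • ∑ a, ∑ b, ∑ c, ∑ e, P.g a b c e • (u a * (Φ b * (Φ c * Φ e)))

/-- The current in D_a^μ supplies, through B_{aμ}, the f t term of `XD`, so this part vanishes under
the same condition as `dirac1`. -/
theorem dirac0_eq (hP : P.Consistent) :
    (2 : ℂ) • (∑ μ, η μ • ∑ a, P.B1 a μ * P.jV a μ) +
      (-2 * Complex.I) • (∑ a, ∑ b, ∑ ε : ℤˣ, ∑ μ,
        u a * v b μ * bil (P.t a ε * P.t b ε - P.t b ε * P.t a ε) (P.γ μ * P.γε ε)) =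
      P.dirac0 := by
  have h : ∑ μ, η μ • ∑ a, P.B1 a μ * P.jV a μ = -∑ b, ∑ c, ∑ ε : ℤˣ, ∑ μ, ∑ a,
      u b * v c μ * (P.f a b c • bil (P.t a ε) (P.γ μ * P.γε ε)) := by
    have h1 : ∀ μ a, η μ • (P.B1 a μ * P.jV a μ) = ∑ b, ∑ c, ∑ ε : ℤˣ,
        -(u b * v c μ * (P.f a b c • bil (P.t a ε) (P.γ μ * P.γε ε))) := fun μ a => by
      rw [P.B1_eq hP, jV]
      simp only [Matrix.smul_mul, bil_smul, ← Finset.smul_sum, mul_smul_comm, smul_smul,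
        η_mul_self, one_smul]
      simp only [Finset.sum_mul]
      simp only [Finset.mul_sum, smul_mul_assoc, neg_mul, smul_neg, Finset.smul_sum]
    simp only [Finset.smul_sum, h1, ← Finset.sum_neg_distrib]
    refine Eq.trans (Finset.sum_congr rfl fun μ _ => Finset.sum_comm.trans <|
      Finset.sum_congr rfl fun b _ => Finset.sum_comm.trans <|
      Finset.sum_congr rfl fun c _ => Finset.sum_comm) ?_
    exact Finset.sum_comm.trans <| Finset.sum_congr rfl fun b _ => Finset.sum_comm.trans <|
      Finset.sum_congr rfl fun c _ => Finset.sum_comm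
  rw [h, dirac0]
  simp only [XD, bil_sub_smul]
  simp only [smul_sub, mul_sub, Finset.sum_sub_distrib, Finset.mul_sum,
    Finset.smul_sum, mul_smul_comm, smul_smul, smul_neg, mul_neg, neg_mul]
  abel

theorem A00_expand' (hP : P.Consistent) : P.A00 =
    P.gauge0 + P.scalar0 + P.vector0 + P.ghost0 + P.quartic0 + P.dirac0 +
    ((-2 * Complex.I) • (∑ a, ∑ c, ∑ ε : ℤˣ,
      u a * Φ c * bil (P.t a (-ε) * P.s c ε - P.s c ε * P.t a ε) (P.γε ε)) -
      (2 : ℂ) • ∑ k, P.H k * P.jS k) := by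
  rw [P.A00_expand hP, ← P.dirac0_eq hP, ADirac]
  abel

end Params

variable {I₁ I₂ I₃ I₄ : Type*} {P : Params I₁ I₂ I₃ I₄}
  [Fintype I₁] [Fintype I₂] [Fintype I₃] [Fintype I₄]
  {S : Type*} [Ring S] [Algebra ℂ S] {φ : Expr I₁ I₂ I₃ I₄ →ₐ[ℂ] S}

namespace IsSuperComm

variable (hφ : IsSuperComm φ)
include hφ

/-- The scalar currents in G_c enter through H_c and supply the f' s term that completes `YD`. -/
theorem map_yukawa0 : φ ((-2 * Complex.I) • (∑ a, ∑ c, ∑ ε : ℤˣ, YM.u a * YM.Φ c *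
      Params.bil (P.t a (-ε) * P.s c ε - P.s c ε * P.t a ε) (P.γε ε)) -
      (2 : ℂ) • ∑ k, P.H k * P.jS k) = φ P.yukawa0 := by
  have h : φ (∑ k, P.H k * P.jS k) = -φ (∑ a, ∑ c, ∑ ε : ℤˣ, ∑ k,
      P.f' k c a • (YM.u a * YM.Φ c * Params.bil (P.s k ε) (P.γε ε))) := by
    simp only [P.H_eq, Params.jS, map_sum, map_mul, map_smul, map_neg, hφ.sorting, smul_neg,
      Finset.sum_neg_distrib, neg_mul, neg_inj]
    simp only [Finset.sum_mul]
    simp only [Finset.mul_sum, smul_mul_assoc]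
    rw [Finset.sum_comm]
    conv_rhs => rw [Finset.sum_comm]
    refine Finset.sum_congr rfl fun c _ => ?_
    rw [Finset.sum_comm]
    refine Finset.sum_congr rfl fun a _ => ?_
    rw [Finset.sum_comm]
  rw [map_sub, map_smul, map_smul, h, Params.yukawa0]
  simp only [Params.YD, Params.bil_sub_smul, mul_sub, map_sub, map_sum, map_smul, Finset.mul_sum,
    Finset.sum_sub_distrib, Finset.smul_sum, mul_smul_comm, smul_smul, smul_neg, map_neg,
    ← Finset.sum_neg_distrib, ← neg_smul, neg_mul, mul_neg]

/-- Commuting Φ's see only the symmetrization of f'f''. The tensor g is twice the sum of three terms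
with equal contractions, which explains the factor 1/6. -/
theorem map_quartic0 : φ P.quartic0 = φ P.gTerm := by
  have hΦ : ∀ b c, φ (YM.Φ c) * φ (YM.Φ b) = φ (YM.Φ b) * φ (YM.Φ c) :=
    fun b c => (hφ.Φ b).central _
  have hΦ' : ∀ b c z, φ (YM.Φ c) * (φ (YM.Φ b) * z) = φ (YM.Φ b) * (φ (YM.Φ c) * z) :=
    fun b c => mul_left_comm_of (hΦ b c)
  have h0 : φ P.quartic0 = ∑ a, ∑ b, ∑ c, ∑ e,
      P.f'f'' b a c e • (φ (YM.u a) * (φ (YM.Φ b) * (φ (YM.Φ c) * φ (YM.Φ e)))) := by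
    simp only [Params.quartic0, map_neg, map_sum, map_smul, map_mul, neg_mul, smul_neg,
      Finset.sum_neg_distrib, neg_neg, mul_assoc]
    rw [Finset.sum_comm]
    refine sum₄_congr fun a b c e => ?_
    rw [← mul_left_comm_of ((hφ.Φ b).central (YM.u a))]
  have h1 : φ P.gTerm = (1 / 6 : ℂ) • ∑ a, ∑ b, ∑ c, ∑ e,
      (2 * (P.f'f'' b a c e + P.f'f'' c a b e + P.f'f'' e a b c)) •
        (φ (YM.u a) * (φ (YM.Φ b) * (φ (YM.Φ c) * φ (YM.Φ e)))) := by
    simp only [Params.gTerm, Params.g, Params.f'f'', map_smul, map_sum, map_mul,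
      Finset.sum_add_distrib]
  rw [h0, h1, Finset.smul_sum]
  refine Finset.sum_congr rfl fun a _ => ?_
  have h2 : ∑ b, ∑ c, ∑ e, P.f'f'' c a b e •
      (φ (YM.u a) * (φ (YM.Φ b) * (φ (YM.Φ c) * φ (YM.Φ e)))) =
      ∑ b, ∑ c, ∑ e, P.f'f'' b a c e •
      (φ (YM.u a) * (φ (YM.Φ b) * (φ (YM.Φ c) * φ (YM.Φ e)))) := by
    rw [Finset.sum_comm]
    refine Finset.sum_congr rfl fun b _ => Finset.sum_congr rfl fun c _ =>
      Finset.sum_congr rfl fun e _ => ?_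
    rw [hΦ' b c]
  have h3 : ∑ b, ∑ c, ∑ e, P.f'f'' e a b c •
      (φ (YM.u a) * (φ (YM.Φ b) * (φ (YM.Φ c) * φ (YM.Φ e)))) =
      ∑ b, ∑ c, ∑ e, P.f'f'' b a c e •
      (φ (YM.u a) * (φ (YM.Φ b) * (φ (YM.Φ c) * φ (YM.Φ e)))) := by
    rw [← sum_cyclic fun b c e => P.f'f'' b a c e •
      (φ (YM.u a) * (φ (YM.Φ b) * (φ (YM.Φ c) * φ (YM.Φ e))))]
    refine Finset.sum_congr rfl fun b _ => Finset.sum_congr rfl fun c _ =>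
      Finset.sum_congr rfl fun e _ => ?_
    rw [hΦ e c, hΦ' e b]
  simp only [mul_smul (2 : ℂ), add_smul, smul_add, Finset.sum_add_distrib]
  simp only [← Finset.smul_sum, h2, h3]
  module

/-- The anomaly `𝒜(T,T)` once the Jacobi identity and the representation property hold. -/
theorem map_A00 (hP : P.Consistent) (hJ : P.Jacobi) (hR : P.Representation) :
    φ P.A00 = φ P.dirac0 + φ P.yukawa0 + φ P.gTerm := by
  have hR' := hP.representation_iff.1 hR
  rw [P.A00_expand' hP]
  simp only [map_add, hφ.map_gauge0 hP hJ, hφ.map_scalar0 hR', hφ.map_vector0 hR',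
    hφ.map_ghost0 hR', hφ.map_quartic0, hφ.map_yukawa0]
  abel

end IsSuperComm

namespace Params

/-- `XD` and `YD` vanish exactly if the Dirac relations hold. -/
theorem diracRelations_iff (hP : P.Consistent) :
    P.DiracRelations ↔ (∀ b c ε, P.XD b c ε = 0) ∧ ∀ a c ε, P.YD a c ε = 0 := by
  have hI : Complex.I ≠ 0 := Complex.I_ne_zero
  refine and_congr (forall_congr' fun a => forall_congr' fun b => forall_congr' fun ε => ?_)
    (forall_congr' fun a => forall_congr' fun c => forall_congr' fun ε => ?_)
  · have h : P.XD a b ε = (-Complex.I) • ((P.t a ε * P.t b ε - P.t b ε * P.t a ε) -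
        Complex.I • ∑ c, P.f a b c • P.t c ε) := by
      rw [XD, smul_sub _ (_ - _) (_ • _), smul_smul, neg_mul, Complex.I_mul_I, neg_neg, one_smul]
      simp only [P.f_cyclic hP]
    rw [h, smul_eq_zero_iff_right (neg_ne_zero.2 hI), sub_eq_zero]
  · have h : P.YD a c ε = (-2 * Complex.I) • ((P.t a (-ε) * P.s c ε - P.s c ε * P.t a ε) -
        (-Complex.I) • ∑ e, P.f' e c a • P.s e ε) := by
      rw [YD, smul_sub _ (_ - _) (_ • _), smul_smul]
      simp only [mul_smul (-2 : ℂ), ← Finset.smul_sum]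
      congr 2
      linear_combination -2 * Complex.I_mul_I
    rw [h, smul_eq_zero_iff_right (mul_ne_zero (by norm_num) hI), sub_eq_zero]

end Params
end YM

namespace YM

variable {I₁ I₂ I₃ I₄ : Type*}

/-! A realization of the on-shell algebra in the free graded commutative algebra: second time
derivatives are traded for the mass terms, and products of spatial derivatives are set to zero. -/

/-- Normal form of a jet variable of a Klein-Gordon field of mass `m`. -/
def nfKG (m : ℝ) (ξ : Fld I₁ I₂ I₃ I₄) (s : Multiset (Fin 4)) : Expr I₁ I₂ I₃ I₄ :=
  if (s.filter (· ≠ 0)).card ≤ 1 then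
    (-(m : ℂ) ^ 2) ^ (s.count 0 / 2) •
      jet ξ (Multiset.replicate (s.count 0 % 2) 0 + s.filter (· ≠ 0))
  else 0

/-- Doubling a spatial derivative exceeds the permitted number and gives 0, while two time
derivatives give -m²; the metric sum reduces to -m² + m². -/
theorem nfKG_klein_gordon (m : ℝ) (ξ : Fld I₁ I₂ I₃ I₄) (s : Multiset (Fin 4)) :
    ∑ ρ, η ρ • nfKG m ξ (ρ ::ₘ ρ ::ₘ s) + (m : ℂ) ^ 2 • nfKG m ξ s = 0 := by
  have h : ∀ ρ : Fin 4, ρ ≠ 0 → nfKG m ξ (ρ ::ₘ ρ ::ₘ s) = 0 := fun ρ hρ => by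
    simp [nfKG, hρ]
  rw [Fin.sum_univ_four, h 1 (by decide), h 2 (by decide), h 3 (by decide)]
  simp only [nfKG, Multiset.count_cons_self]
  rw [Multiset.filter_cons_of_neg _ (by simp), Multiset.filter_cons_of_neg _ (by simp),
    Nat.add_assoc, one_add_one_eq_two, Nat.add_div_right _ two_pos, Nat.add_mod_right]
  split_ifs
  · simp only [η, if_true, one_smul, smul_zero, add_zero, smul_smul, pow_succ']
    module
  · simp

theorem nfKG_zero (m : ℝ) (ξ : Fld I₁ I₂ I₃ I₄) : nfKG m ξ 0 = jet ξ 0 := by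
  simp [nfKG]

theorem nfKG_singleton (m : ℝ) (ξ : Fld I₁ I₂ I₃ I₄) (μ : Fin 4) :
    nfKG m ξ {μ} = jet ξ {μ} := by
  by_cases h : μ = 0
  · subst h
    simp [nfKG, Multiset.filter_singleton]
  · simp [nfKG, Multiset.filter_singleton, h, Multiset.count_singleton, Ne.symm h]

/-- Normal form of a jet variable of a spinor field `ξ`, with `m` the matrix of the time
derivative. -/
def nfSpinor (m : Matrix (Fin 4) (Fin 4) ℂ) (ξ : Fin 4 → Fld I₁ I₂ I₃ I₄) (α : Fin 4)
    (s : Multiset (Fin 4)) : Expr I₁ I₂ I₃ I₄ :=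
  if s.filter (· ≠ 0) = 0 then ∑ β, (m ^ s.count 0) α β • jet (ξ β) 0 else 0

theorem nfSpinor_zero (m : Matrix (Fin 4) (Fin 4) ℂ) (ξ : Fin 4 → Fld I₁ I₂ I₃ I₄) (α : Fin 4) :
    nfSpinor m ξ α 0 = jet (ξ α) 0 := by
  simp [nfSpinor, Matrix.one_apply]

/-- Only the time derivative survives, and it contributes one more factor m, which `n 0` turns into
the scalar k. This is the Dirac equation with spatial derivatives discarded. -/
theorem sum_smul_nfSpinor (m : Matrix (Fin 4) (Fin 4) ℂ) (ξ : Fin 4 → Fld I₁ I₂ I₃ I₄)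
    (n : Fin 4 → Matrix (Fin 4) (Fin 4) ℂ) (k : ℂ) (h : n 0 * m = k • 1) (α : Fin 4)
    (s : Multiset (Fin 4)) :
    ∑ ρ, ∑ β, n ρ α β • nfSpinor m ξ β (ρ ::ₘ s) = k • nfSpinor m ξ α s := by
  have h' : ∀ ρ β : Fin 4, ρ ≠ 0 → nfSpinor m ξ β (ρ ::ₘ s) = 0 := fun ρ β hρ => by
    simp [nfSpinor, hρ]
  rw [Fin.sum_univ_four]
  simp only [h' 1 _ (by decide), h' 2 _ (by decide), h' 3 _ (by decide), smul_zero,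
    Finset.sum_const_zero, add_zero]
  simp only [nfSpinor, Multiset.count_cons_self]
  rw [Multiset.filter_cons_of_neg _ (by simp)]
  split_ifs
  · have : ∀ β, (n 0 * m ^ (s.count 0 + 1)) α β = k * (m ^ s.count 0) α β := fun β => by
      rw [pow_succ', ← mul_assoc, h, Matrix.smul_mul, one_mul, Matrix.smul_apply, smul_eq_mul]
    simp only [Finset.smul_sum, smul_smul]
    rw [Finset.sum_comm]
    refine Finset.sum_congr rfl fun β _ => ?_
    rw [← Finset.sum_smul, ← Matrix.mul_apply, this]
  · simp

namespace Params

variable (P : Params I₁ I₂ I₃ I₄)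

/-- Normal forms of the jet variables. -/
def nf : Jet I₁ I₂ I₃ I₄ → Expr I₁ I₂ I₃ I₄
  | (.v a μ, s) => nfKG (P.mV a) (.v a μ) s
  | (.u a, s) => nfKG (P.mV a) (.u a) s
  | (.ut a, s) => nfKG (P.mV a) (.ut a) s
  | (.Φ c, s) => nfKG (P.mS c) (.Φ c) s
  | (.ψ A α, s) => nfSpinor ((-Complex.I * P.M A) • P.γ 0) (fun β => .ψ A β) α s
  | (.ψbar A α, s) => nfSpinor ((Complex.I * P.M A) • (P.γ 0)ᵀ) (fun β => .ψbar A β) α s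

/-- Replacing the jet variables by their normal forms. -/
def nfHom : Expr I₁ I₂ I₃ I₄ →ₐ[ℂ] Expr I₁ I₂ I₃ I₄ := FreeAlgebra.lift ℂ P.nf

theorem nfHom_jet (ξ : Fld I₁ I₂ I₃ I₄) (s : Multiset (Fin 4)) : P.nfHom (jet ξ s) = P.nf (ξ, s) := by
  simp [nfHom, jet]

theorem nfHom_jet_zero (ξ : Fld I₁ I₂ I₃ I₄) : P.nfHom (jet ξ 0) = jet ξ 0 := by
  rw [nfHom_jet]
  cases ξ <;> simp [nf, nfKG_zero, nfSpinor_zero]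

theorem nfHom_v_singleton (a : I₁ ⊕ I₂) (μ ν : Fin 4) :
    P.nfHom (jet (.v a μ) {ν}) = jet (.v a μ) {ν} := by
  rw [nfHom_jet, nf, nfKG_singleton]

theorem nfHom_u_singleton (a : I₁ ⊕ I₂) (ν : Fin 4) :
    P.nfHom (jet (.u a) {ν}) = jet (.u a) {ν} := by
  rw [nfHom_jet, nf, nfKG_singleton]

theorem nfHom_ut_singleton (a : I₁ ⊕ I₂) (ν : Fin 4) :
    P.nfHom (jet (.ut a) {ν}) = jet (.ut a) {ν} := by
  rw [nfHom_jet, nf, nfKG_singleton]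

theorem nfHom_Φ_singleton (c : I₂ ⊕ I₃) (ν : Fin 4) :
    P.nfHom (jet (.Φ c) {ν}) = jet (.Φ c) {ν} := by
  rw [nfHom_jet, nf, nfKG_singleton]

theorem nf_mem (x : Jet I₁ I₂ I₃ I₄) :
    P.nf x ∈ Submodule.span ℂ {A | ∃ ξ s, ξ.odd = x.1.odd ∧ A = jet ξ s} := by
  have hKG : ∀ m (ξ : Fld I₁ I₂ I₃ I₄) s,
      nfKG m ξ s ∈ Submodule.span ℂ {A | ∃ ξ' s, ξ'.odd = ξ.odd ∧ A = jet ξ' s} := fun m ξ s => by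
    rw [nfKG]
    split_ifs
    · exact Submodule.smul_mem _ _ (Submodule.subset_span ⟨ξ, _, rfl, rfl⟩)
    · exact Submodule.zero_mem _
  have hS : ∀ m (ξ : Fin 4 → Fld I₁ I₂ I₃ I₄) (h : ∀ β, (ξ β).odd = true) α s,
      nfSpinor m ξ α s ∈ Submodule.span ℂ {A | ∃ ξ' s, ξ'.odd = true ∧ A = jet ξ' s} :=
    fun m ξ h α s => by
      rw [nfSpinor]
      split_ifs
      · exact Submodule.sum_mem _ fun β _ =>
          Submodule.smul_mem _ _ (Submodule.subset_span ⟨ξ β, _, h β, rfl⟩)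
      · exact Submodule.zero_mem _
  rcases x with ⟨(⟨a, μ⟩ | a | a | a | _ | _), s⟩
  · exact hKG _ _ _
  · exact hKG _ _ _
  · exact hKG _ _ _
  · exact hKG _ _ _
  · exact hS _ _ (fun _ => rfl) _ _
  · exact hS _ _ (fun _ => rfl) _ _

/-- Passing to normal forms is compatible with graded commutativity. -/
theorem toSC_nfHom_isSuperComm : IsSuperComm (toSC.comp P.nfHom) := by
  intro x y
  have h : ∀ x : Jet I₁ I₂ I₃ I₄, SuperCommutes toSC x.1.odd (P.nf x) := fun x => by
    have hx := P.nf_mem x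
    generalize P.nf x = A at hx ⊢
    induction hx using Submodule.span_induction with
    | mem A hA =>
      obtain ⟨ξ, s, h, rfl⟩ := hA
      exact h ▸ toSC_isSuperComm.jet ξ s
    | zero => exact .zero _
    | add A B _ _ hA hB => exact hA.add hB
    | smul c A _ hA => exact hA.smul c
  simp only [AlgHom.comp_apply, nfHom, FreeAlgebra.lift_ι_apply]
  have hy := P.nf_mem y
  generalize P.nf y = B at hy ⊢
  induction hy using Submodule.span_induction with
  | mem A hA =>
    obtain ⟨ξ, s, hξ, rfl⟩ := hA
    have := h x (ξ, s)
    rw [← hξ]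
    exact this
  | zero => simp
  | add A B _ _ hA hB => rw [map_add, mul_add, hA, hB, add_mul, smul_add]
  | smul c A _ hA => rw [map_smul, mul_smul_comm, hA, smul_mul_assoc, smul_comm]

theorem nfHom_rel (hγ : P.Clifford) ⦃A B : Expr I₁ I₂ I₃ I₄⦄ (h : P.Rel A B) :
    toSC.comp P.nfHom A = toSC.comp P.nfHom B := by
  -- The only Clifford relation needed to realize the equations of motion, since spatial derivatives
  -- of spinors are sent to 0.
  have hγ0 : P.γ 0 * P.γ 0 = 1 := by
    have := hγ 0 0
    rw [if_pos rfl, ← two_smul ℂ, η, if_pos rfl, mul_one] at this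
    exact smul_right_injective _ (two_ne_zero' ℂ) this
  induction h with
  | comm x y =>
    rw [map_mul, map_smul, map_mul]
    exact P.toSC_nfHom_isSuperComm x y
  | kg_v a μ s =>
    simp only [AlgHom.comp_apply, map_add, map_sum, map_smul, nfHom_jet, nf, map_zero]
    simpa only [map_add, map_sum, map_smul, map_zero] using
      congrArg toSC (nfKG_klein_gordon (P.mV a) (.v a μ) s)
  | kg_u a s =>
    simp only [AlgHom.comp_apply, map_add, map_sum, map_smul, nfHom_jet, nf, map_zero]
    simpa only [map_add, map_sum, map_smul, map_zero] using
      congrArg toSC (nfKG_klein_gordon (P.mV a) (.u a) s)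
  | kg_ut a s =>
    simp only [AlgHom.comp_apply, map_add, map_sum, map_smul, nfHom_jet, nf, map_zero]
    simpa only [map_add, map_sum, map_smul, map_zero] using
      congrArg toSC (nfKG_klein_gordon (P.mV a) (.ut a) s)
  | kg_Φ a s =>
    simp only [AlgHom.comp_apply, map_add, map_sum, map_smul, nfHom_jet, nf, map_zero]
    simpa only [map_add, map_sum, map_smul, map_zero] using
      congrArg toSC (nfKG_klein_gordon (P.mS a) (.Φ a) s)
  | dirac A α s =>
    -- Solving iγ_0 ∂_0 ψ = Mψ with γ_0² = 1 gives ∂_0 ψ = -iMγ_0 ψ.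
    have := sum_smul_nfSpinor ((-Complex.I * P.M A) • P.γ 0) (fun β => (.ψ A β : Fld I₁ I₂ I₃ I₄))
      (fun ρ => (Complex.I * η ρ) • P.γ ρ) (P.M A) (by
        rw [smul_mul_smul_comm, hγ0, η, if_pos rfl]
        congr 1
        linear_combination -(P.M A : ℂ) * Complex.I_mul_I) α s
    simp only [AlgHom.comp_apply, map_sum, map_smul, nfHom_jet, nf]
    simpa only [map_sum, map_smul, Matrix.smul_apply, smul_eq_mul, mul_assoc] using
      congrArg toSC this
  | dirac_bar A α s =>
    -- For ψ̄ the matrices act from the right, hence the transposes, and the mass term has the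
    -- opposite sign.
    have := sum_smul_nfSpinor ((Complex.I * P.M A) • (P.γ 0)ᵀ)
      (fun β => (.ψbar A β : Fld I₁ I₂ I₃ I₄))
      (fun ρ => (Complex.I * η ρ) • (P.γ ρ)ᵀ) (-(P.M A : ℂ)) (by
        rw [smul_mul_smul_comm, ← Matrix.transpose_mul, hγ0, η, if_pos rfl, Matrix.transpose_one]
        congr 1
        linear_combination (P.M A : ℂ) * Complex.I_mul_I) α s
    simp only [AlgHom.comp_apply, map_sum, map_smul, nfHom_jet, nf]
    simpa only [map_sum, map_smul, Matrix.smul_apply, Matrix.transpose_apply, smul_eq_mul,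
      mul_assoc] using congrArg toSC this

/-- This carries on-shell equations to `SC`, where differentiation with respect to a jet variable
makes sense. Only this implication is needed, so the normal form may lose information. -/
theorem toSC_nfHom_eq_zero (hγ : P.Clifford) {A : Expr I₁ I₂ I₃ I₄} (h : P.toWick A = 0) :
    toSC (P.nfHom A) = 0 := by
  have := RingQuot.liftAlgHom_mkAlgHom_apply ℂ (toSC.comp P.nfHom) (P.nfHom_rel hγ) A
  rw [← AlgHom.comp_apply, ← this]
  change RingQuot.liftAlgHom ℂ _ (P.toWick A) = 0
  rw [h, map_zero]

end Params
end YM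

/-! ### Quartic words and compositions of two derivations. -/

namespace YM

variable {I₁ I₂ I₃ I₄ : Type*}

/-- The monomial with the given factors. -/
def word (l : List (Jet I₁ I₂ I₃ I₄)) : Expr I₁ I₂ I₃ I₄ := (l.map (FreeAlgebra.ι ℂ)).prod

theorem word_cons (x : Jet I₁ I₂ I₃ I₄) (l : List (Jet I₁ I₂ I₃ I₄)) :
    word (x :: l) = FreeAlgebra.ι ℂ x * word l := by
  simp [word]

/-- Combinations of the monomials of length four and ghost number `n` with factors in `X`. -/
def words (X : Set (Jet I₁ I₂ I₃ I₄)) (n : ℤ) : Submodule ℂ (Expr I₁ I₂ I₃ I₄) :=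
  Submodule.span ℂ {A | ∃ l : List (Jet I₁ I₂ I₃ I₄), l.length = 4 ∧ (∀ x ∈ l, x ∈ X) ∧
    (l.map fun x => x.1.gh).sum = n ∧ A = word l}

/-- The undifferentiated boson and ghost fields. -/
def undiff : Set (Jet I₁ I₂ I₃ I₄) := {x | x.1.dim = 1 ∧ x.2 = 0}

/-- The undifferentiated ghost and scalar fields. -/
def ghostScalar : Set (Jet I₁ I₂ I₃ I₄) := {x | ((∃ a, x.1 = .u a) ∨ ∃ c, x.1 = .Φ c) ∧ x.2 = 0}

theorem undiff_cases {x : Jet I₁ I₂ I₃ I₄} (hx : x ∈ undiff) :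
    (∃ a μ, x = (.v a μ, 0)) ∨ (∃ a, x = (.u a, 0)) ∨ (∃ a, x = (.ut a, 0)) ∨
      ∃ c, x = (.Φ c, 0) := by
  obtain ⟨h1, h2⟩ := hx
  rcases x with ⟨_ | _ | _ | _ | _ | _, s⟩ <;> simp_all [Fld.dim] <;> norm_num at h1

theorem ghostScalar_cases {x : Jet I₁ I₂ I₃ I₄} (hx : x ∈ ghostScalar) :
    (∃ a, x = (.u a, 0)) ∨ ∃ c, x = (.Φ c, 0) := by
  obtain ⟨⟨a, h⟩ | ⟨a, h⟩, h'⟩ := hx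
  · exact .inl ⟨a, Prod.ext h h'⟩
  · exact .inr ⟨a, Prod.ext h h'⟩

/-- Each of the four factors has dimension at least 1 and the total is at most 4, so each has
dimension exactly 1. This excludes derivatives and Dirac fields. -/
theorem quartic_le_words (n : ℤ) : Params.quartic I₁ I₂ I₃ I₄ n ≤ words undiff n := by
  have hf : ∀ ξ : Fld I₁ I₂ I₃ I₄, 1 ≤ ξ.dim := fun ξ => by cases ξ <;> simp [Fld.dim] <;> norm_num
  refine Submodule.span_le.2 ?_
  rintro _ ⟨x₁, x₂, x₃, x₄, rfl, hn, hd⟩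
  refine Submodule.subset_span ⟨[x₁, x₂, x₃, x₄], rfl, ?_, ?_, ?_⟩
  · have hx : ∀ x : Jet I₁ I₂ I₃ I₄, 0 ≤ (Multiset.card x.2 : ℚ) := fun x => by positivity
    have hu : ∀ x : Jet I₁ I₂ I₃ I₄, Jet.dim x ≤ 1 → x ∈ undiff := fun x h => by
      rw [Jet.dim] at h
      have h1 := hf x.1
      have h2 := hx x
      exact ⟨by linarith, Multiset.card_eq_zero.1 (by exact_mod_cast (by linarith :
        (Multiset.card x.2 : ℚ) = 0))⟩
    have hl : ∀ x : Jet I₁ I₂ I₃ I₄, 1 ≤ Jet.dim x := fun x => by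
      rw [Jet.dim]; linarith [hf x.1, hx x]
    have h1 := hl x₁
    have h2 := hl x₂
    have h3 := hl x₃
    have h4 := hl x₄
    simp only [List.mem_cons, List.not_mem_nil, or_false]
    rintro x (rfl | rfl | rfl | rfl) <;> exact hu _ (by linarith)
  · simp only [List.map_cons, List.map_nil, List.sum_cons, List.sum_nil]
    linarith
  · simp [word, mul_assoc]

theorem der_word_eq_zero {p : Bool} {D : Jet I₁ I₂ I₃ I₄ → Expr I₁ I₂ I₃ I₄}
    {l : List (Jet I₁ I₂ I₃ I₄)} (h : ∀ x ∈ l, D x = 0) : der p D (word l) = 0 := by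
  induction l with
  | nil => simp [word, der_one]
  | cons x l ih =>
    rw [word_cons, der_mul, der_ι, h x (by simp), ih fun y hy => h y (by simp [hy])]
    simp

theorem der_grading_ι {p q : Bool} {D : Jet I₁ I₂ I₃ I₄ → Expr I₁ I₂ I₃ I₄}
    {x : Jet I₁ I₂ I₃ I₄} (h : D x = 0) : der p D (grading q (FreeAlgebra.ι ℂ x)) = 0 := by
  rw [grading_ι]
  split_ifs <;> simp [der_ι, h]

/-- The composition of two graded derivations on a monomial whose factors are eigenvectors of the
composition and are annihilated by the first one. -/
theorem der_der_word {p q : Bool} {D D' : Jet I₁ I₂ I₃ I₄ → Expr I₁ I₂ I₃ I₄}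
    {n : Jet I₁ I₂ I₃ I₄ → ℂ} {l : List (Jet I₁ I₂ I₃ I₄)} (hpq : p = q ∨ ∀ x ∈ l, n x = 0)
    (h₀ : ∀ x ∈ l, D x = 0) (h₁ : ∀ x ∈ l, der p D (D' x) = n x • FreeAlgebra.ι ℂ x) :
    der p D (der q D' (word l)) = (l.map n).sum • word l := by
  induction l with
  | nil => simp [word, der_one]
  | cons x l ih =>
    -- Moving both derivations past x produces two grading signs. They cancel if the parities agree;
    -- otherwise all eigenvalues are 0 and the signs do not matter.
    have h2 : (l.map n).sum • (grading p (grading q (FreeAlgebra.ι ℂ x)) * word l) =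
        (l.map n).sum • (FreeAlgebra.ι ℂ x * word l) := by
      rcases hpq with rfl | h
      · rw [grading_grading]
      · have : (l.map n).sum = 0 := List.sum_eq_zero fun y hy => by
          obtain ⟨z, hz, rfl⟩ := List.mem_map.1 hy
          exact h z (by simp [hz])
        rw [this, zero_smul, zero_smul]
    rw [word_cons, der_mul, der_ι, map_add, der_mul, der_mul, h₁ x (by simp),
      der_grading_ι (h₀ x (by simp)), der_word_eq_zero fun y hy => h₀ y (by simp [hy]),
      ih (hpq.imp_right fun h y hy => h y (by simp [hy])) (fun y hy => h₀ y (by simp [hy]))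
      fun y hy => h₁ y (by simp [hy]), mul_smul_comm, h2, List.map_cons, List.sum_cons, add_smul,
      smul_mul_assoc]
    simp

theorem der_der_eq_zero {p q : Bool} {D D' : Jet I₁ I₂ I₃ I₄ → Expr I₁ I₂ I₃ I₄}
    {X : Set (Jet I₁ I₂ I₃ I₄)} {n : ℤ} (h₀ : ∀ x ∈ X, D x = 0)
    (h₁ : ∀ x ∈ X, der p D (D' x) = 0) {A : Expr I₁ I₂ I₃ I₄} (hA : A ∈ words X n) :
    der p D (der q D' A) = 0 := by
  induction hA using Submodule.span_induction with
  | mem A hA =>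
    obtain ⟨l, -, hl, -, rfl⟩ := hA
    rw [der_der_word (n := fun _ => 0) (.inr fun _ _ => rfl) (fun x hx => h₀ x (hl x hx)) fun x hx => by
      rw [h₁ x (hl x hx)]; simp]
    simp
  | zero => simp
  | add A B _ _ hA hB => rw [map_add, map_add, hA, hB, add_zero]
  | smul c A _ hA => rw [map_smul, map_smul, hA, smul_zero]

theorem ghostScalar_subset : (ghostScalar : Set (Jet I₁ I₂ I₃ I₄)) ⊆ undiff := by
  intro x hx
  rcases ghostScalar_cases hx with ⟨a, rfl⟩ | ⟨a, rfl⟩ <;> exact ⟨rfl, rfl⟩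

/-! A homotopy for the gauge charge. -/

/-- The values of the contracting homotopy. -/
def homotopyVal : Jet I₁ I₂ I₃ I₄ → Expr I₁ I₂ I₃ I₄
  | (.u a, s) => ∑ μ, if s = {μ} then (-Complex.I * η μ) • v a μ else 0
  | (.v a μ, s) => if s = {μ} then (Complex.I / 4) • ut a else 0
  | _ => 0

/-- The contracting homotopy: an odd derivation sending `d_μ u_a` to `-i v_{aμ}` and
`d_μ v_a^μ` to `i ũ_a`. -/
def homotopy : Expr I₁ I₂ I₃ I₄ →ₗ[ℂ] Expr I₁ I₂ I₃ I₄ := der true homotopyVal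

theorem toSC_homotopy_eq_zero {A : Expr I₁ I₂ I₃ I₄} (h : toSC A = 0) : toSC (homotopy A) = 0 := by
  refine toSC_der_eq_zero (fun x => ?_) h
  have hj := fun (ξ : Fld I₁ I₂ I₃ I₄) s => toSC_isSuperComm.jet ξ s
  rcases x with ⟨(⟨a, μ⟩ | a | a | a | _ | _), s⟩
  · change SuperCommutes toSC _ (if _ then _ else _)
    split_ifs
    · exact (hj (.ut a) 0).smul _
    · exact .zero _
  · refine SuperCommutes.sum _ fun μ _ => ?_
    split_ifs
    · exact (hj (.v a μ) 0).smul _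
    · exact .zero _
  all_goals exact .zero _

theorem homotopyVal_undiff {x : Jet I₁ I₂ I₃ I₄} (hx : x ∈ undiff) : homotopyVal x = 0 := by
  have h : ∀ μ : Fin 4, (0 : Multiset (Fin 4)) ≠ {μ} := fun μ => (Multiset.singleton_ne_zero μ).symm
  rcases undiff_cases hx with ⟨a, μ, rfl⟩ | ⟨a, rfl⟩ | ⟨a, rfl⟩ | ⟨c, rfl⟩ <;>
    simp [homotopyVal, h]

/-- `v` and `ũ` are the fields which the gauge charge does not map to undifferentiated fields. -/
def isGauge : Jet I₁ I₂ I₃ I₄ → Bool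
  | (.v _ _, _) => true
  | (.ut _, _) => true
  | _ => false

namespace Params

variable (P : Params I₁ I₂ I₃ I₄)

/-- The constants of the homotopy are fixed here: iη·(-iη) = 1 on v, and on ũ each of the four terms
of the divergence gives -i·(i/4) = 1/4. The mass terms involve undifferentiated fields, which the
homotopy kills. -/
theorem homotopy_dQval {x : Jet I₁ I₂ I₃ I₄} (hx : x ∈ undiff) :
    homotopy (P.dQval x) = (if isGauge x then 1 else 0 : ℂ) • FreeAlgebra.ι ℂ x := by
  have h : ∀ μ : Fin 4, (0 : Multiset (Fin 4)) ≠ {μ} := fun μ => (Multiset.singleton_ne_zero μ).symm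
  have hj : ∀ (ξ : Fld I₁ I₂ I₃ I₄) s, homotopy (jet ξ s) = homotopyVal (ξ, s) :=
    fun ξ s => der_ι _ _ _
  rcases undiff_cases hx with ⟨a, μ, rfl⟩ | ⟨a, rfl⟩ | ⟨a, rfl⟩ | ⟨c, rfl⟩
  · simp only [dQval, map_smul, hj, homotopyVal, isGauge, Multiset.cons_zero,
      Multiset.singleton_inj, Finset.sum_ite_eq, Finset.mem_univ, if_true, smul_smul]
    congr 1
    linear_combination -(η μ * η μ) * Complex.I_mul_I + η_mul_self μ
  · simp [dQval, isGauge]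
  · have h4 : (-Complex.I) • ((4 : ℂ) • (Complex.I / 4) • ut a) =
        (1 : ℂ) • (FreeAlgebra.ι ℂ (.ut a, 0) : Expr I₁ I₂ I₃ I₄) := by
      rw [smul_smul, smul_smul]
      congr 1
      linear_combination -Complex.I_mul_I
    rcases a with a | a
    · simp only [dQval, map_smul, map_sum, hj, homotopyVal, isGauge, Multiset.cons_zero, if_true]
      rw [← h4, Finset.sum_const, Finset.card_univ, Fintype.card_fin, ← Nat.cast_smul_eq_nsmul ℂ]
      norm_num
    · simp only [dQval, map_smul, map_add, map_sum, hj, homotopyVal, isGauge, Multiset.cons_zero,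
        if_true, smul_zero, add_zero]
      rw [← h4, Finset.sum_const, Finset.card_univ, Fintype.card_fin, ← Nat.cast_smul_eq_nsmul ℂ]
      norm_num
  · rcases c with a | j <;> simp [dQval, isGauge, hj, homotopyVal, h]

theorem sum_isGauge (l : List (Jet I₁ I₂ I₃ I₄)) :
    (l.map fun x => (if isGauge x then 1 else 0 : ℂ)).sum = (l.countP isGauge : ℂ) := by
  induction l with
  | nil => simp
  | cons x l ih =>
    rw [List.map_cons, List.sum_cons, ih, List.countP_cons]
    split_ifs <;> push_cast <;> ring

/-- The operator counting the fields `v` and `ũ`. -/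
def gaugeCount : Module.End ℂ (Expr I₁ I₂ I₃ I₄) := homotopy ∘ₗ P.dQ

theorem gaugeCount_word {l : List (Jet I₁ I₂ I₃ I₄)} (hl : ∀ x ∈ l, x ∈ undiff) :
    P.gaugeCount (word l) = (l.countP isGauge : ℂ) • word l := by
  rw [← sum_isGauge]
  exact der_der_word (.inl rfl) (fun x hx => homotopyVal_undiff (hl x hx))
    fun x hx => P.homotopy_dQval (hl x hx)

/-- An expression in undifferentiated fields with `d_Q A = 0` up to terms killed by the homotopy
depends on `u` and `Φ` only. -/
theorem exists_ghostScalar {n : ℤ} {A : Expr I₁ I₂ I₃ I₄} (hA : A ∈ words undiff n)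
    (h : toSC (homotopy (P.dQ A)) = 0) : ∃ A' ∈ words ghostScalar n, toSC A = toSC A' := by
  set N := P.gaugeCount
  -- On words, N counts the letters v and ũ, so its eigenvalues are 0, …, 4, and Q is 24 times the
  -- projection onto eigenvalue 0.
  set Q := (N - 1) * (N - 2) * (N - 3) * (N - 4) with hQ
  have hmem : Q A ∈ words ghostScalar n := by
    clear h
    induction hA using Submodule.span_induction with
    | mem A hA =>
      obtain ⟨l, hl, hX, hn, rfl⟩ := hA
      have hN := P.gaugeCount_word hX
      set k := l.countP isGauge with hk
      have hk4 : k ≤ 4 := hl ▸ List.countP_le_length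
      have hQw : Q (word l) =
          (((k : ℂ) - 1) * ((k : ℂ) - 2) * ((k : ℂ) - 3) * ((k : ℂ) - 4)) • word l := by
        simp only [hQ, Module.End.mul_apply, LinearMap.sub_apply, Module.End.one_apply,
          Module.End.ofNat_apply, map_sub, map_smul, map_nsmul, N, hN]
        module
      rw [hQw]
      by_cases h0 : k = 0
      · refine Submodule.smul_mem _ _ (Submodule.subset_span ⟨l, hl, fun x hx => ?_, hn, rfl⟩)
        have := List.countP_eq_zero.1 h0 x hx
        rcases undiff_cases (hX x hx) with ⟨a, μ, rfl⟩ | ⟨a, rfl⟩ | ⟨a, rfl⟩ | ⟨c, rfl⟩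
        · exact absurd rfl this
        · exact ⟨.inl ⟨a, rfl⟩, rfl⟩
        · exact absurd rfl this
        · exact ⟨.inr ⟨c, rfl⟩, rfl⟩
      · have : (((k : ℂ) - 1) * ((k : ℂ) - 2) * ((k : ℂ) - 3) * ((k : ℂ) - 4)) = 0 := by
          clear_value k
          clear hQw hN hk
          interval_cases k <;> simp at h0 ⊢
        rw [this, zero_smul]
        exact Submodule.zero_mem _
    | zero => simp
    | add A B _ _ hA hB => rw [map_add]; exact Submodule.add_mem _ hA hB
    | smul c A _ hA => rw [map_smul]; exact Submodule.smul_mem _ _ hA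
  have hN : ∀ B, toSC B = 0 → toSC (N B) = 0 := fun B hB =>
    toSC_homotopy_eq_zero (P.toSC_dQ_eq_zero hB)
  have h1 : toSC (N A) = 0 := h
  have h2 := hN _ h1
  have h3 := hN _ h2
  have h4 := hN _ h3
  -- As N A vanishes in `SC`, so do the higher powers, and only the constant term 24 of Q survives.
  have hQA : Q A = N (N (N (N A))) - (10 : ℂ) • N (N (N A)) + (35 : ℂ) • N (N A) -
      (50 : ℂ) • N A + (24 : ℂ) • A := by
    simp only [hQ, Module.End.mul_apply, LinearMap.sub_apply, Module.End.one_apply,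
      Module.End.ofNat_apply, map_sub, map_smul, map_nsmul]
    module
  refine ⟨(1 / 24 : ℂ) • Q A, Submodule.smul_mem _ _ hmem, ?_⟩
  rw [map_smul, hQA]
  simp only [map_add, map_sub, map_smul, h1, h2, h3, h4, smul_zero, sub_zero, zero_add, smul_smul]
  norm_num

end Params

/-! The divergence of expressions in `u` and `Φ`. -/

/-- The values of `scalarShift`. -/
def scalarShiftVal (ν : Fin 4) : Jet I₁ I₂ I₃ I₄ → Expr I₁ I₂ I₃ I₄
  | (.Φ c, s) => if s = {ν} then Φ c else 0
  | _ => 0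

/-- The even derivation sending `d_ν Φ_c` to `Φ_c`. -/
def scalarShift (ν : Fin 4) : Expr I₁ I₂ I₃ I₄ →ₗ[ℂ] Expr I₁ I₂ I₃ I₄ := der false (scalarShiftVal ν)

theorem toSC_scalarShift_eq_zero (ν : Fin 4) {A : Expr I₁ I₂ I₃ I₄} (h : toSC A = 0) :
    toSC (scalarShift ν A) = 0 := by
  refine toSC_der_eq_zero (fun x => ?_) h
  rcases x with ⟨(⟨a, μ⟩ | a | a | c | _ | _), s⟩
  · exact .zero _
  · exact .zero _
  · exact .zero _
  · change SuperCommutes toSC _ (if _ then _ else _)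
    split_ifs
    · exact toSC_isSuperComm.jet (.Φ c) 0
    · exact .zero _
  all_goals exact .zero _

theorem scalarShiftVal_undiff (ν : Fin 4) {x : Jet I₁ I₂ I₃ I₄} (hx : x ∈ undiff) :
    scalarShiftVal ν x = 0 := by
  rcases undiff_cases hx with ⟨a, μ, rfl⟩ | ⟨a, rfl⟩ | ⟨a, rfl⟩ | ⟨c, rfl⟩ <;>
    simp [scalarShiftVal, (Multiset.singleton_ne_zero ν).symm]

/-- A word of length four in u and Φ of ghost number n has 4 - n letters Φ, and turning ∂_ν Φ back
into Φ counts them. If μ ≠ ν there is nothing to turn back. -/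
theorem scalarShift_d (μ ν : Fin 4) {n : ℤ} {A : Expr I₁ I₂ I₃ I₄} (hA : A ∈ words ghostScalar n) :
    scalarShift ν (d μ A) = ((if μ = ν then 1 else 0) * (4 - n) : ℂ) • A := by
  induction hA using Submodule.span_induction with
  | mem A hA =>
    obtain ⟨l, hl, hX, rfl, rfl⟩ := hA
    have h := der_der_word (p := false) (q := false) (D := scalarShiftVal ν)
      (D' := fun x : Jet I₁ I₂ I₃ I₄ => jet x.1 (μ ::ₘ x.2))
      (n := fun x => (if μ = ν then 1 else 0) * (1 - (x.1.gh : ℂ))) (l := l) (.inl rfl)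
      (fun x hx => scalarShiftVal_undiff ν (ghostScalar_subset (hX x hx))) fun x hx => by
        rw [jet, der_ι]
        rcases ghostScalar_cases (hX x hx) with ⟨a, rfl⟩ | ⟨c, rfl⟩
        · simp [scalarShiftVal, Fld.gh]
        · simp [scalarShiftVal, Fld.gh, Φ, jet]
    refine h.trans ?_
    have hs : ∀ l : List (Jet I₁ I₂ I₃ I₄),
        (l.map fun x => (if μ = ν then 1 else 0) * (1 - (x.1.gh : ℂ))).sum =
        (if μ = ν then 1 else 0) * (l.length - ((l.map fun x => x.1.gh).sum : ℤ)) := fun l => by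
      induction l with
      | nil => simp
      | cons x l ih =>
        simp only [List.map_cons, List.sum_cons, List.length_cons, ih]
        push_cast
        ring
    rw [hs, hl]
    norm_num
  | zero => simp
  | add A B _ _ hA hB => rw [map_add, map_add, hA, hB, smul_add]
  | smul c A _ hA => rw [map_smul, map_smul, hA, smul_comm]

namespace Params

variable (P : Params I₁ I₂ I₃ I₄)

/-- The charge never produces a derivative of Φ from undifferentiated fields: it contains ∂u, ∂v, Φ
and u only. -/
theorem scalarShift_dQ (ν : Fin 4) {n : ℤ} {A : Expr I₁ I₂ I₃ I₄} (hA : A ∈ words undiff n) :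
    scalarShift ν (P.dQ A) = 0 := by
  refine der_der_eq_zero (fun x hx => scalarShiftVal_undiff ν hx) (fun x hx => ?_) hA
  have h := (Multiset.singleton_ne_zero ν).symm
  rcases undiff_cases hx with ⟨a, μ, rfl⟩ | ⟨a, rfl⟩ | ⟨a | a, rfl⟩ | ⟨a | j, rfl⟩ <;>
    simp [-Complex.coe_smul, dQval, jet, der_ι, scalarShiftVal, h]

/-- If `X + d_Q S` is a divergence of expressions in `u` and `Φ`, these vanish. -/
theorem toSC_eq_zero_of_divergence {m n : ℤ} (hn : n ≠ 4) {X S : Expr I₁ I₂ I₃ I₄}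
    {R : Fin 4 → Expr I₁ I₂ I₃ I₄} (hX : ∀ ν, scalarShift ν X = 0) (hS : S ∈ words undiff m)
    (hR : ∀ μ, R μ ∈ words undiff n) (hd : ∀ μ, toSC (homotopy (P.dQ (R μ))) = 0)
    (h : toSC (X + P.dQ S - Complex.I • ∑ μ, d μ (R μ)) = 0) (ν : Fin 4) : toSC (R ν) = 0 := by
  choose R' hR' hRR' using fun μ => P.exists_ghostScalar (hR μ) (hd μ)
  have hdR : ∀ μ, toSC (d μ (R μ)) = toSC (d μ (R' μ)) := fun μ => by
    have := toSC_d_eq_zero μ (A := R μ - R' μ) (by rw [map_sub, hRR', sub_self])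
    rwa [map_sub, map_sub, sub_eq_zero] at this
  have h1 : toSC (X + P.dQ S - Complex.I • ∑ μ, d μ (R' μ)) = 0 := by
    rw [← h]
    simp only [map_sub, map_add, map_smul, map_sum, hdR]
  -- The shift isolates the component ν of the divergence and multiplies it by 4 - n, which is
  -- invertible.
  have h2 := toSC_scalarShift_eq_zero ν h1
  simp only [map_sub, map_add, map_smul, map_sum, hX, P.scalarShift_dQ ν hS,
    scalarShift_d _ ν (hR' _)] at h2
  have hn' : (4 - n : ℂ) ≠ 0 := sub_ne_zero.2 fun h => hn (by exact_mod_cast h.symm)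
  simpa [ite_smul, Complex.I_ne_zero, hn', ← hRR'] using h2

/-! Normal forms of the terms of the cohomology equation. -/

theorem nfHom_ι {x : Jet I₁ I₂ I₃ I₄} (hx : x ∈ undiff) :
    P.nfHom (FreeAlgebra.ι ℂ x) = FreeAlgebra.ι ℂ x := by
  obtain ⟨ξ, s⟩ := x
  obtain ⟨-, rfl : s = 0⟩ := hx
  exact P.nfHom_jet_zero ξ

theorem nfHom_word {l : List (Jet I₁ I₂ I₃ I₄)} (hl : ∀ x ∈ l, x ∈ undiff) :
    P.nfHom (word l) = word l := by
  induction l with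
  | nil => simp [word]
  | cons x l ih =>
    rw [word_cons, map_mul, P.nfHom_ι (hl x (by simp)), ih fun y hy => hl y (by simp [hy])]

/-- A derivation yields at most one altered letter in each term, so it suffices that the values on
undifferentiated fields are already normal. This covers d_Q and ∂_μ. -/
theorem nfHom_der {p : Bool} {D : Jet I₁ I₂ I₃ I₄ → Expr I₁ I₂ I₃ I₄} {n : ℤ}
    (hD : ∀ x ∈ undiff, P.nfHom (D x) = D x) {A : Expr I₁ I₂ I₃ I₄} (hA : A ∈ words undiff n) :
    P.nfHom (der p D A) = der p D A := by
  have hw : ∀ l : List (Jet I₁ I₂ I₃ I₄), (∀ x ∈ l, x ∈ undiff) →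
      P.nfHom (der p D (word l)) = der p D (word l) := fun l hl => by
    induction l with
    | nil => simp [word, der_one]
    | cons x l ih =>
      have hx := hl x (by simp)
      have hl' : ∀ y ∈ l, y ∈ undiff := fun y hy => hl y (by simp [hy])
      have hg : P.nfHom (grading p (FreeAlgebra.ι ℂ x)) = grading p (FreeAlgebra.ι ℂ x) := by
        rw [grading_ι]
        split_ifs <;> simp [P.nfHom_ι hx]
      rw [word_cons, der_mul, der_ι, map_add, map_mul, map_mul, hD x hx, P.nfHom_word hl', ih hl',
        hg]
  induction hA using Submodule.span_induction with
  | mem A hA =>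
    obtain ⟨l, -, hl, -, rfl⟩ := hA
    exact hw l hl
  | zero => simp
  | add A B _ _ hA hB => rw [map_add, map_add, hA, hB]
  | smul c A _ hA => rw [map_smul, map_smul, hA]

theorem nfHom_words {n : ℤ} {A : Expr I₁ I₂ I₃ I₄} (hA : A ∈ words undiff n) : P.nfHom A = A := by
  induction hA using Submodule.span_induction with
  | mem A hA =>
    obtain ⟨l, -, hl, -, rfl⟩ := hA
    exact P.nfHom_word hl
  | zero => simp
  | add A B _ _ hA hB => rw [map_add, hA, hB]
  | smul c A _ hA => rw [map_smul, hA]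

theorem nfHom_d (μ : Fin 4) {n : ℤ} {A : Expr I₁ I₂ I₃ I₄} (hA : A ∈ words undiff n) :
    P.nfHom (d μ A) = d μ A := by
  refine P.nfHom_der (fun x hx => ?_) hA
  rcases undiff_cases hx with ⟨a, ν, rfl⟩ | ⟨a, rfl⟩ | ⟨a, rfl⟩ | ⟨c, rfl⟩
  · exact P.nfHom_v_singleton _ _ _
  · exact P.nfHom_u_singleton _ _
  · exact P.nfHom_ut_singleton _ _
  · exact P.nfHom_Φ_singleton _ _

theorem nfHom_dQ {n : ℤ} {A : Expr I₁ I₂ I₃ I₄} (hA : A ∈ words undiff n) :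
    P.nfHom (P.dQ A) = P.dQ A := by
  refine P.nfHom_der (fun x hx => ?_) hA
  rcases undiff_cases hx with ⟨a, ν, rfl⟩ | ⟨a, rfl⟩ | ⟨a | a, rfl⟩ | ⟨c | j, rfl⟩ <;>
    simp [-Complex.coe_smul, dQval, nfHom_v_singleton, nfHom_u_singleton, nfHom_jet_zero]

end Params
end YM

/-! ### Coefficients of monomials as iterated left derivatives. -/

namespace YM

variable {I₁ I₂ I₃ I₄ : Type*}

theorem toSC_smul_one_eq_zero {c : ℂ} (h : toSC (c • (1 : Expr I₁ I₂ I₃ I₄)) = 0) : c = 0 :=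
  toSC_algebraMap_eq_zero (by rwa [Algebra.algebraMap_eq_smul_one])

section Coefficients

variable [Fintype I₁] [Fintype I₂] [Fintype I₃] [Fintype I₄]

theorem pd_pd_u_u (C : I₁ ⊕ I₂ → I₁ ⊕ I₂ → ℂ) (x y : I₁ ⊕ I₂) :
    pd (.u y, 0) (pd (.u x, 0) (∑ b, ∑ c, C b c • (u b * u c) : Expr I₁ I₂ I₃ I₄)) =
      (C x y - C y x) • 1 := by
  classical
  simp [-Fintype.sum_sum_type, pd_mul, pd_u, grading_u, Fld.odd, Finset.sum_add_distrib,
    Finset.sum_ite_irrel, smul_ite]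
  module

theorem pd_pd_pd_u_u_u (C : I₁ ⊕ I₂ → I₁ ⊕ I₂ → I₁ ⊕ I₂ → ℂ) (x y z : I₁ ⊕ I₂) :
    pd (.u z, 0) (pd (.u y, 0) (pd (.u x, 0)
      (∑ b, ∑ c, ∑ e, C b c e • (u b * (u c * u e)) : Expr I₁ I₂ I₃ I₄))) =
      (C x y z - C x z y - C y x z + C y z x + C z x y - C z y x) • 1 := by
  classical
  simp [-Fintype.sum_sum_type, pd_mul, pd_u, grading_u, Fld.odd, Finset.sum_add_distrib,
    Finset.sum_ite_irrel, smul_ite, mul_add]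
  module

theorem pd_pd_u_Φ (C : I₁ ⊕ I₂ → I₂ ⊕ I₃ → ℂ) (x : I₁ ⊕ I₂) (y : I₂ ⊕ I₃) :
    pd (.u x, 0) (pd (.Φ y, 0) (∑ b, ∑ c, C b c • (u b * Φ c) : Expr I₁ I₂ I₃ I₄)) =
      C x y • 1 := by
  classical
  simp [-Fintype.sum_sum_type, pd_mul, pd_u, pd_Φ, grading_u, grading_Φ, Fld.odd,
    Finset.sum_add_distrib, grading_false,
    Finset.sum_ite_irrel, smul_ite]

theorem pd_Φ_pd_d_Φ_scalar1 (P : Params I₁ I₂ I₃ I₄) (e g : I₂ ⊕ I₃) :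
    pd (.Φ e, 0) (pd (.Φ g, {0}) (P.scalar1 0)) =
      ∑ b, ∑ c, (2 * P.f'f' e b g c - P.ff' b c e g) • (u b * u c) := by
  classical
  simp [-Fintype.sum_sum_type, Params.scalar1, pd_mul, pd_u, pd_Φ, pd_d_Φ, pd_v, grading_d_Φ,
    grading_u, grading_Φ, Fld.odd, grading_v, η,
    Finset.sum_add_distrib, grading_false, Finset.sum_ite_irrel, smul_ite]
  simp only [Finset.smul_sum, ← Finset.sum_neg_distrib, ← Finset.sum_add_distrib]
  refine Finset.sum_congr rfl fun b _ => Finset.sum_congr rfl fun c _ => ?_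
  module

theorem pd_ψbar_pd_ψ_bil (m : Matrix I₄ I₄ ℂ) (g : Matrix (Fin 4) (Fin 4) ℂ) (A B : I₄)
    (α β : Fin 4) : pd (.ψbar A α, 0) (pd (.ψ B β, 0) (Params.bil m g : Expr I₁ I₂ I₃ I₄)) =
      (-(m A B * g α β)) • 1 := by
  classical
  simp [Params.bil, pd_mul, pd_jet, grading_jet, Fld.odd, ite_and, Finset.sum_ite_irrel, smul_ite]

theorem pd_v_A11 {P : Params I₁ I₂ I₃ I₄} (hP : P.Consistent) (g : I₁ ⊕ I₂) :
    pd (.v g 1, {0}) (P.A11 0 1) = ∑ b, ∑ c, ∑ e, P.ff b c e g • (u b * (u c * u e)) := by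
  classical
  simp [-Fintype.sum_sum_type, P.A11_expand hP, pd_mul, pd_u, pd_d_v, F, ite_and,
    Fld.odd, η, Finset.sum_add_distrib, grading_false, Finset.sum_ite_irrel, smul_ite, mul_assoc]

theorem pd_ψbar_pd_ψ_u_u (K : I₁ ⊕ I₂ → I₁ ⊕ I₂ → ℤˣ → Matrix I₄ I₄ ℂ)
    (g : ℤˣ → Matrix (Fin 4) (Fin 4) ℂ) (A B : I₄) (α β : Fin 4) :
    pd (.ψbar A α, 0) (pd (.ψ B β, 0)
      (∑ b, ∑ c, ∑ ε, u b * u c * Params.bil (K b c ε) (g ε) : Expr I₁ I₂ I₃ I₄)) =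
      ∑ b, ∑ c, (-∑ ε, K b c ε A B * g ε α β) • (u b * u c) := by
  classical
  simp only [map_sum, pd_mul, pd_u, Fld.odd, grading_u, Prod.mk.injEq, reduceCtorEq, false_and,
    if_false, zero_mul, mul_zero, zero_add, add_zero, map_mul, neg_mul, mul_neg, neg_neg,
    pd_ψbar_pd_ψ_bil, neg_smul, mul_smul_comm, mul_one, Finset.sum_smul, Finset.sum_neg_distrib]

theorem pd_ψbar_pd_ψ_u_Φ (K : I₁ ⊕ I₂ → I₂ ⊕ I₃ → ℤˣ → Matrix I₄ I₄ ℂ)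
    (g : ℤˣ → Matrix (Fin 4) (Fin 4) ℂ) (A B : I₄) (α β : Fin 4) :
    pd (.ψbar A α, 0) (pd (.ψ B β, 0)
      (∑ b, ∑ c, ∑ ε, u b * Φ c * Params.bil (K b c ε) (g ε) : Expr I₁ I₂ I₃ I₄)) =
      ∑ b, ∑ c, (-∑ ε, K b c ε A B * g ε α β) • (u b * Φ c) := by
  classical
  simp only [map_sum, pd_mul, pd_u, pd_Φ, Fld.odd, grading_u, grading_Φ, Prod.mk.injEq,
    reduceCtorEq, false_and, map_neg, grading_false, smul_neg,
    if_false, zero_mul, mul_zero, zero_add, add_zero, map_mul, neg_mul, mul_neg, neg_neg,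
    pd_ψbar_pd_ψ_bil, neg_smul, mul_smul_comm, mul_one, Finset.sum_smul, Finset.sum_neg_distrib]

theorem pd_u_Φ_Φ_Φ (C : I₁ ⊕ I₂ → I₂ ⊕ I₃ → I₂ ⊕ I₃ → I₂ ⊕ I₃ → ℂ)
    (a : I₁ ⊕ I₂) (b c e : I₂ ⊕ I₃) :
    pd (.u a, 0) (pd (.Φ e, 0) (pd (.Φ c, 0) (pd (.Φ b, 0) (∑ a, ∑ b, ∑ c, ∑ e,
      C a b c e • (u a * (Φ b * (Φ c * Φ e))) : Expr I₁ I₂ I₃ I₄)))) =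
      (C a b c e + C a b e c + C a c b e + C a c e b + C a e b c + C a e c b) • 1 := by
  classical
  simp [-Fintype.sum_sum_type, pd_mul, pd_u, pd_Φ, grading_u, grading_Φ, Fld.odd,
    Finset.sum_add_distrib, grading_false, mul_add,
    Finset.sum_ite_irrel, smul_ite]
  module

end Coefficients

end YM

/-! ### Descent, first half: the Jacobi identity and the representation property. -/

namespace YM

variable {I₁ I₂ I₃ I₄ : Type*} [Fintype I₁] [Fintype I₂] [Fintype I₃] [Fintype I₄]

/-- A letter absent from the words and from the values on their letters cannot occur in the image.
It gives the list of monomials to which R cannot contribute. -/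
theorem pd_der_eq_zero {q : Bool} {D : Jet I₁ I₂ I₃ I₄ → Expr I₁ I₂ I₃ I₄} {n : ℤ}
    (y : Jet I₁ I₂ I₃ I₄) (hy : y ∉ undiff) (hD : ∀ x ∈ undiff, pd y (D x) = 0)
    {A : Expr I₁ I₂ I₃ I₄} (hA : A ∈ words undiff n) : pd y (der q D A) = 0 :=
  der_der_eq_zero (fun x hx => if_neg fun h => hy (by rwa [← h])) hD hA

theorem singleton_notMem_undiff (ξ : Fld I₁ I₂ I₃ I₄) (μ : Fin 4) : (ξ, {μ}) ∉ undiff :=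
  fun h => Multiset.singleton_ne_zero μ h.2

theorem ψ_notMem_undiff (A : I₄) (α : Fin 4) : ((.ψ A α, 0) : Jet I₁ I₂ I₃ I₄) ∉ undiff := by
  rintro ⟨h : (3 / 2 : ℚ) = 1, -⟩
  norm_num at h

theorem pd_ψ_d_eq_zero (A : I₄) (α : Fin 4) (μ : Fin 4) {n : ℤ} {X : Expr I₁ I₂ I₃ I₄}
    (hX : X ∈ words undiff n) : pd (.ψ A α, 0) (d μ X) = 0 :=
  pd_der_eq_zero _ (ψ_notMem_undiff A α) (fun x _ => by
    rw [pd_jet, if_neg]; simp) hX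

theorem pd_d_Φ_d_eq_zero (c : I₂ ⊕ I₃) {μ ν : Fin 4} (h : μ ≠ ν) {n : ℤ} {X : Expr I₁ I₂ I₃ I₄}
    (hX : X ∈ words undiff n) : pd (.Φ c, {ν}) (d μ X) = 0 :=
  pd_der_eq_zero _ (singleton_notMem_undiff _ _) (fun x hx => by
    rw [pd_jet, if_neg]
    simp [hx.2, h]) hX

namespace Params

variable (P : Params I₁ I₂ I₃ I₄)

theorem pd_ψ_dQ_eq_zero (A : I₄) (α : Fin 4) {n : ℤ} {X : Expr I₁ I₂ I₃ I₄}
    (hX : X ∈ words undiff n) : pd (.ψ A α, 0) (P.dQ X) = 0 :=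
  pd_der_eq_zero _ (ψ_notMem_undiff A α) (fun x hx => by
    rcases undiff_cases hx with ⟨a, ν, rfl⟩ | ⟨a, rfl⟩ | ⟨a | a, rfl⟩ | ⟨c | j, rfl⟩ <;>
      simp [-Complex.coe_smul, dQval, pd_jet]) hX

theorem pd_d_Φ_dQ_eq_zero (c : I₂ ⊕ I₃) (μ : Fin 4) {n : ℤ} {X : Expr I₁ I₂ I₃ I₄}
    (hX : X ∈ words undiff n) : pd (.Φ c, {μ}) (P.dQ X) = 0 :=
  pd_der_eq_zero _ (singleton_notMem_undiff _ _) (fun x hx => by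
    have h := (Multiset.singleton_ne_zero μ).symm
    rcases undiff_cases hx with ⟨a, ν, rfl⟩ | ⟨a, rfl⟩ | ⟨a | a, rfl⟩ | ⟨c | j, rfl⟩ <;>
      simp [-Complex.coe_smul, dQval, pd_jet, h]) hX

/-- Derivatives of v come only from d_Q ũ, as the divergence ∂_ρ v^ρ, so ∂_ν v^μ with ν ≠ μ is out
of reach. -/
theorem pd_d_v_dQ_eq_zero (a : I₁ ⊕ I₂) {μ ν : Fin 4} (h : μ ≠ ν) {n : ℤ}
    {X : Expr I₁ I₂ I₃ I₄} (hX : X ∈ words undiff n) : pd (.v a μ, {ν}) (P.dQ X) = 0 :=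
  pd_der_eq_zero _ (singleton_notMem_undiff _ _) (fun x hx => by
    have h' : ∀ a' ρ, ¬ (((.v a' ρ, {ρ}) : Jet I₁ I₂ I₃ I₄) = (.v a μ, {ν})) := fun a' ρ hρ => by
      simp only [Prod.mk.injEq, Fld.v.injEq, Multiset.singleton_inj] at hρ
      exact h (hρ.1.2.symm.trans hρ.2)
    rcases undiff_cases hx with ⟨a, ν, rfl⟩ | ⟨a, rfl⟩ | ⟨a | a, rfl⟩ | ⟨c | j, rfl⟩ <;>
      simp only [dQval, pd_jet, map_smul, map_sum, map_add, Multiset.cons_zero, h', if_false,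
        reduceCtorEq, Prod.mk.injEq, false_and, smul_zero, Finset.sum_const_zero, add_zero,
        map_zero]) hX

variable {P}
variable {R : List (Fin 4) → List (Fin 4) → Expr I₁ I₂ I₃ I₄}

/-- Words in undifferentiated fields are their own normal forms, so the equations of motion impose
no relation among them. -/
theorem toSC_eq_zero_of_words (hγ : P.Clifford) {n : ℤ} {A : Expr I₁ I₂ I₃ I₄}
    (hA : A ∈ words undiff n) (h : P.toWick A = 0) : toSC A = 0 := by
  rw [← P.nfHom_words hA]
  exact P.toSC_nfHom_eq_zero hγ h

namespace IsRenormalization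

variable (hR : P.IsRenormalization R)
include hR

theorem mem_words (J : List (Fin 4)) : R [] J ∈ words undiff (J.length : ℤ) := by
  have := quartic_le_words _ (hR.mem [] J)
  simpa using this

/-- Truncation is stated for the first entry; graded symmetry transfers it to the second. It starts
the descent at two indices. -/
theorem toSC_of_two_lt (hγ : P.Clifford) {J : List (Fin 4)} (hJ : 2 < J.length) :
    toSC (R [] J) = 0 := by
  refine toSC_eq_zero_of_words hγ (hR.mem_words J) ?_
  rw [hR.symm, map_smul, hR.trunc J [] hJ, smul_zero]

theorem toSC_diagonal (hγ : P.Clifford) (μ : Fin 4) : toSC (R [] [μ, μ]) = 0 := by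
  refine toSC_eq_zero_of_words hγ (hR.mem_words _) ?_
  have h := hR.antisymm μ μ []
  rw [map_neg, eq_neg_iff_add_eq_zero, ← two_smul ℂ,
    smul_eq_zero_iff_right (two_ne_zero' ℂ)] at h
  rw [hR.symm, map_smul, h, smul_zero]

/-- The cohomology equation in the free graded commutative algebra. -/
theorem toSC_cohomology (hγ : P.Clifford) (hE : P.Eliminates R) (J : List (Fin 4)) :
    toSC (P.nfHom (P.anomaly [] J)) +
      toSC (P.dQ (R [] J) - Complex.I • ∑ μ, d μ (R [] (J ++ [μ]))) = 0 := by
  have := P.toSC_nfHom_eq_zero hγ (hE [] J).1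
  rw [← this, map_add, map_add]
  congr 2
  simp only [sR, List.length_nil, pow_zero, mul_one, map_sub, map_smul, map_sum,
    P.nfHom_dQ (hR.mem_words _), P.nfHom_d _ (hR.mem_words _)]

theorem toSC_d_eq_zero_of_two_le (hγ : P.Clifford) {J : List (Fin 4)} (hJ : 2 ≤ J.length) :
    toSC (∑ μ, d μ (R [] (J ++ [μ]))) = 0 := by
  rw [map_sum]
  exact Finset.sum_eq_zero fun μ _ =>
    toSC_d_eq_zero μ (hR.toSC_of_two_lt hγ (by simp; omega))

theorem toSC_A11_add (hγ : P.Clifford) (hP : P.Consistent) (hE : P.Eliminates R) (μ ν : Fin 4) :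
    toSC (-P.A11 μ ν + P.dQ (R [] [μ, ν])) = 0 := by
  have h := hR.toSC_cohomology hγ hE [μ, ν]
  rw [map_sub, map_smul, hR.toSC_d_eq_zero_of_two_le hγ (by simp), smul_zero, sub_zero,
    ← map_add] at h
  have hA : P.nfHom (P.A11 μ ν) = P.A11 μ ν := by
    simp only [P.A11_expand hP, F, v, u, d_jet, map_sum, map_smul, map_mul, map_sub,
      Multiset.cons_zero, nfHom_v_singleton, nfHom_jet_zero]
  rwa [anomaly, map_neg, hA] at h

/-- Compare the coefficients of ∂_0 v^1 u u u in the equation for (T,T^{01}). The charge cannot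
produce ∂_0 v^1, and anticommuting ghosts turn the coefficient into the alternating sum of ff, which
is twice the Jacobi sum. -/
theorem jacobi (hγ : P.Clifford) (hP : P.Consistent) (hE : P.Eliminates R) : P.Jacobi := by
  intro x y z g
  have h := toSC_pd_eq_zero (.v g 1, {0}) (hR.toSC_A11_add hγ hP hE 0 1)
  rw [map_add, P.pd_d_v_dQ_eq_zero g (by decide) (hR.mem_words _), add_zero, map_neg, map_neg,
    neg_eq_zero, pd_v_A11 hP] at h
  have h := toSC_pd_eq_zero (.u z, 0) (toSC_pd_eq_zero (.u y, 0) (toSC_pd_eq_zero (.u x, 0) h))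
  rw [pd_pd_pd_u_u_u] at h
  have h := toSC_smul_one_eq_zero h
  have hs := hP.ff_swap
  have h' : P.ff x y z g + P.ff y z x g + P.ff z x y g = 0 := by
    linear_combination (1 / 2 : ℂ) * (h + hs x y z g + hs y z x g + hs z x y g)
  simpa only [Params.ff, Finset.sum_add_distrib] using h'

theorem toSC_dQ_eq_zero_two (hγ : P.Clifford) (hP : P.Consistent) (hE : P.Eliminates R)
    (μ ν : Fin 4) : toSC (P.dQ (R [] [μ, ν])) = 0 := by
  have h := hR.toSC_A11_add hγ hP hE μ ν
  rwa [map_add, map_neg, toSC_isSuperComm.map_A11 hP (hR.jacobi hγ hP hE), neg_zero,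
    zero_add] at h

theorem toSC_scalar1_add (hγ : P.Clifford) (hP : P.Consistent) (hE : P.Eliminates R) (μ : Fin 4) :
    toSC (P.scalar1 μ + P.dirac1 μ + P.dQ (R [] [μ]) - Complex.I • ∑ ν, d ν (R [] [μ, ν])) = 0 := by
  have h := hR.toSC_cohomology hγ hE [μ]
  have hA := P.toSC_nfHom_isSuperComm.map_A10 hP (hR.jacobi hγ hP hE) μ
  have h1 : P.nfHom (P.scalar1 μ) = P.scalar1 μ := by
    simp only [scalar1, Φ, v, u, d_jet, map_sum, map_smul, map_mul, map_sub, map_add, map_neg,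
      Multiset.cons_zero, nfHom_v_singleton, nfHom_Φ_singleton, nfHom_jet_zero]
  have h2 : P.nfHom (P.dirac1 μ) = P.dirac1 μ := by
    simp only [dirac1, bil, u, map_sum, map_smul, map_mul, nfHom_jet_zero]
  simp only [AlgHom.comp_apply, h1, h2] at hA
  rw [anomaly, hA, ← map_add, ← map_add] at h
  rw [add_sub_assoc]
  exact h

/-- Compare the coefficients of Φ_e ∂_0 Φ_g u u in the equation for (T,T^0). The charge contributes
no ∂Φ, and a divergence term would have to come from R^{00}, which vanishes by antisymmetry. -/
theorem representation (hγ : P.Clifford) (hP : P.Consistent) (hE : P.Eliminates R) :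
    P.Representation := by
  rw [hP.representation_iff]
  intro x y e g
  have h := toSC_pd_eq_zero (.Φ g, {0}) (hR.toSC_scalar1_add hγ hP hE 0)
  have hd : toSC (∑ ν, pd (.Φ g, {0}) (d ν (R [] [0, ν]))) = 0 := by
    rw [map_sum]
    refine Finset.sum_eq_zero fun ν _ => ?_
    -- For ν ≠ 0 the derivative ∂_ν cannot produce ∂_0 Φ.
    by_cases hν : ν = 0
    · subst hν
      exact toSC_pd_eq_zero _ (toSC_d_eq_zero _ (hR.toSC_diagonal hγ 0))
    · rw [pd_d_Φ_d_eq_zero g hν (hR.mem_words _), map_zero]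
  have h1 : pd (.Φ g, {0}) (P.dirac1 0) = 0 := by
    simp [dirac1, pd_mul, pd_u, pd_bil]
  rw [map_sub, map_add, map_add, h1, P.pd_d_Φ_dQ_eq_zero g 0 (hR.mem_words _), map_smul, map_sum,
    map_sub, map_smul, hd, smul_zero, sub_zero, add_zero, add_zero] at h
  have h := toSC_pd_eq_zero (.Φ e, 0) h
  rw [pd_Φ_pd_d_Φ_scalar1] at h
  have h := toSC_pd_eq_zero (.u y, 0) (toSC_pd_eq_zero (.u x, 0) h)
  rw [pd_pd_u_u] at h
  have h := toSC_smul_one_eq_zero h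
  have hs : P.ff' y x e g = -P.ff' x y e g := by
    simp only [Params.ff', ← Finset.sum_neg_distrib]
    exact Finset.sum_congr rfl fun a _ => by rw [hP.f_antisymm₂ a y x, neg_mul]
  rw [hs] at h
  linear_combination (-1 / 2 : ℂ) * h

theorem toSC_dirac1_add (hγ : P.Clifford) (hP : P.Consistent) (hE : P.Eliminates R) (μ : Fin 4) :
    toSC (P.dirac1 μ + P.dQ (R [] [μ]) - Complex.I • ∑ ν, d ν (R [] [μ, ν])) = 0 := by
  have h := hR.toSC_scalar1_add hγ hP hE μ
  simp only [map_sub, map_add] at h ⊢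
  rwa [toSC_isSuperComm.map_scalar1 (hP.representation_iff.1 (hR.representation hγ hP hE)),
    zero_add] at h

end IsRenormalization

end Params
end YM

/-! ### Independence of the chirality projections; descent, second half. -/

namespace YM
namespace Params

section Clifford

variable {I₁ I₂ I₃ I₄ : Type*} {P : Params I₁ I₂ I₃ I₄} (hγ : P.Clifford)
include hγ

theorem Clifford.sq (μ : Fin 4) : P.γ μ * P.γ μ = η μ • (1 : Matrix (Fin 4) (Fin 4) ℂ) := by
  have := hγ μ μ
  rw [if_pos rfl, ← two_smul ℂ, mul_smul] at this
  exact smul_right_injective _ (two_ne_zero' ℂ) this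

theorem Clifford.anticomm {μ ν : Fin 4} (h : μ ≠ ν) : P.γ μ * P.γ ν = -(P.γ ν * P.γ μ) := by
  have := hγ μ ν
  rwa [if_neg h, add_eq_zero_iff_eq_neg] at this

theorem Clifford.γ0_γ5_γ0 : P.γ 0 * P.γ5 * P.γ 0 = -P.γ5 := by
  have h0 : P.γ 0 * P.γ 0 = 1 := by simpa [η] using hγ.sq 0
  have h : P.γ 1 * P.γ 2 * P.γ 3 * P.γ 0 = -(P.γ 0 * (P.γ 1 * P.γ 2 * P.γ 3)) := by
    rw [mul_assoc, hγ.anticomm (show (3 : Fin 4) ≠ 0 by decide), mul_neg, ← mul_assoc,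
      mul_assoc (P.γ 1), hγ.anticomm (show (2 : Fin 4) ≠ 0 by decide), mul_neg, neg_mul, neg_neg,
      ← mul_assoc (P.γ 1), hγ.anticomm (show (1 : Fin 4) ≠ 0 by decide), neg_mul, neg_mul]
    simp only [mul_assoc]
  have h' : P.γ5 = Complex.I • (P.γ 0 * (P.γ 1 * P.γ 2 * P.γ 3)) := by
    rw [γ5]; simp only [mul_assoc]
  rw [h', mul_smul_comm, ← mul_assoc, h0, one_mul, smul_mul_assoc, h, smul_neg]

/-- Each γ_μ squares to ±1, so it can be cancelled on the right, and a zero product would make the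
unit matrix zero. -/
theorem Clifford.γ5_ne_zero : P.γ5 ≠ 0 := by
  intro h
  rw [γ5, smul_eq_zero_iff_right Complex.I_ne_zero] at h
  have hη : ∀ μ, η μ ≠ 0 := fun μ => by rw [η]; split_ifs <;> simp
  have hu : ∀ (A : Matrix (Fin 4) (Fin 4) ℂ) μ, A * P.γ μ = 0 → A = 0 := fun A μ hA => by
    have : A * (P.γ μ * P.γ μ) = 0 := by rw [← mul_assoc, hA, zero_mul]
    rwa [hγ.sq, mul_smul_comm, mul_one, smul_eq_zero_iff_right (hη μ)] at this
  have h0 := hu 1 0 (by rw [one_mul]; exact hu _ 1 (hu _ 2 (hu _ 3 h)))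
  exact one_ne_zero h0

/-- Conjugation by γ_0 fixes 1 and reverses γ_5, so 1 and γ_5 are linearly independent, and with
them the two projections. -/
theorem Clifford.eq_zero_of_sum_γε {k : ℤˣ → ℂ} (h : ∑ ε, k ε • P.γε ε = 0) (ε : ℤˣ) : k ε = 0 := by
  have h0 : P.γ 0 * P.γ 0 = 1 := by simpa [η] using hγ.sq 0
  have hu : (Finset.univ : Finset ℤˣ) = {1, -1} := by decide
  rw [hu, Finset.sum_pair (by decide)] at h
  simp only [γε, Units.val_one, Units.val_neg, Int.cast_one, Int.cast_neg, one_smul,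
    neg_smul] at h
  have h1 : (k 1 + k (-1)) • (1 : Matrix (Fin 4) (Fin 4) ℂ) + (k 1 - k (-1)) • P.γ5 = 0 := by
    have := congrArg (fun A : Matrix (Fin 4) (Fin 4) ℂ => (2 : ℂ) • A) h
    rw [smul_zero] at this
    rw [← this]
    module
  have h2 : (k 1 + k (-1)) • (1 : Matrix (Fin 4) (Fin 4) ℂ) - (k 1 - k (-1)) • P.γ5 = 0 := by
    have := congrArg (fun A => P.γ 0 * A * P.γ 0) h1
    simp only [mul_add, add_mul, mul_smul_comm, smul_mul_assoc, mul_one, h0, hγ.γ0_γ5_γ0,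
      mul_zero, zero_mul, smul_neg] at this
    rwa [sub_eq_add_neg]
  have h3 : (2 * (k 1 + k (-1))) • (1 : Matrix (Fin 4) (Fin 4) ℂ) = 0 := by
    rw [← add_zero (0 : Matrix _ _ _)]
    nth_rewrite 1 [← h1]
    rw [← h2]
    module
  have h4 : (2 * (k 1 - k (-1))) • P.γ5 = 0 := by
    rw [← sub_zero (0 : Matrix _ _ _)]
    nth_rewrite 1 [← h1]
    rw [← h2]
    module
  have h5 := (smul_eq_zero_iff_left one_ne_zero).1 h3
  have h6 := (smul_eq_zero_iff_left hγ.γ5_ne_zero).1 h4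
  rcases Int.units_eq_one_or ε with rfl | rfl
  · linear_combination (1 / 4 : ℂ) * h5 + (1 / 4 : ℂ) * h6
  · linear_combination (1 / 4 : ℂ) * h5 - (1 / 4 : ℂ) * h6

theorem Clifford.eq_zero_of_sum_γ0_γε {k : ℤˣ → ℂ} (h : ∑ ε, k ε • (P.γ 0 * P.γε ε) = 0) (ε : ℤˣ) :
    k ε = 0 := by
  have h0 : P.γ 0 * P.γ 0 = 1 := by simpa [η] using hγ.sq 0
  refine hγ.eq_zero_of_sum_γε ?_ ε
  have := congrArg (P.γ 0 * ·) h
  simpa only [Finset.mul_sum, mul_smul_comm, ← mul_assoc, h0, one_mul, mul_zero] using this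

end Clifford

variable {I₁ I₂ I₃ I₄ : Type*} [Fintype I₁] [Fintype I₂] [Fintype I₃] [Fintype I₄]
  {P : Params I₁ I₂ I₃ I₄} {R : List (Fin 4) → List (Fin 4) → Expr I₁ I₂ I₃ I₄}

theorem XD_swap (hP : P.Consistent) (b c : I₁ ⊕ I₂) (ε : ℤˣ) : P.XD c b ε = -P.XD b c ε := by
  have : ∑ a, P.f a c b • P.t a ε = -∑ a, P.f a b c • P.t a ε := by
    rw [← Finset.sum_neg_distrib]
    exact Finset.sum_congr rfl fun a _ => by rw [hP.f_antisymm₂ a c b, neg_smul]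
  rw [XD, XD, this]
  module

theorem scalarShift_gTerm (ν : Fin 4) : scalarShift ν P.gTerm = 0 := by
  simp [-Fintype.sum_sum_type, gTerm, scalarShift, der_mul, u, Φ, jet, der_ι, scalarShiftVal,
    (Multiset.singleton_ne_zero ν).symm]

theorem homotopy_gTerm : homotopy P.gTerm = 0 := by
  simp [-Fintype.sum_sum_type, gTerm, homotopy, der_mul, u, Φ, jet, der_ι, homotopyVal,
    fun ν : Fin 4 => (Multiset.singleton_ne_zero ν).symm]

namespace IsRenormalization

variable (hR : P.IsRenormalization R)
include hR

/-- R contains no Dirac fields, and neither the charge nor a derivative creates undifferentiated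
ones, so the ψ̄ψ u u coefficient vanishes by itself. Independence of γ_0 γ_+ and γ_0 γ_- then
separates the chiralities. -/
theorem XD_eq_zero (hγ : P.Clifford) (hP : P.Consistent) (hE : P.Eliminates R)
    (b c : I₁ ⊕ I₂) (ε : ℤˣ) : P.XD b c ε = 0 := by
  ext A B
  have key : ∀ α β, ∑ ε, P.XD b c ε A B * (P.γ 0 * P.γε ε) α β = 0 := fun α β => by
    have h := toSC_pd_eq_zero (.ψ B β, 0) (hR.toSC_dirac1_add hγ hP hE 0)
    simp only [map_sub, map_add, map_smul, map_sum, P.pd_ψ_dQ_eq_zero B β (hR.mem_words _),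
      pd_ψ_d_eq_zero B β _ (hR.mem_words _), map_zero, Finset.sum_const_zero, smul_zero, sub_zero,
      add_zero] at h
    have h := toSC_pd_eq_zero (.ψbar A α, 0) h
    rw [dirac1, pd_ψbar_pd_ψ_u_u] at h
    have h := toSC_pd_eq_zero (.u c, 0) (toSC_pd_eq_zero (.u b, 0) h)
    rw [pd_pd_u_u] at h
    have h := toSC_smul_one_eq_zero h
    simp only [P.XD_swap hP b c, Matrix.neg_apply, neg_mul, Finset.sum_neg_distrib, neg_neg, η,
      if_true, one_smul] at h
    linear_combination (-1 / 2 : ℂ) * h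
  refine hγ.eq_zero_of_sum_γ0_γε (k := fun ε => P.XD b c ε A B) ?_ ε
  ext α β
  simpa [Matrix.sum_apply] using key α β

theorem toSC_dQ_sub (hγ : P.Clifford) (hP : P.Consistent) (hE : P.Eliminates R) (μ : Fin 4) :
    toSC (0 + P.dQ (R [] [μ]) - Complex.I • ∑ ν, d ν (R [] [μ, ν])) = 0 := by
  have h := hR.toSC_dirac1_add hγ hP hE μ
  have h1 : P.dirac1 μ = 0 := by
    simp only [dirac1, hR.XD_eq_zero hγ hP hE, bil_zero, mul_zero, Finset.sum_const_zero]
  rwa [h1] at h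

theorem toSC_yukawa0_add (hγ : P.Clifford) (hP : P.Consistent) (hE : P.Eliminates R) :
    toSC (P.yukawa0 + P.gTerm + P.dQ (R [] []) - Complex.I • ∑ μ, d μ (R [] [μ])) = 0 := by
  have h := hR.toSC_cohomology hγ hE []
  have hA := P.toSC_nfHom_isSuperComm.map_A00 hP (hR.jacobi hγ hP hE)
    (hR.representation hγ hP hE)
  have h0 : P.dirac0 = 0 := by
    simp only [dirac0, hR.XD_eq_zero hγ hP hE, bil_zero, mul_zero, smul_zero,
      Finset.sum_const_zero]
  have h1 : P.nfHom P.yukawa0 = P.yukawa0 := by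
    simp only [yukawa0, bil, Φ, u, map_sum, map_smul, map_mul, nfHom_jet_zero]
  have h2 : P.nfHom P.gTerm = P.gTerm := by
    simp only [gTerm, Φ, u, map_sum, map_smul, map_mul, nfHom_jet_zero]
  simp only [AlgHom.comp_apply, h0, h1, h2, map_zero, zero_add] at hA
  rw [anomaly, hA, ← map_add, ← map_add] at h
  rw [add_sub_assoc]
  exact h

theorem YD_eq_zero (hγ : P.Clifford) (hP : P.Consistent) (hE : P.Eliminates R)
    (a : I₁ ⊕ I₂) (c : I₂ ⊕ I₃) (ε : ℤˣ) : P.YD a c ε = 0 := by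
  ext A B
  have key : ∀ α β, ∑ ε, P.YD a c ε A B * P.γε ε α β = 0 := fun α β => by
    have hg : pd (.ψ B β, 0) P.gTerm = 0 := by
      simp [gTerm, pd_mul, pd_u, pd_Φ]
    have h := toSC_pd_eq_zero (.ψ B β, 0) (hR.toSC_yukawa0_add hγ hP hE)
    simp only [map_sub, map_add, map_smul, map_sum, P.pd_ψ_dQ_eq_zero B β (hR.mem_words _), hg,
      pd_ψ_d_eq_zero B β _ (hR.mem_words _), map_zero, Finset.sum_const_zero, smul_zero, sub_zero,
      add_zero] at h
    have h := toSC_pd_eq_zero (.ψbar A α, 0) h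
    rw [yukawa0, pd_ψbar_pd_ψ_u_Φ] at h
    have h := toSC_pd_eq_zero (.u a, 0) (toSC_pd_eq_zero (.Φ c, 0) h)
    rw [pd_pd_u_Φ] at h
    exact neg_eq_zero.1 (toSC_smul_one_eq_zero h)
  refine hγ.eq_zero_of_sum_γε (k := fun ε => P.YD a c ε A B) ?_ ε
  ext α β
  simpa [Matrix.sum_apply] using key α β

theorem diracRelations (hγ : P.Clifford) (hP : P.Consistent) (hE : P.Eliminates R) :
    P.DiracRelations :=
  (P.diracRelations_iff hP).2 ⟨hR.XD_eq_zero hγ hP hE, hR.YD_eq_zero hγ hP hE⟩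

/-- R^{μν} is d_Q-closed of ghost number 2 ≠ 4, so the divergence argument forces it to vanish,
leaving d_Q R^μ = 0. -/
theorem toSC_dQ_eq_zero_one (hγ : P.Clifford) (hP : P.Consistent) (hE : P.Eliminates R)
    (μ : Fin 4) : toSC (P.dQ (R [] [μ])) = 0 := by
  have h := hR.toSC_dQ_sub hγ hP hE μ
  have h2 := P.toSC_eq_zero_of_divergence (n := 2) (by norm_num) (fun _ => map_zero _)
    (hR.mem_words [μ]) (fun ν => hR.mem_words [μ, ν])
    (fun ν => toSC_homotopy_eq_zero (hR.toSC_dQ_eq_zero_two hγ hP hE μ ν)) h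
  simpa [map_sub, toSC_d_eq_zero _ (h2 _)] using h

/-- The remaining equation for the scalar self-interaction. -/
theorem toSC_gTerm_add (hγ : P.Clifford) (hP : P.Consistent) (hE : P.Eliminates R) :
    toSC (P.gTerm + P.dQ (R [] [])) = 0 := by
  have h := hR.toSC_yukawa0_add hγ hP hE
  have h0 : P.yukawa0 = 0 := by
    simp only [yukawa0, hR.YD_eq_zero hγ hP hE, bil_zero, mul_zero, Finset.sum_const_zero]
  rw [h0, zero_add] at h
  have h2 := P.toSC_eq_zero_of_divergence (n := 1) (by norm_num) scalarShift_gTerm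
    (hR.mem_words []) (fun ν => hR.mem_words [ν])
    (fun ν => toSC_homotopy_eq_zero (hR.toSC_dQ_eq_zero_one hγ hP hE ν)) h
  simpa [map_sub, toSC_d_eq_zero _ (h2 _)] using h

/-- The homotopy kills `gTerm`, whose letters are undifferentiated, so the homotopy also kills d_Q
R(T,T), although R(T,T) need not be d_Q-closed. -/
theorem exists_scalar (hγ : P.Clifford) (hP : P.Consistent) (hE : P.Eliminates R) :
    ∃ A ∈ words ghostScalar 0, toSC (R [] []) = toSC A := by
  refine P.exists_ghostScalar (hR.mem_words []) ?_
  have := toSC_homotopy_eq_zero (hR.toSC_gTerm_add hγ hP hE)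
  rwa [map_add, homotopy_gTerm, zero_add] at this

end IsRenormalization

end Params
end YM

/-! ### Quartic polynomials in the scalar fields. -/

namespace YM

variable {I₁ I₂ I₃ I₄ : Type*}

/-- The monomial `Φ_{x₀} Φ_{x₁} Φ_{x₂} Φ_{x₃}`. -/
def scalarWord (x : Fin 4 → I₂ ⊕ I₃) : Expr I₁ I₂ I₃ I₄ := Φ (x 0) * Φ (x 1) * Φ (x 2) * Φ (x 3)

/-- Here no letter has negative ghost number, so total ghost number 0 excludes u. -/
theorem words_ghostScalar_zero_le : words (ghostScalar : Set (Jet I₁ I₂ I₃ I₄)) 0 ≤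
    Submodule.span ℂ (Set.range scalarWord) := by
  refine Submodule.span_le.2 ?_
  rintro _ ⟨l, hl, hX, hn, rfl⟩
  have hg : ∀ x ∈ l, 0 ≤ x.1.gh := fun x hx => by
    rcases ghostScalar_cases (hX x hx) with ⟨a, rfl⟩ | ⟨c, rfl⟩ <;> simp [Fld.gh]
  have hΦ : ∀ x ∈ l, ∃ c, x = (.Φ c, 0) := fun x hx => by
    rcases ghostScalar_cases (hX x hx) with ⟨a, rfl⟩ | h
    · have := List.single_le_sum (l := l.map fun x => x.1.gh) (fun y hy => by
        obtain ⟨z, hz, rfl⟩ := List.mem_map.1 hy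
        exact hg z hz) 1 (List.mem_map.2 ⟨_, hx, rfl⟩)
      rw [hn] at this
      exact absurd this (by norm_num)
    · exact h
  match l, hl with
  | [x, y, z, w], _ =>
    obtain ⟨a, rfl⟩ := hΦ x (by simp)
    obtain ⟨b, rfl⟩ := hΦ y (by simp)
    obtain ⟨c, rfl⟩ := hΦ z (by simp)
    obtain ⟨e, rfl⟩ := hΦ w (by simp)
    refine Submodule.subset_span ⟨![a, b, c, e], ?_⟩
    simp [scalarWord, word, Φ, jet, mul_assoc]

variable {S : Type*} [Ring S] [Algebra ℂ S] {φ : Expr I₁ I₂ I₃ I₄ →ₐ[ℂ] S}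

theorem IsSuperComm.map_scalarWord_comp (hφ : IsSuperComm φ) (x : Fin 4 → I₂ ⊕ I₃)
    (σ : Equiv.Perm (Fin 4)) : φ (scalarWord (x ∘ σ)) = φ (scalarWord x) := by
  have h : ∀ x : Fin 4 → I₂ ⊕ I₃, φ (scalarWord x) = (List.ofFn fun i => φ (YM.Φ (x i))).prod :=
    fun x => by simp [scalarWord, List.ofFn_succ, mul_assoc]
  rw [h, h]
  refine List.Perm.prod_eq' (Equiv.Perm.ofFn_comp_perm σ fun i => φ (YM.Φ (x i))) ?_
  refine List.pairwise_of_forall_mem_list fun y hy z hz => ?_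
  obtain ⟨i, rfl⟩ := (List.mem_ofFn' _ _).1 hy
  obtain ⟨j, rfl⟩ := (List.mem_ofFn' _ _).1 hz
  exact (hφ.Φ _).central _

theorem sum_rotate₄ {α β γ δ M : Type*} [Fintype α] [Fintype β] [Fintype γ] [Fintype δ]
    [AddCommMonoid M] (G : α → β → γ → δ → M) :
    ∑ a, ∑ b, ∑ c, ∑ e, G a b c e = ∑ b, ∑ c, ∑ e, ∑ a, G a b c e :=
  Finset.sum_comm.trans <| Finset.sum_congr rfl fun _ _ => Finset.sum_comm.trans <|
    Finset.sum_congr rfl fun _ _ => Finset.sum_comm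

theorem sum₄_eq_sum_fin {ι M : Type*} [Fintype ι] [AddCommMonoid M] (G : (Fin 4 → ι) → M) :
    ∑ a, ∑ b, ∑ c, ∑ e, G ![a, b, c, e] = ∑ x, G x := by
  let E : (ι × ι × ι × ι) ≃ (Fin 4 → ι) :=
    { toFun := fun p => ![p.1, p.2.1, p.2.2.1, p.2.2.2]
      invFun := fun x => (x 0, x 1, x 2, x 3)
      left_inv := fun p => rfl
      right_inv := fun x => by ext i; fin_cases i <;> rfl }
  rw [← E.sum_comp]
  simp only [Fintype.sum_prod_type]
  rfl

/-- Complete symmetry of a tensor of rank four. -/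
structure IsSymmetric₄ {ι : Type*} (h : ι → ι → ι → ι → ℂ) : Prop where
  symm₁ : ∀ a b c e, h a b c e = h b a c e
  symm₂ : ∀ a b c e, h a b c e = h a c b e
  symm₃ : ∀ a b c e, h a b c e = h a b e c

theorem isSymmetric₄_of_perm {ι : Type*} (H : (Fin 4 → ι) → ℂ)
    (hH : ∀ x (σ : Equiv.Perm (Fin 4)), H (x ∘ σ) = H x) :
    IsSymmetric₄ fun a b c e => H ![a, b, c, e] where
  symm₁ a b c e := by
    rw [← hH ![b, a, c, e] (Equiv.swap 0 1)]
    congr 1; ext i; fin_cases i <;> rfl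
  symm₂ a b c e := by
    rw [← hH ![a, c, b, e] (Equiv.swap 1 2)]
    congr 1; ext i; fin_cases i <;> rfl
  symm₃ a b c e := by
    rw [← hH ![a, b, e, c] (Equiv.swap 2 3)]
    congr 1; ext i; fin_cases i <;> rfl

variable [Fintype I₁] [Fintype I₂] [Fintype I₃] [Fintype I₄]

theorem exists_quarticTerm {A : Expr I₁ I₂ I₃ I₄} (hA : A ∈ words ghostScalar 0) :
    ∃ h, IsSymmetric₄ h ∧ toSC A = toSC (Params.quarticTerm h) := by
  classical
  obtain ⟨r, rfl⟩ := (Submodule.mem_span_range_iff_exists_fun ℂ).1 (words_ghostScalar_zero_le hA)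
  -- The coefficients are summed over all 24 permutations; the factor -i makes (i/24)·(-i)·24 = 1.
  refine ⟨_, isSymmetric₄_of_perm (fun x => -Complex.I * ∑ σ : Equiv.Perm (Fin 4), r (x ∘ σ))
    fun x τ => ?_, ?_⟩
  · congr 1
    exact Fintype.sum_equiv (Equiv.mulLeft τ) _ _ fun σ => rfl
  · have hσ : ∀ σ : Equiv.Perm (Fin 4), ∑ x, r (x ∘ σ) • toSC (scalarWord x : Expr I₁ I₂ I₃ I₄) =
        ∑ x, r x • toSC (scalarWord x) := fun σ => by
      refine Fintype.sum_equiv (σ.symm.arrowCongr (Equiv.refl _)) _ _ fun x => ?_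
      rw [← toSC_isSuperComm.map_scalarWord_comp x σ]
      rfl
    have h1 := sum₄_eq_sum_fin fun x => (-Complex.I * ∑ σ : Equiv.Perm (Fin 4), r (x ∘ σ)) •
      toSC (scalarWord x : Expr I₁ I₂ I₃ I₄)
    have h2 : ∑ x, (-Complex.I * ∑ σ : Equiv.Perm (Fin 4), r (x ∘ σ)) •
        toSC (scalarWord x : Expr I₁ I₂ I₃ I₄) =
        (-Complex.I * 24) • ∑ x, r x • toSC (scalarWord x) := by
      simp only [mul_smul, Finset.sum_smul, ← Finset.smul_sum]
      rw [Finset.sum_comm]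
      simp only [hσ]
      rw [Finset.sum_const, Finset.card_univ, Fintype.card_perm, Fintype.card_fin,
        ← Nat.cast_smul_eq_nsmul ℂ]
      norm_num [Nat.factorial]
    rw [h2] at h1
    simp only [Params.quarticTerm, map_smul, map_sum]
    refine Eq.trans ?_ (congrArg ((Complex.I / 24) • ·) h1.symm)
    simp only [smul_smul]
    have : Complex.I / 24 * (-Complex.I * 24) = 1 := by linear_combination -Complex.I_mul_I
    rw [this, one_smul]

namespace Params

variable (P : Params I₁ I₂ I₃ I₄)

/-- The tensor `m_a h_{abcd}` for a vector index `a`. -/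
def mh (h : I₂ ⊕ I₃ → I₂ ⊕ I₃ → I₂ ⊕ I₃ → I₂ ⊕ I₃ → ℂ) (a : I₁ ⊕ I₂) (b c e : I₂ ⊕ I₃) : ℂ :=
  Sum.elim (fun _ => 0) (fun a' => (P.m₂ a' : ℂ) * h (.inl a') b c e) a

theorem dQ_mul (A B : Expr I₁ I₂ I₃ I₄) : P.dQ (A * B) = P.dQ A * B + grading true A * P.dQ B :=
  der_mul _ _ _ _

theorem sum_dQ_Φ {M : Type*} [AddCommGroup M] [Module ℂ M] (k : I₂ ⊕ I₃ → ℂ)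
    (G : Expr I₁ I₂ I₃ I₄ →ₗ[ℂ] M) : ∑ a, k a • G (P.dQ (Φ a)) =
      Complex.I • ∑ a, (Sum.elim (fun _ => 0) (fun a' => (P.m₂ a' : ℂ) * k (.inl a')) a : ℂ) •
        G (u a) := by
  have h : ∀ c, P.dQ (Φ c : Expr I₁ I₂ I₃ I₄) = P.dQval (.Φ c, 0) := fun c => der_ι _ _ _
  simp only [Fintype.sum_sum_type, h, dQval, Sum.elim_inl, Sum.elim_inr, map_smul, map_zero,
    smul_zero, zero_smul, Finset.sum_const_zero, add_zero, zero_add, Finset.smul_sum, smul_smul, u]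
  exact Finset.sum_congr rfl fun a _ => by congr 1; ring

end Params

variable {P : Params I₁ I₂ I₃ I₄}

/-- The four Leibniz terms agree by the symmetry of h, and d_Q Φ_a = i m_a u_a gives 4·(i/24)·i =
-1/6, opposite to the prefactor of `gTerm`. -/
theorem IsSuperComm.map_dQ_quarticTerm (hφ : IsSuperComm φ)
    {h : I₂ ⊕ I₃ → I₂ ⊕ I₃ → I₂ ⊕ I₃ → I₂ ⊕ I₃ → ℂ} (hh : IsSymmetric₄ h) :
    φ (P.dQ (Params.quarticTerm h)) =
      -φ ((1 / 6 : ℂ) • ∑ a, ∑ b, ∑ c, ∑ e, P.mh h a b c e • (YM.u a * (YM.Φ b * (YM.Φ c * YM.Φ e)))) := by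
  set Y : I₂ ⊕ I₃ → I₂ ⊕ I₃ → I₂ ⊕ I₃ → I₂ ⊕ I₃ → S := fun a b c e =>
    φ (P.dQ (YM.Φ a)) * (φ (YM.Φ b) * (φ (YM.Φ c) * φ (YM.Φ e))) with hY
  have hd : ∀ a b c e, φ (P.dQ (YM.Φ a * YM.Φ b * YM.Φ c * YM.Φ e)) =
      Y a b c e + Y b a c e + Y c a b e + Y e a b c := fun a b c e => by
    have hc : ∀ a B, φ B * φ (YM.Φ a) = φ (YM.Φ a) * φ B := fun a B => (hφ.Φ a).central B
    simp only [P.dQ_mul, map_add, map_mul, grading_Φ, hY]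
    simp only [add_mul, mul_assoc]
    rw [mul_left_comm_of (hc a (P.dQ (YM.Φ b))).symm, mul_left_comm_of (hc b (P.dQ (YM.Φ c))).symm,
      mul_left_comm_of (hc a (P.dQ (YM.Φ c))).symm, ← hc c (P.dQ (YM.Φ e)),
      mul_left_comm_of (hc b (P.dQ (YM.Φ e))).symm, mul_left_comm_of (hc a (P.dQ (YM.Φ e))).symm]
  have h1 : ∑ a, ∑ b, ∑ c, ∑ e, h a b c e • Y b a c e = ∑ a, ∑ b, ∑ c, ∑ e, h a b c e • Y a b c e := by
    rw [Finset.sum_comm]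
    exact sum₄_congr fun a b c e => by rw [hh.symm₁]
  have h2 : ∑ a, ∑ b, ∑ c, ∑ e, h a b c e • Y c a b e = ∑ a, ∑ b, ∑ c, ∑ e, h a b c e • Y a b c e := by
    rw [← h1]
    refine Finset.sum_congr rfl fun a _ => ?_
    rw [Finset.sum_comm]
    exact Finset.sum_congr rfl fun b _ => Finset.sum_congr rfl fun c _ =>
      Finset.sum_congr rfl fun e _ => by rw [hh.symm₂]
  have h3 : ∑ a, ∑ b, ∑ c, ∑ e, h a b c e • Y e a b c = ∑ a, ∑ b, ∑ c, ∑ e, h a b c e • Y a b c e := by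
    rw [← h2]
    refine Finset.sum_congr rfl fun a _ => Finset.sum_congr rfl fun b _ => ?_
    rw [Finset.sum_comm]
    exact Finset.sum_congr rfl fun c _ => Finset.sum_congr rfl fun e _ => by rw [hh.symm₃]
  have h4 : ∑ a, ∑ b, ∑ c, ∑ e, h a b c e • Y a b c e = Complex.I • ∑ a, ∑ b, ∑ c, ∑ e,
      P.mh h a b c e • (φ (YM.u a) * (φ (YM.Φ b) * (φ (YM.Φ c) * φ (YM.Φ e)))) := by
    rw [sum_rotate₄, sum_rotate₄ fun a b c e =>
      P.mh h a b c e • (φ (YM.u a) * (φ (YM.Φ b) * (φ (YM.Φ c) * φ (YM.Φ e))))]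
    simp only [Finset.smul_sum (r := Complex.I) (s := (Finset.univ : Finset (I₂ ⊕ I₃)))]
    refine Finset.sum_congr rfl fun b _ => Finset.sum_congr rfl fun c _ =>
      Finset.sum_congr rfl fun e _ => ?_
    exact P.sum_dQ_Φ (fun a => h a b c e)
      ((LinearMap.mulRight ℂ (φ (YM.Φ b) * (φ (YM.Φ c) * φ (YM.Φ e)))) ∘ₗ φ.toLinearMap)
  simp only [Params.quarticTerm, map_smul, map_sum, hd, smul_add, Finset.sum_add_distrib, h1, h2,
    h3, h4, map_mul]
  match_scalars
  linear_combination (1 / 6 : ℂ) * Complex.I_mul_I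

end YM

/-! ### The quartic coupling and the two implications. -/

namespace YM
namespace Params

variable {I₁ I₂ I₃ I₄ : Type*} [Fintype I₁] [Fintype I₂] [Fintype I₃] [Fintype I₄]
  {P : Params I₁ I₂ I₃ I₄}

theorem g_swap₁ (hP : P.Consistent) (a : I₁ ⊕ I₂) (b c e : I₂ ⊕ I₃) : P.g a b c e = P.g a c b e := by
  simp only [g]
  congr 1
  refine Finset.sum_congr rfl fun k _ => ?_
  rw [hP.f''_symm₂ k c b]
  ring

theorem g_swap₂ (hP : P.Consistent) (a : I₁ ⊕ I₂) (b c e : I₂ ⊕ I₃) : P.g a b c e = P.g a b e c := by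
  simp only [g]
  congr 1
  refine Finset.sum_congr rfl fun k _ => ?_
  rw [hP.f''_symm₂ k e c]
  ring

theorem IsQuarticCoupling.isSymmetric₄ {h : I₂ ⊕ I₃ → I₂ ⊕ I₃ → I₂ ⊕ I₃ → I₂ ⊕ I₃ → ℂ}
    (hh : P.IsQuarticCoupling h) : IsSymmetric₄ h :=
  ⟨hh.symm₁, hh.symm₂, hh.symm₃⟩

theorem IsQuarticCoupling.mh_eq_g (hm : ∀ a, 0 < P.m₂ a)
    {h : I₂ ⊕ I₃ → I₂ ⊕ I₃ → I₂ ⊕ I₃ → I₂ ⊕ I₃ → ℂ} (hh : P.IsQuarticCoupling h)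
    (hS : P.ScalarRelations) (a : I₁ ⊕ I₂) (b c e : I₂ ⊕ I₃) : P.mh h a b c e = P.g a b c e := by
  rcases a with a | a
  · rw [hS.1]; rfl
  · change (P.m₂ a : ℂ) * h (.inl a) b c e = _
    have : (P.m₂ a : ℂ) ≠ 0 := by exact_mod_cast (hm a).ne'
    rw [hh.eq]
    field_simp

/-! Necessity of the relations. -/

namespace IsRenormalization

variable {R : List (Fin 4) → List (Fin 4) → Expr I₁ I₂ I₃ I₄} (hR : P.IsRenormalization R)
include hR

/-- The renormalization of `(T,T)` is quartic in the scalar fields, with coefficients determined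
by `g`. -/
theorem exists_coupling (hγ : P.Clifford) (hP : P.Consistent) (hE : P.Eliminates R) :
    ∃ h, IsSymmetric₄ h ∧ toSC (R [] []) = toSC (quarticTerm h) ∧
      ∀ a b c e, P.g a b c e = P.mh h a b c e := by
  obtain ⟨A, hA, hRA⟩ := hR.exists_scalar hγ hP hE
  obtain ⟨h, hh, hAh⟩ := exists_quarticTerm hA
  refine ⟨h, hh, hRA.trans hAh, fun a b c e => ?_⟩
  have h1 := hR.toSC_gTerm_add hγ hP hE
  have h2 : toSC (P.dQ (R [] [])) = toSC (P.dQ (quarticTerm h)) :=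
    toSC_der_congr P.dQval_superCommutes (hRA.trans hAh)
  rw [map_add, h2, toSC_isSuperComm.map_dQ_quarticTerm hh, gTerm, ← sub_eq_add_neg, ← map_sub,
    ← smul_sub, map_smul, smul_eq_zero_iff_right (by norm_num)] at h1
  simp only [← Finset.sum_sub_distrib, ← sub_smul] at h1
  have h3 := toSC_pd_eq_zero (.u a, 0) (toSC_pd_eq_zero (.Φ e, 0) (toSC_pd_eq_zero (.Φ c, 0)
    (toSC_pd_eq_zero (.Φ b, 0) h1)))
  rw [pd_u_Φ_Φ_Φ] at h3
  have h4 := toSC_smul_one_eq_zero h3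
  have m1 : ∀ b c e, P.mh h a b c e = P.mh h a c b e := fun b c e => by
    rcases a with a | a
    · rfl
    · rw [mh, mh, Sum.elim_inr, Sum.elim_inr, hh.symm₂]
  have m2 : ∀ b c e, P.mh h a b c e = P.mh h a b e c := fun b c e => by
    rcases a with a | a
    · rfl
    · rw [mh, mh, Sum.elim_inr, Sum.elim_inr, hh.symm₃]
  -- Differentiation gives all six orders of the scalar indices; both tensors are symmetric in
  -- these, so the six terms coincide.
  rw [P.g_swap₂ hP a b e c, P.g_swap₁ hP a c b e, P.g_swap₂ hP a c e b, P.g_swap₁ hP a c b e,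
    P.g_swap₁ hP a e b c, P.g_swap₂ hP a b e c, P.g_swap₁ hP a e c b, P.g_swap₂ hP a c e b,
    P.g_swap₁ hP a c b e, m2 b e c, m1 c b e, m2 c e b, m1 c b e, m1 e b c, m2 b e c, m1 e c b,
    m2 c e b, m1 c b e] at h4
  linear_combination (1 / 6 : ℂ) * h4

/-- From g = m h the massless components of g vanish, and dividing by m_a turns the symmetry of h in
its first two indices into the remaining part of (iv). -/
theorem exists_isQuarticCoupling (hm : ∀ a, 0 < P.m₂ a) (hγ : P.Clifford) (hP : P.Consistent)
    (hE : P.Eliminates R) :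
    P.ScalarRelations ∧ ∃ h, P.IsQuarticCoupling h ∧ P.toWick (R [] []) = P.toWick (quarticTerm h) := by
  obtain ⟨h, hh, hRh, hg⟩ := hR.exists_coupling hγ hP hE
  have hg' : ∀ (a : I₂) b c e, 1 / (P.m₂ a : ℂ) * P.g (.inr a) b c e = h (.inl a) b c e :=
    fun a b c e => by
      have : (P.m₂ a : ℂ) ≠ 0 := by exact_mod_cast (hm a).ne'
      rw [hg]
      change 1 / (P.m₂ a : ℂ) * ((P.m₂ a : ℂ) * h (.inl a) b c e) = _
      field_simp
  refine ⟨⟨fun a b c e => hg _ _ _ _, fun a b c e => ?_⟩, h,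
    ⟨hh.symm₁, hh.symm₂, hh.symm₃, fun a b c e => (hg' a b c e).symm⟩,
    P.toWick_isSuperComm.eq_of_toSC_eq hRh⟩
  rw [hg', hg', hh.symm₁]

end IsRenormalization

/-! Sufficiency of the relations. -/

/-- The symmetric tensor with `h_{abcd} = k_{abcd}` for `a ∈ I₂`, the component on `I₃` being
zero. -/
def extendCoupling {ι κ : Type*} (k : ι → ι ⊕ κ → ι ⊕ κ → ι ⊕ κ → ℂ) :
    ι ⊕ κ → ι ⊕ κ → ι ⊕ κ → ι ⊕ κ → ℂ
  | .inl a, b, c, e => k a b c e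
  | .inr a, .inl b, c, e => k b (.inr a) c e
  | .inr a, .inr b, .inl c, e => k c (.inr a) (.inr b) e
  | .inr a, .inr b, .inr c, .inl e => k e (.inr a) (.inr b) (.inr c)
  | .inr _, .inr _, .inr _, .inr _ => 0

/-- The definition puts the leftmost index in I₂ first. By `x1` and the symmetry in the other slots,
any other index in I₂ could be chosen instead. -/
theorem extendCoupling_isSymmetric₄ {ι κ : Type*} {k : ι → ι ⊕ κ → ι ⊕ κ → ι ⊕ κ → ℂ}
    (g1 : ∀ a b c e, k a b c e = k a c b e) (g2 : ∀ a b c e, k a b c e = k a b e c)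
    (x1 : ∀ a b c e, k a (.inl b) c e = k b (.inl a) c e) : IsSymmetric₄ (extendCoupling k) := by
  have x2 : ∀ a b c e, k a c (.inl b) e = k b c (.inl a) e := fun a b c e => by
    rw [g1, x1, g1]
  have x3 : ∀ a b c e, k a c e (.inl b) = k b c e (.inl a) := fun a b c e => by
    rw [g2, x2, g2]
  refine ⟨?_, ?_, ?_⟩
  · rintro (a | a) (b | b) (c | c) (e | e) <;> simp only [extendCoupling] <;>
      first | exact x1 _ _ _ _ | exact g1 _ _ _ _
  · rintro (a | a) (b | b) (c | c) (e | e) <;> simp only [extendCoupling] <;>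
      first | exact x2 _ _ _ _ | exact g1 _ _ _ _ | exact g2 _ _ _ _
  · rintro (a | a) (b | b) (c | c) (e | e) <;> simp only [extendCoupling] <;>
      first | exact x3 _ _ _ _ | exact g2 _ _ _ _

theorem exists_isQuarticCoupling (hP : P.Consistent) (hS : P.ScalarRelations) :
    ∃ h, P.IsQuarticCoupling h := by
  have := extendCoupling_isSymmetric₄
    (k := fun (a : I₂) (b c e : I₂ ⊕ I₃) => 1 / (P.m₂ a : ℂ) * P.g (.inr a) b c e)
    (fun a b c e => by rw [P.g_swap₁ hP]) (fun a b c e => by rw [P.g_swap₂ hP]) hS.2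
  exact ⟨_, this.symm₁, this.symm₂, this.symm₃, fun a b c e => rfl⟩

variable {h : I₂ ⊕ I₃ → I₂ ⊕ I₃ → I₂ ⊕ I₃ → I₂ ⊕ I₃ → ℂ}

theorem Rs_append (I J : List (Fin 4)) (μ : Fin 4) : (Rs h I (J ++ [μ]) : Expr I₁ I₂ I₃ I₄) = 0 := by
  cases I <;> cases J <;> rfl

theorem Rs_append_left (I J : List (Fin 4)) (μ : Fin 4) :
    (Rs h (I ++ [μ]) J : Expr I₁ I₂ I₃ I₄) = 0 := by
  cases I <;> rfl

theorem Rs_isRenormalization (P : Params I₁ I₂ I₃ I₄) : P.IsRenormalization (Rs h) where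
  mem I J := by
    rcases I with _ | ⟨μ, I⟩
    · rcases J with _ | ⟨ν, J⟩
      · refine Submodule.smul_mem _ _ <| Submodule.sum_mem _ fun a _ => Submodule.sum_mem _ fun b _ =>
          Submodule.sum_mem _ fun c _ => Submodule.sum_mem _ fun e _ => Submodule.smul_mem _ _ <|
          Submodule.subset_span ⟨(.Φ a, 0), (.Φ b, 0), (.Φ c, 0), (.Φ e, 0), rfl, rfl, ?_⟩
        norm_num [Jet.dim, Fld.dim]
      · exact Submodule.zero_mem _
    · exact Submodule.zero_mem _
  symm I J := by
    rcases I with _ | ⟨μ, I⟩ <;> rcases J with _ | ⟨ν, J⟩ <;> simp [Rs]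
  antisymm μ ν J := by simp [Rs]
  trunc I J hI := by
    rcases I with _ | ⟨μ, I⟩
    · simp at hI
    · simp [Rs]

/-- Valid for every supercommuting homomorphism, so the cancellation holds before the equations of
motion are imposed. Divergences do not appear because the other components of the renormalization
are zero. -/
theorem map_anomaly_add {S : Type*} [Ring S] [Algebra ℂ S] {φ : Expr I₁ I₂ I₃ I₄ →ₐ[ℂ] S}
    (hφ : IsSuperComm φ) (hm : ∀ a, 0 < P.m₂ a) (hP : P.Consistent)
    (hJ : P.Jacobi) (hR : P.Representation) (hD : P.DiracRelations) (hS : P.ScalarRelations)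
    (hh : P.IsQuarticCoupling h) (I J : List (Fin 4)) :
    φ (P.anomaly I J + P.dQ (Rs h I J)) = 0 := by
  obtain ⟨hX, hY⟩ := (P.diracRelations_iff hP).1 hD
  have h1 : ∀ μ, φ (P.A10 μ) = 0 := fun μ => by
    rw [hφ.map_A10 hP hJ, hφ.map_scalar1 (hP.representation_iff.1 hR)]
    simp only [dirac1, hX, bil_zero, mul_zero, Finset.sum_const_zero, map_zero, add_zero]
  have h0 : φ (P.A00 + P.dQ (quarticTerm h)) = 0 := by
    rw [map_add, hφ.map_A00 hP hJ hR, hφ.map_dQ_quarticTerm hh.isSymmetric₄]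
    simp only [hh.mh_eq_g hm hS]
    simp only [dirac0, yukawa0, hX, hY, bil_zero, mul_zero, smul_zero, Finset.sum_const_zero,
      map_zero, add_zero, zero_add]
    exact add_neg_cancel _
  unfold anomaly
  split
  · exact h0
  all_goals simp [Rs, h1, hφ.map_A11 hP hJ]

theorem Rs_eliminates (hm : ∀ a, 0 < P.m₂ a) (hP : P.Consistent)
    (hJ : P.Jacobi) (hR : P.Representation) (hD : P.DiracRelations) (hS : P.ScalarRelations)
    (hh : P.IsQuarticCoupling h) : P.Eliminates (Rs h) := fun I J => by
  refine ⟨?_, fun ρ => ?_⟩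
  · simp only [sR, Rs_append, map_zero, Finset.sum_const_zero, smul_zero, sub_zero]
    exact map_anomaly_add P.toWick_isSuperComm hm hP hJ hR hD hS hh I J
  · simp only [sR', Rs_append, Rs_append_left, smul_zero, sub_zero, map_zero]

end Params
end YM

end

theorem mainTheorem1 {I₁ I₂ I₃ I₄ : Type*}
    [Fintype I₁] [Fintype I₂] [Fintype I₃] [Fintype I₄]
    (P : YM.Params I₁ I₂ I₃ I₄) (hm : ∀ a, 0 < P.m₂ a) (hγ : P.Clifford) (hP : P.Consistent) :
    ((∃ R, P.IsRenormalization R ∧ P.Eliminates R) ↔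
      (P.Jacobi ∧ P.Representation ∧ P.DiracRelations ∧ P.ScalarRelations)) ∧
    ((P.Jacobi ∧ P.Representation ∧ P.DiracRelations ∧ P.ScalarRelations) →
      (∃ h, P.IsQuarticCoupling h) ∧
      ∀ h, P.IsQuarticCoupling h →
        P.IsRenormalization (YM.Params.Rs h) ∧ P.Eliminates (YM.Params.Rs h)) ∧
    (∀ R, P.IsRenormalization R → P.Eliminates R →
      ∃ h, P.IsQuarticCoupling h ∧
        P.toWick (R [] []) = P.toWick (YM.Params.quarticTerm h)) := by
  have hb : (P.Jacobi ∧ P.Representation ∧ P.DiracRelations ∧ P.ScalarRelations) →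
      (∃ h, P.IsQuarticCoupling h) ∧
      ∀ h, P.IsQuarticCoupling h →
        P.IsRenormalization (YM.Params.Rs h) ∧ P.Eliminates (YM.Params.Rs h) :=
    fun ⟨hJ, hT, hD, hS⟩ => ⟨YM.Params.exists_isQuarticCoupling hP hS, fun h hh =>
      ⟨YM.Params.Rs_isRenormalization P, YM.Params.Rs_eliminates hm hP hJ hT hD hS hh⟩⟩
  refine ⟨⟨?_, fun h => ?_⟩, hb, fun R hR hE => (hR.exists_isQuarticCoupling hm hγ hP hE).2⟩
  · rintro ⟨R, hR, hE⟩
    exact ⟨hR.jacobi hγ hP hE, hR.representation hγ hP hE, hR.diracRelations hγ hP hE,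
      (hR.exists_isQuarticCoupling hm hγ hP hE).1⟩
  · obtain ⟨⟨k, hk⟩, h'⟩ := hb h
    exact ⟨_, h' k hk⟩
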